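/- **Model.** There are $m$ businesses $j\in[m]$ and consumers $i=1,2,\dots$ who arrive one per round. A market $\mathcal M$ consists of - true parameters $(\pi_j,Q_j)$ with fit probability $\pi_j\in(0,1)$ and quality $Q_j\in[0,1]$, - fixed prices $P_j\ge 0$, - a value distribution $\mathcal D^V$ that has a density and is supported in some $[0,\overline V]$, - a common prior under which all $\pi_j$ and $Q_j$ are independent, where the true $\pi_j$ and $Q_j$ lie in the supports of their priors, - a search cost $c\ge 0$. Values $V_i\sim\mathcal D^V$, fits $F_{ij}\sim\mathrm{Bernoulli}(\pi_j)$ and quality realizations $q_{ij}\sim\mathrm{Bernoulli}(Q_j)$ are all independent. Consumer $i$ knows $V_i$, the prior, and the history $H_{i-1}$ of all earlier rounds. She inspects businesses sequentially. Each inspection costs $c$ and reveals $F_{ij}$, and what she does next may depend on what she has seen. She then stops and transacts with at most one inspected business. Her utility $U_i$ is $V_i\,\mathbf 1[F_{ij}=q_{ij}=1]-P_j$ if she transacts with $j$ (and $0$ if she does not transact), minus $c$ times the number of inspections. After each round, the fits of the inspected businesses, the business transacted with (if any) and its quality realization are appended to the public history. Consumers are Bayesian-rational: each uses a search policy that maximizes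 her expected utility under the posterior given $H_{i-1}$. Ties are broken in favour of inaction: - she inspects a business only if omitting this inspection (and then continuing in any way that never inspects this business) is strictly worse, - she never transacts with a business that failed inspection (relevant only at price $0$). All other ties (for instance, between search orders) are broken arbitrarily, as a function of the history and, measurably, of the value. **Long-term outcomes.** For an infinite history, business $j$ is *learned* if the posterior beliefs about $\pi_j$ and about $Q_j$ given $H_{i-1}$ converge in probability, as $i\to\infty$, to the true values $\pi_j$ and $Q_j$. That is, for each $\varepsilon>0$ the posterior mass at distance at least $\varepsilon$ from the true value tends to $0$. The *learned set* $L(\mathcal M)$ is the set of learned businesses. For $S\subseteq[m]$ let $U^*(S)$ be the optimal expected utility, over $V\sim\mathcal D^V$, of a consumer who knows the true parameters and may use only businesses in $S$. The *limit consumer utility* is $U(\mathcal M):=U^*(L(\mathcal M))$. Both $L(\mathcal M)$ and $U(\mathcal M)$ are random through the history. **Theorem.** Let $\mathcal M$ and $\widetilde{\mathcal M}$ be markets that are identical except that their search costs $c$ and $\tilde c$ satisfy $0\le\tilde c<c$. Then there is a coupling of their infinite histories (a joint distribution with the correct marginals) under which, almost surely, 1. $L(\widetilde{\mathcal M})\supseteq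 L(\mathcal M)$, 2. $U(\widetilde{\mathcal M})\ge U(\mathcal M)$, where, also almost surely, in each of the two markets $U(\cdot)$ is the limit as $i\to\infty$ of the conditional expected utility $\mathbb E[U_i\mid H_{i-1}]$, both when the expectation is taken under the true parameters and when it is taken under the posterior belief given $H_{i-1}$. -/

import Mathlib

open MeasureTheory ProbabilityTheory Filter Topology
open scoped ENNReal unitInterval

noncomputable section

/-- Business parameters: for each of the `m` businesses the pair
(fit probability, quality). -/
abbrev Params (m : ℕ) : Type := Fin m → I × I

/-- A market with `m` businesses and exogenous prices. -/
structure Market (m : ℕ) where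
  /-- the true parameters: `(param j).1` is the fit probability of `j`, `(param j).2` its quality -/
  param : Params m
  price : Fin m → ℝ
  /-- the distribution of consumer values -/
  valueLaw : Measure ℝ
  valueBound : ℝ
  /-- the prior over the fit probability of each business -/
  fitPrior : Fin m → Measure I
  /-- the prior over the quality of each business -/
  qualityPrior : Fin m → Measure I
  /-- the search cost per inspection -/
  cost : ℝ
  price_nonneg : ∀ j, 0 ≤ price j
  cost_nonneg : 0 ≤ cost
  valueLaw_prob : IsProbabilityMeasure valueLaw
  /-- the value distribution admits a density -/
  valueLaw_density : valueLaw ≪ volume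
  valueLaw_bounded : valueLaw (Set.Icc 0 valueBound)ᶜ = 0
  fitPrior_prob : ∀ j, IsProbabilityMeasure (fitPrior j)
  qualityPrior_prob : ∀ j, IsProbabilityMeasure (qualityPrior j)
  fit_pos : ∀ j, 0 < (param j).1
  fit_lt_one : ∀ j, (param j).1 < 1
  /-- the parameters are a potential realization of the prior -/
  fit_mem_support : ∀ j, (param j).1 ∈ (fitPrior j).support
  quality_mem_support : ∀ j, (param j).2 ∈ (qualityPrior j).support

attribute [instance] Market.valueLaw_prob Market.fitPrior_prob Market.qualityPrior_prob

/-- The market that differs from `M` only in its search cost, which is `c`. -/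
def Market.withCost {m : ℕ} (M : Market m) (c : ℝ) (hc : 0 ≤ c) : Market m :=
  { M with cost := c, cost_nonneg := hc }

/-! ### Search by one consumer -/

/-- A sequential search policy: halt (and transact with at most one business), or inspect a
business and continue depending on whether it is a fit. -/
inductive SearchPolicy (m : ℕ) : Type
  | halt (choice : Option (Fin m)) : SearchPolicy m
  | inspect (j : Fin m) (ifFit ifUnfit : SearchPolicy m) : SearchPolicy m

namespace SearchPolicy

variable {m : ℕ}

instance : MeasurableSpace (SearchPolicy m) := ⊤

/-- `T.IsAdmissible A`: after the businesses in `A` were inspected, `T` never inspects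
a business twice and transacts only with an inspected business. -/
def IsAdmissible : SearchPolicy m → Finset (Fin m) → Prop
  | halt none, _ => True
  | halt (some j), A => j ∈ A
  | inspect j T₁ T₀, A => j ∉ A ∧ T₁.IsAdmissible (insert j A) ∧ T₀.IsAdmissible (insert j A)

/-- Result of the policy on the fit profile `F`: the set of inspected businesses, and the business
transacted with, if any. -/
def run : SearchPolicy m → (Fin m → Bool) → Finset (Fin m) × Option (Fin m)
  | halt o, _ => (∅, o)
  | inspect j T₁ T₀, F =>
      let r := bif F j then T₁.run F else T₀.run F
      (insert j r.1, r.2)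

end SearchPolicy

/-- The feedback of one round: the fit of each business that was inspected (`none` if it was not
inspected), and the business transacted with, if any, together with its quality realization. -/
structure Feedback (m : ℕ) where
  fits : Fin m → Option Bool
  transaction : Option (Fin m × Bool)

instance {m : ℕ} : MeasurableSpace (Feedback m) := ⊤

/-- The feedback that policy `T` produces on the fit profile `F` and the quality realizations `q`. -/
def SearchPolicy.feedback {m : ℕ} (T : SearchPolicy m) (F q : Fin m → Bool) : Feedback m where
  fits j := if j ∈ (T.run F).1 then some (F j) else none
  transaction := (T.run F).2.map fun j => (j, q j)

/-- Joint law of the fit profile and the quality realizations of one consumer, if the business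
parameters are `θ`: all coordinates are independent. -/
def fitQualityLaw {m : ℕ} (θ : Params m) : Measure ((Fin m → Bool) × (Fin m → Bool)) :=
  (Measure.pi fun j => bernoulliMeasure true false (θ j).1).prod
    (Measure.pi fun j => bernoulliMeasure true false (θ j).2)

instance {m : ℕ} (θ : Params m) : IsProbabilityMeasure (fitQualityLaw θ) := by
  unfold fitQualityLaw; infer_instance

/-- Histories of finite length, most recent round first. -/
abbrev FiniteHistory (m : ℕ) : Type := List (Feedback m)

/-- Infinite histories; `h n` is the feedback of round `n`. -/
abbrev History (m : ℕ) : Type := ℕ → Feedback m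

/-- The first `n` rounds of an infinite history. -/
def History.take {m : ℕ} (h : History m) : ℕ → FiniteHistory m
  | 0 => []
  | n + 1 => h n :: History.take h n

/-- How consumers search: the policy used after a given history by a consumer with a given value. -/
abbrev ConsumerRule (m : ℕ) : Type := FiniteHistory m → ℝ → SearchPolicy m

namespace Market

variable {m : ℕ}

/-- Utility of a consumer with value `V` who uses policy `T`: the transaction utility (the value,
if the transaction meets the need, minus the price) minus the total search cost. -/
def utility (M : Market m) (V : ℝ) (T : SearchPolicy m) (F q : Fin m → Bool) : ℝ :=
  (match (T.run F).2 with
    | none => 0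
    | some j => (if F j = true ∧ q j = true then V else 0) - M.price j)
  - M.cost * ((T.run F).1.card : ℝ)

/-- Expected utility of policy `T` for a consumer with value `V` and belief `ν` over the
parameters. -/
def expectedUtility (M : Market m) (ν : Measure (Params m)) (V : ℝ) (T : SearchPolicy m) : ℝ :=
  ∫ θ, ∫ x, M.utility V T x.1 x.2 ∂(fitQualityLaw θ) ∂ν

/-- `T` is a best response to the belief `ν`, with ties broken in favour of inaction. -/
structure IsBestResponse (M : Market m) (ν : Measure (Params m)) (V : ℝ) (T : SearchPolicy m) :
    Prop where
  admissible : T.IsAdmissible ∅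
  optimal : ∀ T' : SearchPolicy m, T'.IsAdmissible ∅ →
    M.expectedUtility ν V T' ≤ M.expectedUtility ν V T
  /-- No transaction with a business that failed inspection. As prices are nonnegative, this only
  breaks a tie at price zero. -/
  transacts_fit : ∀ (F : Fin m → Bool) (j : Fin m), (T.run F).2 = some j → F j = true
  /-- No unneeded inspection: a policy that omits the inspection of some `j` in some of the events
  in which `T` inspects `j` (and may then continue in any way that never inspects `j`), and that
  otherwise acts like `T`, is strictly worse. -/
  inspects_needed : ∀ (j : Fin m) (T' : SearchPolicy m), T'.IsAdmissible ∅ →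
    (∀ F, T'.run F = T.run F ∨ (j ∈ (T.run F).1 ∧ j ∉ (T'.run F).1)) →
    (∃ F, j ∈ (T.run F).1 ∧ j ∉ (T'.run F).1) →
    M.expectedUtility ν V T' < M.expectedUtility ν V T

/-! ### Beliefs and histories -/

/-- The law of one round: the value of the consumer, her fit profile and quality realizations. -/
def roundLaw (M : Market m) (θ : Params m) :
    Measure (ℝ × (Fin m → Bool) × (Fin m → Bool)) :=
  M.valueLaw.prod (fitQualityLaw θ)

instance (M : Market m) (θ : Params m) : IsProbabilityMeasure (M.roundLaw θ) := by
  unfold roundLaw; infer_instance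

/-- The common prior over the parameters of all businesses: all parameters are independent. -/
def prior (M : Market m) : Measure (Params m) :=
  Measure.pi fun j => (M.fitPrior j).prod (M.qualityPrior j)

/-- The probability of the finite history `H` if the business parameters are `θ`. -/
def likelihood (M : Market m) (s : ConsumerRule m) : FiniteHistory m → Params m → ℝ≥0∞
  | [], _ => 1
  | h :: H, θ =>
      M.likelihood s H θ * M.roundLaw θ {x | (s H x.1).feedback x.2.1 x.2.2 = h}

/-- The posterior belief over the parameters given the finite history `H`, by Bayes' rule. -/
def posterior (M : Market m) (s : ConsumerRule m) (H : FiniteHistory m) : Measure (Params m) :=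
  (∫⁻ θ, M.likelihood s H θ ∂M.prior)⁻¹ • M.prior.withDensity (M.likelihood s H)

/-- The posterior belief over the fit probability of business `j`. -/
def fitBelief (M : Market m) (s : ConsumerRule m) (H : FiniteHistory m) (j : Fin m) : Measure I :=
  (M.posterior s H).map fun θ => (θ j).1

/-- The posterior belief over the quality of business `j`. -/
def qualityBelief (M : Market m) (s : ConsumerRule m) (H : FiniteHistory m) (j : Fin m) :
    Measure I :=
  (M.posterior s H).map fun θ => (θ j).2

/-- Every consumer is Bayesian-rational: after each history and for each value, the policy is a
best response to the posterior belief. -/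
structure IsRational (M : Market m) (s : ConsumerRule m) : Prop where
  measurable : ∀ H, Measurable (s H)
  bestResponse : ∀ H, ∀ V ∈ Set.Icc 0 M.valueBound, M.IsBestResponse (M.posterior s H) V (s H V)

end Market

/-- The history up to round `n`, as a function of the primitive randomness `ω`, where `ω n`
consists of the value, fit profile and quality realizations of consumer `n`. -/
def historyUpTo {m : ℕ} (s : ConsumerRule m)
    (ω : ℕ → ℝ × (Fin m → Bool) × (Fin m → Bool)) : ℕ → FiniteHistory m
  | 0 => []
  | n + 1 =>
      (s (historyUpTo s ω n) (ω n).1).feedback (ω n).2.1 (ω n).2.2 :: historyUpTo s ω n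

/-- The infinite history, as a function of the primitive randomness. -/
def fullHistory {m : ℕ} (s : ConsumerRule m)
    (ω : ℕ → ℝ × (Fin m → Bool) × (Fin m → Bool)) : History m :=
  fun n => (s (historyUpTo s ω n) (ω n).1).feedback (ω n).2.1 (ω n).2.2

namespace Market

variable {m : ℕ}

/-- The law of the infinite history of the market; the rounds are i.i.d. under the true
parameters. -/
def historyLaw (M : Market m) (s : ConsumerRule m) : Measure (History m) :=
  (Measure.infinitePi fun _ : ℕ => M.roundLaw M.param).map (fullHistory s)

/-! ### Long-term outcomes -/

/-- Business `j` is learned in the history `h`: the beliefs about its fit probability and its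
quality converge in probability to the true values. -/
def IsLearned (M : Market m) (s : ConsumerRule m) (h : History m) (j : Fin m) : Prop :=
  ∀ ε : ℝ, 0 < ε →
    Tendsto (fun n => M.fitBelief s (h.take n) j {p | ε ≤ dist p (M.param j).1}) atTop (𝓝 0) ∧
    Tendsto (fun n => M.qualityBelief s (h.take n) j {p | ε ≤ dist p (M.param j).2}) atTop (𝓝 0)

/-- The learned set. -/
def learnedSet (M : Market m) (s : ConsumerRule m) (h : History m) : Set (Fin m) :=
  {j | M.IsLearned s h j}

/-- Optimal expected utility of a consumer who knows the parameters and may use only the businesses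
in `S`. -/
def optimalUtility (M : Market m) (S : Set (Fin m)) : ℝ :=
  ∫ V, (⨆ T : {T : SearchPolicy m // T.IsAdmissible ∅ ∧ ∀ F, ∀ j ∈ (T.run F).1, j ∈ S},
    M.expectedUtility (Measure.dirac M.param) V T.1) ∂M.valueLaw

/-- Limit consumer utility in the history `h`. -/
def limitUtility (M : Market m) (s : ConsumerRule m) (h : History m) : ℝ :=
  M.optimalUtility (M.learnedSet s h)

/-- Expected utility of the consumer who arrives after the finite history `H`, where the parameters
are distributed according to `ν`. -/
def consumerUtility (M : Market m) (s : ConsumerRule m) (ν : Measure (Params m))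
    (H : FiniteHistory m) : ℝ :=
  ∫ V, M.expectedUtility ν V (s H V) ∂M.valueLaw

/-- Along the history `h` the expected utility of the next consumer given the past converges to
`u`, both under the true parameters and under the belief of the consumer. -/
def UtilityTendsto (M : Market m) (s : ConsumerRule m) (h : History m) (u : ℝ) : Prop :=
  Tendsto (fun n => M.consumerUtility s (Measure.dirac M.param) (h.take n)) atTop (𝓝 u) ∧
  Tendsto (fun n => M.consumerUtility s (M.posterior s (h.take n)) (h.take n)) atTop (𝓝 u)

end Market

end

noncomputable section

/-! ### Search policies as functions of the fit profile -/

namespace SearchPolicy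

variable {m : ℕ}

/-- The run of a policy depends only on the fits of the inspected businesses. -/
theorem run_congr (T : SearchPolicy m) {F F' : Fin m → Bool}
    (h : ∀ j ∈ (T.run F).1, F' j = F j) : T.run F' = T.run F := by
  induction T with
  | halt o => rfl
  | inspect j T₁ T₀ ih₁ ih₀ =>
    have hj : F' j = F j := h j (by simp [run])
    cases hF : F j <;> simp only [run, hj, hF, cond_true, cond_false] at h ⊢
    · rw [ih₀ fun i hi => h i (Finset.mem_insert_of_mem hi)]
    · rw [ih₁ fun i hi => h i (Finset.mem_insert_of_mem hi)]

/-- Whether `i` is inspected does not depend on the fit of `i`. -/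
theorem mem_run_congr (T : SearchPolicy m) {i : Fin m} {F F' : Fin m → Bool}
    (h : ∀ j, j ≠ i → F' j = F j) : i ∈ (T.run F').1 ↔ i ∈ (T.run F).1 := by
  induction T with
  | halt o => simp [run]
  | inspect j T₁ T₀ ih₁ ih₀ =>
    by_cases hij : j = i
    · simp [run, hij]
    · cases hF : F j <;> simp [run, h j hij, hF, ih₁, ih₀]

theorem IsAdmissible.choice_mem {T : SearchPolicy m} {A : Finset (Fin m)} (hT : T.IsAdmissible A)
    {F : Fin m → Bool} {j : Fin m} (hj : (T.run F).2 = some j) : j ∈ A ∪ (T.run F).1 := by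
  induction T generalizing A with
  | halt o =>
    simp only [run] at hj
    subst hj
    exact Finset.mem_union_left _ hT
  | inspect i T₁ T₀ ih₁ ih₀ =>
    cases hF : F i <;> simp only [run, hF, cond_true, cond_false] at hj ⊢
    · have := ih₀ hT.2.2 hj
      simp only [Finset.mem_union, Finset.mem_insert] at this ⊢
      tauto
    · have := ih₁ hT.2.1 hj
      simp only [Finset.mem_union, Finset.mem_insert] at this ⊢
      tauto

theorem IsAdmissible.choice_mem_run {T : SearchPolicy m} (hT : T.IsAdmissible ∅)
    {F : Fin m → Bool} {j : Fin m} (hj : (T.run F).2 = some j) : j ∈ (T.run F).1 := by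
  simpa using hT.choice_mem hj

/-- The policy that acts like `T` but never inspects `j`: it proceeds as if `j` were not a fit. -/
def without (j : Fin m) : SearchPolicy m → SearchPolicy m
  | halt o => halt (if o = some j then none else o)
  | inspect i T₁ T₀ =>
      if i = j then T₀.without j else inspect i (T₁.without j) (T₀.without j)

theorem IsAdmissible.without {T : SearchPolicy m} {A : Finset (Fin m)} (hT : T.IsAdmissible A)
    (j : Fin m) : (T.without j).IsAdmissible (A.erase j) := by
  induction T generalizing A with
  | halt o =>
    cases o with
    | none => simp [SearchPolicy.without, IsAdmissible]
    | some i =>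
      by_cases hij : i = j
      · simp [SearchPolicy.without, IsAdmissible, hij]
      · simpa [SearchPolicy.without, IsAdmissible, hij] using hT
  | inspect i T₁ T₀ ih₁ ih₀ =>
    by_cases hij : i = j
    · subst hij
      simpa [SearchPolicy.without, Finset.erase_insert_eq_erase] using ih₀ hT.2.2
    · have h₁ := ih₁ hT.2.1
      have h₀ := ih₀ hT.2.2
      rw [Finset.erase_insert_of_ne hij] at h₁ h₀
      simp only [SearchPolicy.without, hij, if_false]
      exact ⟨fun h => hT.1 (Finset.mem_of_mem_erase h), h₁, h₀⟩

theorem run_without (T : SearchPolicy m) (j : Fin m) (F : Fin m → Bool) :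
    (T.without j).run F = ((T.run (Function.update F j false)).1.erase j,
      if (T.run (Function.update F j false)).2 = some j then none
      else (T.run (Function.update F j false)).2) := by
  induction T with
  | halt o =>
    simp only [run, SearchPolicy.without, Finset.erase_empty]
    congr
  | inspect i T₁ T₀ ih₁ ih₀ =>
    by_cases hij : i = j
    · subst hij
      simp [run, SearchPolicy.without, ih₀, Finset.erase_insert_eq_erase]
    · cases hF : F i <;>
        simp [run, SearchPolicy.without, ih₀, ih₁, hij, hF, Finset.erase_insert_of_ne]

/-- Inspect the businesses of a list in this order, and transact with the first fit. -/
def chain : List (Fin m) → SearchPolicy m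
  | [] => halt none
  | j :: l => inspect j (halt (some j)) (chain l)

theorem chain_isAdmissible {l : List (Fin m)} (hl : l.Nodup) {A : Finset (Fin m)}
    (hA : ∀ j ∈ l, j ∉ A) : (chain l).IsAdmissible A := by
  induction l generalizing A with
  | nil => trivial
  | cons j l ih =>
    rw [List.nodup_cons] at hl
    refine ⟨hA j (by simp), by simp [IsAdmissible], ih hl.2 fun i hi => ?_⟩
    rw [Finset.mem_insert, not_or]
    exact ⟨fun h => hl.1 (h ▸ hi), hA i (by simp [hi])⟩

/-- An injective code for search policies. -/
def code : SearchPolicy m → ℕ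
  | halt o => Nat.pair 0 (Encodable.encode o)
  | inspect j T₁ T₀ => Nat.pair 1 (Nat.pair j (Nat.pair T₁.code T₀.code))

theorem code_injective : Function.Injective (code (m := m)) := by
  intro T
  induction T with
  | halt o =>
    rintro (o' | ⟨j, T₁, T₀⟩) h
    · simpa [code] using h
    · simp [code] at h
  | inspect j T₁ T₀ ih₁ ih₀ =>
    rintro (o' | ⟨j', T₁', T₀'⟩) h
    · simp [code] at h
    · simp only [code, Nat.pair_eq_pair, true_and] at h
      rw [Fin.ext h.1, ih₁ h.2.1, ih₀ h.2.2]

instance : Countable (SearchPolicy m) := code_injective.countable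

end SearchPolicy

/-! ### Expected utility with independent fits -/

section Weights

variable {m : ℕ}

/-- The probability of the fit profile `F` if `p j` is the probability that `j` is a fit. -/
def fitWeight (p : Fin m → ℝ) (F : Fin m → Bool) : ℝ :=
  ∏ k, if F k = true then p k else 1 - p k

/-- A function of fit profiles sums to zero if flipping the fit of `i` changes its sign. -/
theorem sum_eq_zero_of_flip (i : Fin m) (f : (Fin m → Bool) → ℝ)
    (hf : ∀ F, f F + f (Function.update F i (!F i)) = 0) : ∑ F, f F = 0 := by
  refine Finset.sum_involution (fun F _ => Function.update F i (!F i)) (fun F _ => hf F)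
    (fun F _ _ h => ?_) (fun _ _ => Finset.mem_univ _) (fun F _ => ?_)
  · have := congrFun h i
    simp at this
  · simp

theorem fitWeight_eq_mul (p : Fin m → ℝ) (F : Fin m → Bool) (i : Fin m) :
    fitWeight p F = (if F i = true then p i else 1 - p i) *
      ∏ k ∈ Finset.univ.erase i, if F k = true then p k else 1 - p k :=
  (Finset.mul_prod_erase _ _ (Finset.mem_univ i)).symm

theorem prod_erase_update (p : Fin m → ℝ) (F : Fin m → Bool) (i : Fin m) (b : Bool) :
    (∏ k ∈ Finset.univ.erase i, if Function.update F i b k = true then p k else 1 - p k) =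
      ∏ k ∈ Finset.univ.erase i, if F k = true then p k else 1 - p k :=
  Finset.prod_congr rfl fun k hk => by
    rw [Function.update_of_ne (Finset.ne_of_mem_erase hk)]

/-- The expectation of a function that does not depend on the fit of `i` is not affected by
reweighting with a function of the fit of `i` of mean one. -/
theorem sum_fitWeight_mul_indicator {p : Fin m → ℝ} {i : Fin m} (hp : p i ≠ 0)
    {g : (Fin m → Bool) → ℝ} (hg : ∀ F b, g (Function.update F i b) = g F) :
    ∑ F, fitWeight p F * (if F i = true then g F / p i else 0) = ∑ F, fitWeight p F * g F := by
  rw [← sub_eq_zero, ← Finset.sum_sub_distrib]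
  refine sum_eq_zero_of_flip i _ fun F => ?_
  simp only [fitWeight_eq_mul p _ i, prod_erase_update, hg, Function.update_self]
  cases F i <;> simp <;> field_simp <;> ring

theorem sum_fitWeight_update {p : Fin m → ℝ} {i : Fin m} (x : ℝ)
    {g : (Fin m → Bool) → ℝ} (hg : ∀ F b, g (Function.update F i b) = g F) :
    ∑ F, fitWeight (Function.update p i x) F * g F = ∑ F, fitWeight p F * g F := by
  rw [← sub_eq_zero, ← Finset.sum_sub_distrib]
  refine sum_eq_zero_of_flip i _ fun F => ?_
  have h : ∀ F : Fin m → Bool, (∏ k ∈ Finset.univ.erase i,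
      if F k = true then Function.update p i x k else 1 - Function.update p i x k) =
      ∏ k ∈ Finset.univ.erase i, if F k = true then p k else 1 - p k := fun F =>
    Finset.prod_congr rfl fun k hk => by
      rw [Function.update_of_ne (Finset.ne_of_mem_erase hk)]
  simp only [fitWeight_eq_mul _ _ i, h, prod_erase_update, hg, Function.update_self]
  cases F i <;> simp <;> ring

theorem sum_fitWeight_congr {p p' : Fin m → ℝ} {g : (Fin m → Bool) → ℝ}
    (hg : ∀ i, p i ≠ p' i → ∀ F b, g (Function.update F i b) = g F) :
    ∑ F, fitWeight p F * g F = ∑ F, fitWeight p' F * g F := by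
  have key : ∀ A : Finset (Fin m), ∑ F, fitWeight (fun i => if i ∈ A then p' i else p i) F * g F =
      ∑ F, fitWeight p F * g F := by
    intro A
    induction A using Finset.induction_on with
    | empty => simp
    | insert a A ha ih =>
      by_cases hpa : p a = p' a
      · rw [← ih]
        congr! 4 with F _
        rename_i i
        by_cases hi : i = a
        · subst hi; simp [ha, hpa]
        · simp [hi]
      · rw [← ih, ← sum_fitWeight_update (p := fun i => if i ∈ A then p' i else p i)
          (p' a) (hg a hpa)]
        congr! 4 with F _
        rename_i i
        by_cases hi : i = a
        · subst hi; simp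
        · simp [hi]
  simpa using (key Finset.univ).symm

theorem fitWeight_pos {p : Fin m → ℝ} (h₀ : ∀ j, 0 < p j) (h₁ : ∀ j, p j < 1)
    (F : Fin m → Bool) : 0 < fitWeight p F :=
  Finset.prod_pos fun k _ => by
    split_ifs
    · exact h₀ k
    · exact sub_pos.2 (h₁ k)

end Weights

namespace Market

variable {m : ℕ}

/-- The expected transaction utility given the fit profile, if `q` are the mean qualities. -/
def gain (M : Market m) (q : Fin m → ℝ) (V : ℝ) (F : Fin m → Bool) : Option (Fin m) → ℝ
  | none => 0
  | some j => (if F j = true then V * q j else 0) - M.price j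

/-- The expected utility of a policy if the fits are independent with probabilities `p` and the
mean qualities are `q`. -/
def meanUtility (M : Market m) (p q : Fin m → ℝ) (V : ℝ) (T : SearchPolicy m) : ℝ :=
  ∑ F, fitWeight p F * (M.gain q V F (T.run F).2 - M.cost * ((T.run F).1.card : ℝ))

/-- The reservation value of business `j`. -/
def index (M : Market m) (p q : Fin m → ℝ) (V : ℝ) (j : Fin m) : ℝ :=
  V * q j - M.price j - M.cost / p j

/-- The transaction utility minus the search costs, where the cost of inspecting a business is
charged only in the event that it is a fit. -/
def amortized (M : Market m) (p q : Fin m → ℝ) (V : ℝ) (T : SearchPolicy m) (F : Fin m → Bool) :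
    ℝ :=
  M.gain q V F (T.run F).2 - ∑ i ∈ (T.run F).1, if F i = true then M.cost / p i else 0

theorem meanUtility_eq_sum_amortized (M : Market m) {p : Fin m → ℝ} (q : Fin m → ℝ) (V : ℝ)
    (T : SearchPolicy m) (hp : ∀ j, 0 < p j) :
    M.meanUtility p q V T = ∑ F, fitWeight p F * M.amortized p q V T F := by
  have key : ∑ F, fitWeight p F * (M.cost * ((T.run F).1.card : ℝ)) =
      ∑ F, fitWeight p F * ∑ i ∈ (T.run F).1, if F i = true then M.cost / p i else 0 := by
    have h : ∀ F : Fin m → Bool, ∀ f : Fin m → ℝ,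
        ∑ i ∈ (T.run F).1, f i = ∑ i, if i ∈ (T.run F).1 then f i else 0 := by
      intro F f; simp
    have h' : ∀ F : Fin m → Bool, M.cost * ((T.run F).1.card : ℝ) =
        ∑ i ∈ (T.run F).1, M.cost := by
      intro F; simp [mul_comm]
    simp_rw [h', h, Finset.mul_sum]
    rw [Finset.sum_comm, Finset.sum_comm (s := Finset.univ (α := Fin m → Bool))]
    refine Finset.sum_congr rfl fun i _ => ?_
    rw [← sum_fitWeight_mul_indicator (i := i) (hp i).ne'
      (g := fun F => if i ∈ (T.run F).1 then M.cost else 0)]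
    · refine Finset.sum_congr rfl fun F _ => ?_
      split_ifs <;> simp
    · intro F b
      simp only [T.mem_run_congr (i := i) (F := F) (F' := Function.update F i b)
        fun j hj => Function.update_of_ne hj _ _]
  simp only [meanUtility, amortized, mul_sub, Finset.sum_sub_distrib, key]

section Optimality

variable (M : Market m) {p q : Fin m → ℝ} {V : ℝ}

theorem charge_nonneg (hp : ∀ j, 0 < p j) (F : Fin m → Bool) (i : Fin m) :
    0 ≤ if F i = true then M.cost / p i else 0 := by
  split_ifs
  · exact div_nonneg M.cost_nonneg (hp i).le
  · exact le_rfl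

theorem amortized_nonpos {T : SearchPolicy m} {F : Fin m → Bool}
    (h : ∀ j, (T.run F).2 = some j → F j = false) : M.amortized p q V T F ≤
      - ∑ i ∈ (T.run F).1, if F i = true then M.cost / p i else 0 := by
  unfold amortized
  cases ho : (T.run F).2 with
  | none => simp [gain]
  | some j => simpa [gain, h j ho] using M.price_nonneg j

theorem amortized_eq_index_sub {T : SearchPolicy m} (hT : T.IsAdmissible ∅)
    {F : Fin m → Bool} {j : Fin m} (hj : (T.run F).2 = some j) (hF : F j = true) :
    M.amortized p q V T F = M.index p q V j -
      ∑ i ∈ (T.run F).1.erase j, if F i = true then M.cost / p i else 0 := by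
  rw [amortized, hj, ← Finset.add_sum_erase _ _ (hT.choice_mem_run hj), index]
  simp [gain, hF]
  ring

/-- The amortized utility of a policy on a fit profile is nonpositive or at most the reservation
value of a fit. -/
theorem amortized_le (hp : ∀ j, 0 < p j) {T : SearchPolicy m} (hT : T.IsAdmissible ∅)
    (F : Fin m → Bool) : M.amortized p q V T F ≤ 0 ∨
      ∃ j, F j = true ∧ M.amortized p q V T F ≤ M.index p q V j := by
  by_cases h : ∃ j, (T.run F).2 = some j ∧ F j = true
  · obtain ⟨j, hj, hF⟩ := h
    refine .inr ⟨j, hF, ?_⟩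
    rw [M.amortized_eq_index_sub hT hj hF, sub_le_self_iff]
    exact Finset.sum_nonneg fun i _ => M.charge_nonneg hp F i
  · push Not at h
    refine .inl ((M.amortized_nonpos fun j hj => by simpa using h j hj).trans ?_)
    exact neg_nonpos.2 (Finset.sum_nonneg fun i _ => M.charge_nonneg hp F i)

theorem le_amortized_chain {l : List (Fin m)} (hnd : l.Nodup)
    (hl : l.Pairwise fun i j => M.index p q V j ≤ M.index p q V i)
    (hpos : ∀ j ∈ l, 0 < M.index p q V j) (F : Fin m → Bool) :
    0 ≤ M.amortized p q V (.chain l) F ∧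
      ∀ j ∈ l, F j = true → M.index p q V j ≤ M.amortized p q V (.chain l) F := by
  induction l with
  | nil => simp [amortized, SearchPolicy.chain, SearchPolicy.run, gain]
  | cons i l ih =>
    rw [List.nodup_cons] at hnd
    rw [List.pairwise_cons] at hl
    obtain ⟨h0, h1⟩ := ih hnd.2 hl.2 fun j hj => hpos j (by simp [hj])
    cases hF : F i with
    | true =>
      have h : M.amortized p q V (.chain (i :: l)) F = M.index p q V i := by
        simp [amortized, SearchPolicy.chain, SearchPolicy.run, hF, gain, index]
      rw [h]
      refine ⟨(hpos i (by simp)).le, fun j hj _ => ?_⟩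
      rcases List.mem_cons.1 hj with rfl | hj
      · exact le_rfl
      · exact hl.1 j hj
    | false =>
      have h : M.amortized p q V (.chain (i :: l)) F = M.amortized p q V (.chain l) F := by
        simp only [amortized, SearchPolicy.chain, SearchPolicy.run, hF, cond_false]
        by_cases hi : i ∈ ((SearchPolicy.chain l).run F).1
        · rw [Finset.insert_eq_of_mem hi]
        · rw [Finset.sum_insert hi]; simp [hF]
      rw [h]
      refine ⟨h0, fun j hj hFj => ?_⟩
      rcases List.mem_cons.1 hj with rfl | hj
      · simp [hF] at hFj
      · exact h1 j hj hFj

/-- Some admissible policy attains, on every fit profile, at least zero and the reservation value of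
every fit. -/
theorem exists_amortized_ge (p q : Fin m → ℝ) (V : ℝ) : ∃ D : SearchPolicy m, D.IsAdmissible ∅ ∧
    ∀ F, 0 ≤ M.amortized p q V D F ∧
      ∀ j, F j = true → M.index p q V j ≤ M.amortized p q V D F := by
  classical
  let r : Fin m → Fin m → Prop := fun i j => M.index p q V j ≤ M.index p q V i
  let l : List (Fin m) := ((Finset.univ.filter fun j => 0 < M.index p q V j).toList).insertionSort r
  have hmem : ∀ j, j ∈ l ↔ 0 < M.index p q V j := by intro j; simp [l]
  have hnd : l.Nodup := (List.perm_insertionSort r _).nodup_iff.2 (Finset.nodup_toList _)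
  have : Std.Total r := ⟨fun i j => le_total _ _⟩
  have : IsTrans (Fin m) r := ⟨fun i j k hij hjk => le_trans hjk hij⟩
  have hs : l.Pairwise r := List.pairwise_insertionSort r _
  refine ⟨.chain l, SearchPolicy.chain_isAdmissible hnd (by simp), fun F => ?_⟩
  obtain ⟨h0, h1⟩ := M.le_amortized_chain hnd hs (fun j hj => (hmem j).1 hj) F
  refine ⟨h0, fun j hj => ?_⟩
  by_cases h : 0 < M.index p q V j
  · exact h1 j ((hmem j).2 h) hj
  · exact (not_lt.1 h).trans h0

/-- The amortized utility of an optimal policy is maximal on every fit profile. -/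
theorem le_amortized_of_optimal (h₀ : ∀ j, 0 < p j) (h₁ : ∀ j, p j < 1) {T : SearchPolicy m}
    (hT : T.IsAdmissible ∅)
    (hopt : ∀ T' : SearchPolicy m, T'.IsAdmissible ∅ →
      M.meanUtility p q V T' ≤ M.meanUtility p q V T) (F : Fin m → Bool) :
    0 ≤ M.amortized p q V T F ∧
      ∀ j, F j = true → M.index p q V j ≤ M.amortized p q V T F := by
  obtain ⟨D, hD, hDF⟩ := M.exists_amortized_ge p q V
  have hle : ∀ F, M.amortized p q V T F ≤ M.amortized p q V D F := fun F => by
    rcases M.amortized_le h₀ hT F with h | ⟨j, hj, h⟩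
    · exact h.trans (hDF F).1
    · exact h.trans ((hDF F).2 j hj)
  suffices h : M.amortized p q V D F ≤ M.amortized p q V T F from
    ⟨(hDF F).1.trans h, fun j hj => ((hDF F).2 j hj).trans h⟩
  by_contra hlt
  have := hopt D hD
  rw [M.meanUtility_eq_sum_amortized q V D h₀, M.meanUtility_eq_sum_amortized q V T h₀] at this
  refine this.not_gt (Finset.sum_lt_sum (fun F _ =>
    mul_le_mul_of_nonneg_left (hle F) (fitWeight_pos h₀ h₁ F).le) ⟨F, Finset.mem_univ F, ?_⟩)
  exact mul_lt_mul_of_pos_left (not_le.1 hlt) (fitWeight_pos h₀ h₁ F)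

end Optimality

end Market

/-- The fit profile in which only `j` is a fit. -/
def onlyFit {m : ℕ} (j : Fin m) : Fin m → Bool := fun k => decide (k = j)

namespace Market

variable {m : ℕ} {M : Market m} {ν : Measure (Params m)} {p q : Fin m → ℝ} {V : ℝ}
  {T : SearchPolicy m}

theorem IsBestResponse.le_amortized (hT : M.IsBestResponse ν V T)
    (hν : ∀ T, M.expectedUtility ν V T = M.meanUtility p q V T)
    (h₀ : ∀ j, 0 < p j) (h₁ : ∀ j, p j < 1) (F : Fin m → Bool) :
    0 ≤ M.amortized p q V T F ∧
      ∀ j, F j = true → M.index p q V j ≤ M.amortized p q V T F :=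
  M.le_amortized_of_optimal h₀ h₁ hT.admissible
    (fun T' hT' => by rw [← hν, ← hν]; exact hT.optimal T' hT') F

/-- A best response transacts with a business of positive reservation value if this is the only
fit. -/
theorem IsBestResponse.run_onlyFit (hT : M.IsBestResponse ν V T)
    (hν : ∀ T, M.expectedUtility ν V T = M.meanUtility p q V T)
    (h₀ : ∀ j, 0 < p j) (h₁ : ∀ j, p j < 1) {j : Fin m} (hj : 0 < M.index p q V j) :
    (T.run (onlyFit j)).2 = some j := by
  have h := (hT.le_amortized hν h₀ h₁ (onlyFit j)).2 j (by simp [onlyFit])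
  by_contra hne
  have h' := M.amortized_nonpos (p := p) (q := q) (V := V) (T := T) (F := onlyFit j) fun i hi => by
    by_contra hF
    have : i = j := by simpa [onlyFit] using hF
    exact hne (this ▸ hi)
  have h'' : 0 ≤ ∑ i ∈ (T.run (onlyFit j)).1,
      if onlyFit j i = true then M.cost / p i else 0 :=
    Finset.sum_nonneg fun i _ => M.charge_nonneg h₀ (onlyFit j) i
  linarith

/-- If search is costly, a best response transacts with every inspected fit. -/
theorem IsBestResponse.choice_of_fit (hT : M.IsBestResponse ν V T)
    (hν : ∀ T, M.expectedUtility ν V T = M.meanUtility p q V T)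
    (h₀ : ∀ j, 0 < p j) (h₁ : ∀ j, p j < 1) (hc : 0 < M.cost) {F : Fin m → Bool} {j : Fin m}
    (hj : j ∈ (T.run F).1) (hF : F j = true) : (T.run F).2 = some j := by
  obtain ⟨h, h'⟩ := hT.le_amortized hν h₀ h₁ F
  have hpos : 0 < M.cost / p j := div_pos hc (h₀ j)
  have hge : ∀ A : Finset (Fin m), j ∈ A → M.cost / p j ≤
      ∑ i ∈ A, if F i = true then M.cost / p i else 0 := fun A hA => by
    have := Finset.single_le_sum (f := fun i => if F i = true then M.cost / p i else 0)
      (fun i _ => M.charge_nonneg h₀ F i) hA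
    simpa [hF] using this
  by_contra hne
  by_cases hi : ∃ i, (T.run F).2 = some i ∧ F i = true
  · obtain ⟨i, hi, hFi⟩ := hi
    have := h' i hFi
    rw [M.amortized_eq_index_sub hT.admissible hi hFi] at this
    have := hge ((T.run F).1.erase i)
      (Finset.mem_erase.2 ⟨fun h => hne (h ▸ hi), hj⟩)
    linarith
  · push Not at hi
    have h₂ := M.amortized_nonpos (p := p) (q := q) (V := V) (T := T) (F := F) fun i h => by
      simpa using hi i h
    have := hge _ hj
    linarith

/-- A best response never inspects a business of nonpositive reservation value. -/
theorem IsBestResponse.index_pos (hT : M.IsBestResponse ν V T)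
    (hν : ∀ T, M.expectedUtility ν V T = M.meanUtility p q V T)
    (h₀ : ∀ j, 0 < p j) (h₁ : ∀ j, p j < 1) {F : Fin m → Bool} {j : Fin m}
    (hj : j ∈ (T.run F).1) : 0 < M.index p q V j := by
  by_contra hneg
  rw [not_lt] at hneg
  have hch : ∀ G : Fin m → Bool, ¬ (T.run (Function.update G j false)).2 = some j := fun G h => by
    simpa using hT.transacts_fit _ j h
  have hrun : ∀ G, (T.without j).run G = ((T.run (Function.update G j false)).1.erase j,
      (T.run (Function.update G j false)).2) := fun G => by
    rw [T.run_without, if_neg (hch G)]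
  have hadm : (T.without j).IsAdmissible ∅ := by simpa using hT.admissible.without j
  refine (hT.inspects_needed j (T.without j) hadm (fun G => ?_) ⟨F, hj, ?_⟩).not_ge ?_
  · by_cases hG : j ∈ (T.run G).1
    · exact .inr ⟨hG, by simp [hrun]⟩
    · left
      have : T.run (Function.update G j false) = T.run G := T.run_congr fun i hi => by
        rw [Function.update_of_ne]
        rintro rfl
        exact hG hi
      rw [hrun, this, Finset.erase_eq_of_notMem hG]
  · simp [hrun]
  · rw [hν, hν, M.meanUtility_eq_sum_amortized q V _ h₀, M.meanUtility_eq_sum_amortized q V _ h₀]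
    refine Finset.sum_le_sum fun G _ =>
      mul_le_mul_of_nonneg_left ?_ (fitWeight_pos h₀ h₁ G).le
    have heq : M.amortized p q V (T.without j) G =
        M.amortized p q V T (Function.update G j false) := by
      unfold amortized
      rw [hrun]
      congr 1
      · cases ho : (T.run (Function.update G j false)).2 with
        | none => rfl
        | some i =>
          have : i ≠ j := fun h => hch G (h ▸ ho)
          simp [gain, this]
      · have : ∀ i ∈ (T.run (Function.update G j false)).1.erase j,
            (if G i = true then M.cost / p i else 0) =
              if Function.update G j false i = true then M.cost / p i else 0 := fun i hi => by
          rw [Function.update_of_ne (Finset.ne_of_mem_erase hi)]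
        rw [Finset.sum_congr rfl this]
        exact Finset.sum_erase _ (by simp)
    rw [heq]
    obtain ⟨h, h'⟩ := hT.le_amortized hν h₀ h₁ (Function.update G j false)
    rcases M.amortized_le (q := q) (V := V) h₀ hT.admissible G with hle | ⟨i, hGi, hle⟩
    · exact hle.trans h
    · by_cases hij : i = j
      · subst hij; exact (hle.trans hneg).trans h
      · exact hle.trans (h' i (by simpa [hij] using hGi))

end Market

/-! ### The likelihood of a history -/

/-- The quality realization of business `j` that is revealed by a feedback. -/
def Feedback.qualities {m : ℕ} (h : Feedback m) (j : Fin m) : Option Bool :=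
  h.transaction.bind fun t => if t.1 = j then some t.2 else none

theorem Feedback.qualities_eq_some {m : ℕ} {h : Feedback m} {j : Fin m} {b : Bool} :
    h.qualities j = some b ↔ h.transaction = some (j, b) := by
  unfold Feedback.qualities
  rcases h.transaction with _ | ⟨i, c⟩
  · simp
  · simp only [Option.bind_some, Option.ite_none_right_eq_some, Option.some.injEq, Prod.mk.injEq]

/-- The number of rounds in which the observation `f` is the outcome `b`. -/
def obsCount {m : ℕ} (f : Feedback m → Option Bool) (b : Bool) : FiniteHistory m → ℕ
  | [] => 0
  | h :: H => obsCount f b H + if f h = some b then 1 else 0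

/-- The number of rounds in which the observation `f` was made. -/
def obsTotal {m : ℕ} (f : Feedback m → Option Bool) (H : FiniteHistory m) : ℕ :=
  obsCount f true H + obsCount f false H

/-- The likelihood of `a` successes and `b` failures. -/
def bernLik (a b : ℕ) (p : I) : ℝ≥0∞ := ENNReal.ofReal p ^ a * ENNReal.ofReal (1 - p) ^ b

/-- The probability of an observation of a coin that may also not be tossed. -/
def obsProb (p : I) (o : Option Bool) : ℝ≥0∞ :=
  bernoulliMeasure true false p {x | ∀ b, o = some b → x = b}

theorem bernoulliMeasure_singleton_true (p : I) :
    bernoulliMeasure true false p {true} = ENNReal.ofReal p := by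
  rw [bernoulliMeasure_apply_of_mem_of_notMem p (MeasurableSet.of_discrete) (by simp) (by simp)]
  rw [ENNReal.ofReal]
  congr 1
  ext
  simp [p.2.1]

theorem bernoulliMeasure_singleton_false (p : I) :
    bernoulliMeasure true false p {false} = ENNReal.ofReal (1 - p) := by
  rw [bernoulliMeasure_apply_of_notMem_of_mem p (MeasurableSet.of_discrete) (by simp) (by simp)]
  rw [ENNReal.ofReal]
  congr 1
  ext
  simp [p.2.2]

theorem obsProb_none (p : I) : obsProb p none = 1 := by simp [obsProb]

theorem obsProb_some (p : I) (b : Bool) :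
    obsProb p (some b) = bernoulliMeasure true false p {b} := by
  unfold obsProb
  congr 1
  ext x
  simp [eq_comm]

theorem bernLik_mul_obsProb {m : ℕ} (p : I) (f : Feedback m → Option Bool) (h : Feedback m)
    (H : FiniteHistory m) :
    bernLik (obsCount f true H) (obsCount f false H) p * obsProb p (f h) =
      bernLik (obsCount f true (h :: H)) (obsCount f false (h :: H)) p := by
  rcases hf : f h with _ | _ | _
  · simp [obsCount, hf, obsProb_none]
  · rw [obsProb_some, bernoulliMeasure_singleton_false]
    simp [obsCount, hf, bernLik, pow_succ, mul_assoc]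
  · rw [obsProb_some, bernoulliMeasure_singleton_true]
    simp [obsCount, hf, bernLik, pow_succ, mul_right_comm]

theorem measurable_bernLik (a b : ℕ) : Measurable (bernLik a b) := by
  unfold bernLik
  fun_prop

theorem bernLik_le_one (a b : ℕ) (p : I) : bernLik a b p ≤ 1 := by
  unfold bernLik
  refine mul_le_one' (pow_le_one' ?_ a) (pow_le_one' ?_ b)
  · exact ENNReal.ofReal_le_one.2 p.2.2
  · exact ENNReal.ofReal_le_one.2 (by linarith [p.2.1])

theorem bernLik_anti {a b a' b' : ℕ} (ha : a ≤ a') (hb : b ≤ b') (p : I) :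
    bernLik a' b' p ≤ bernLik a b p := by
  unfold bernLik
  refine mul_le_mul' (pow_le_pow_right_of_le_one' ?_ ha) (pow_le_pow_right_of_le_one' ?_ hb)
  · exact ENNReal.ofReal_le_one.2 p.2.2
  · exact ENNReal.ofReal_le_one.2 (by linarith [p.2.1])

namespace SearchPolicy

variable {m : ℕ}

/-- Whether the policy `T` may produce the feedback `h`. -/
def Produces (T : SearchPolicy m) (h : Feedback m) : Prop :=
  T.feedback (fun j => (h.fits j).getD false) (fun j => (h.qualities j).getD false) = h

theorem feedback_congr {T : SearchPolicy m} {F F' q q' : Fin m → Bool}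
    (hF : ∀ j ∈ (T.run F).1, F' j = F j) (hq : ∀ j, (T.run F).2 = some j → q' j = q j) :
    T.feedback F' q' = T.feedback F q := by
  have h := T.run_congr hF
  simp only [feedback, h, Feedback.mk.injEq]
  constructor
  · funext j
    split_ifs with hj
    · rw [hF j hj]
    · rfl
  · cases ho : (T.run F).2 with
    | none => rfl
    | some j => simp [hq j ho]

theorem fits_feedback {T : SearchPolicy m} {F q : Fin m → Bool} {j : Fin m} {b : Bool} :
    (T.feedback F q).fits j = some b ↔ j ∈ (T.run F).1 ∧ F j = b := by
  simp [feedback]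

theorem qualities_feedback {T : SearchPolicy m} {F q : Fin m → Bool} {j : Fin m} {b : Bool} :
    (T.feedback F q).qualities j = some b ↔ (T.run F).2 = some j ∧ q j = b := by
  rw [Feedback.qualities_eq_some]
  simp only [feedback, Option.map_eq_some_iff, Prod.mk.injEq]
  constructor
  · rintro ⟨i, hi, rfl, rfl⟩; exact ⟨hi, rfl⟩
  · rintro ⟨hi, rfl⟩; exact ⟨j, hi, rfl, rfl⟩

theorem feedback_eq_iff {T : SearchPolicy m} {F q : Fin m → Bool} {h : Feedback m} :
    T.feedback F q = h ↔ T.Produces h ∧ (∀ j b, h.fits j = some b → F j = b) ∧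
      ∀ j b, h.qualities j = some b → q j = b := by
  constructor
  · rintro rfl
    refine ⟨feedback_congr (fun j hj => ?_) fun j hj => ?_, fun j b hb => (fits_feedback.1 hb).2,
      fun j b hb => (qualities_feedback.1 hb).2⟩
    · rw [fits_feedback.2 ⟨hj, rfl⟩, Option.getD_some]
    · rw [qualities_feedback.2 ⟨hj, rfl⟩, Option.getD_some]
  · rintro ⟨hT, hF, hq⟩
    rw [← hT]
    refine feedback_congr (fun j hj => hF j _ ?_) fun j hj => hq j _ ?_
    · conv_lhs => rw [← hT]
      exact fits_feedback.2 ⟨hj, rfl⟩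
    · conv_lhs => rw [← hT]
      exact qualities_feedback.2 ⟨hj, rfl⟩

end SearchPolicy

namespace Market

variable {m : ℕ} (M : Market m) {s : ConsumerRule m}

/-- The probability that the consumer after the history `H` has a value for which her policy may
produce the feedback `h`. -/
def produceProb (s : ConsumerRule m) (H : FiniteHistory m) (h : Feedback m) : ℝ≥0∞ :=
  M.valueLaw {V | (s H V).Produces h}

/-- The factor of the likelihood of a history that does not depend on the parameters. -/
def policyLik (s : ConsumerRule m) : FiniteHistory m → ℝ≥0∞
  | [] => 1
  | h :: H => policyLik s H * M.produceProb s H h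

theorem fitQualityLaw_box (θ : Params m) (o o' : Fin m → Option Bool) :
    fitQualityLaw θ ({F | ∀ j b, o j = some b → F j = b} ×ˢ {q | ∀ j b, o' j = some b → q j = b}) =
      ∏ j, (obsProb (θ j).1 (o j) * obsProb (θ j).2 (o' j)) := by
  have h : ∀ o : Fin m → Option Bool, {F : Fin m → Bool | ∀ j b, o j = some b → F j = b} =
      Set.univ.pi fun j => {x | ∀ b, o j = some b → x = b} := by
    intro o; ext F; simp
  rw [fitQualityLaw, Measure.prod_prod, h, h, Measure.pi_pi, Measure.pi_pi,
    Finset.prod_mul_distrib]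
  rfl

theorem roundLaw_feedback_eq (s : ConsumerRule m) (θ : Params m) (H : FiniteHistory m)
    (h : Feedback m) :
    M.roundLaw θ {x | (s H x.1).feedback x.2.1 x.2.2 = h} = M.produceProb s H h *
      ∏ j, (obsProb (θ j).1 (h.fits j) * obsProb (θ j).2 (h.qualities j)) := by
  rw [← fitQualityLaw_box, produceProb, roundLaw, ← Measure.prod_prod]
  congr 1
  ext ⟨V, F, q⟩
  simp [SearchPolicy.feedback_eq_iff]

theorem likelihood_eq (s : ConsumerRule m) (H : FiniteHistory m) (θ : Params m) :
    M.likelihood s H θ = M.policyLik s H * ∏ j,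
      (bernLik (obsCount (·.fits j) true H) (obsCount (·.fits j) false H) (θ j).1 *
        bernLik (obsCount (·.qualities j) true H) (obsCount (·.qualities j) false H) (θ j).2) := by
  induction H with
  | nil => simp [likelihood, policyLik, bernLik, obsCount]
  | cons h H ih =>
    rw [likelihood, ih, roundLaw_feedback_eq, policyLik, mul_mul_mul_comm, ← Finset.prod_mul_distrib]
    congr 1
    refine Finset.prod_congr rfl fun j _ => ?_
    rw [mul_mul_mul_comm, bernLik_mul_obsProb (θ j).1 (fun h : Feedback m => h.fits j),
      bernLik_mul_obsProb (θ j).2 (fun h : Feedback m => h.qualities j)]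

theorem policyLik_le_one (s : ConsumerRule m) (H : FiniteHistory m) : M.policyLik s H ≤ 1 := by
  induction H with
  | nil => exact le_rfl
  | cons h H ih => exact mul_le_one' ih prob_le_one

end Market

/-! ### Posterior beliefs -/

/-- The posterior over the bias of a coin after `a` successes and `b` failures. -/
def coinPosterior (μ : Measure I) (a b : ℕ) : Measure I :=
  (∫⁻ p, bernLik a b p ∂μ)⁻¹ • μ.withDensity (bernLik a b)

theorem lintegral_bernLik_ne_top (μ : Measure I) [IsProbabilityMeasure μ] (a b : ℕ) :
    ∫⁻ p, bernLik a b p ∂μ ≠ ∞ :=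
  ne_top_of_le_ne_top ENNReal.one_ne_top
    ((lintegral_mono (bernLik_le_one a b)).trans (by simp))

theorem continuous_bernLik (a b : ℕ) : Continuous (bernLik a b) := by
  have h₁ : Continuous fun p : I => ENNReal.ofReal ((p : ℝ) ^ a * (1 - p) ^ b) :=
    ENNReal.continuous_ofReal.comp (by fun_prop)
  convert h₁ using 2 with p
  rw [bernLik, ENNReal.ofReal_mul (pow_nonneg p.2.1 a), ENNReal.ofReal_pow p.2.1,
    ENNReal.ofReal_pow (by linarith [p.2.2])]

theorem lintegral_bernLik_pos {μ : Measure I} {x : I} (hx : x ∈ μ.support) {a b : ℕ}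
    (h : bernLik a b x ≠ 0) : ∫⁻ p, bernLik a b p ∂μ ≠ 0 := by
  rw [← pos_iff_ne_zero, lintegral_pos_iff_support (measurable_bernLik a b)]
  refine (Measure.mem_support_iff_forall x).1 hx _ ?_
  exact (continuous_bernLik a b).continuousAt.eventually_ne h

theorem coinPosterior_prob {μ : Measure I} [IsProbabilityMeasure μ] {x : I} (hx : x ∈ μ.support)
    {a b : ℕ} (h : bernLik a b x ≠ 0) : IsProbabilityMeasure (coinPosterior μ a b) := by
  constructor
  rw [coinPosterior, Measure.smul_apply, withDensity_apply _ MeasurableSet.univ,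
    Measure.restrict_univ, smul_eq_mul]
  exact ENNReal.inv_mul_cancel (lintegral_bernLik_pos hx h) (lintegral_bernLik_ne_top μ a b)

/-- An event that is ruled out remains ruled out after further observations. -/
theorem coinPosterior_eq_zero_mono {μ : Measure I} [IsProbabilityMeasure μ] {a b a' b' : ℕ}
    (ha : a ≤ a') (hb : b ≤ b') {s : Set I} (hs : MeasurableSet s)
    (h : coinPosterior μ a b s = 0) : coinPosterior μ a' b' s = 0 := by
  have h₁ : μ.withDensity (bernLik a b) s = 0 := by
    rw [coinPosterior, Measure.smul_apply, smul_eq_mul, mul_eq_zero] at h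
    exact h.resolve_left (ENNReal.inv_ne_zero.2 (lintegral_bernLik_ne_top μ a b))
  rw [coinPosterior, Measure.smul_apply, smul_eq_mul, mul_eq_zero]
  right
  rw [withDensity_apply _ hs] at h₁ ⊢
  exact le_antisymm ((lintegral_mono (bernLik_anti ha hb)).trans h₁.le) zero_le

theorem lintegral_pi_prod {ι : Type*} [Fintype ι] {X : ι → Type*} [∀ i, MeasurableSpace (X i)]
    {μ : ∀ i, Measure (X i)} [∀ i, IsProbabilityMeasure (μ i)] {f : ∀ i, X i → ℝ≥0∞}
    (hf : ∀ i, Measurable (f i)) :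
    ∫⁻ x, ∏ i, f i (x i) ∂Measure.pi μ = ∏ i, ∫⁻ y, f i y ∂μ i := by
  have := lintegral_prod_eq_prod_lintegral_of_indepFun Finset.univ
    (fun (i : ι) (x : ∀ i, X i) => f i (x i)) (iIndepFun_pi (μ := μ) fun i => (hf i).aemeasurable)
    fun i => by fun_prop
  rw [this]
  exact Finset.prod_congr rfl fun i _ =>
    (measurePreserving_eval μ i).lintegral_comp (hf i)

theorem ENNReal.inv_prod {ι : Type*} (s : Finset ι) {f : ι → ℝ≥0∞} (h₀ : ∀ i, f i ≠ 0)
    (h : ∀ i, f i ≠ ∞) : (∏ i ∈ s, f i)⁻¹ = ∏ i ∈ s, (f i)⁻¹ := by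
  induction s using Finset.cons_induction with
  | empty => simp
  | cons a s ha ih =>
    rw [Finset.prod_cons, Finset.prod_cons, ENNReal.mul_inv (.inl (h₀ a)) (.inl (h a)), ih]

namespace Market

variable {m : ℕ} (M : Market m) {s : ConsumerRule m}

/-- The belief about the fit probability of `j`, in terms of the number of fits and misfits. -/
def fitPosterior (H : FiniteHistory m) (j : Fin m) : Measure I :=
  coinPosterior (M.fitPrior j) (obsCount (·.fits j) true H) (obsCount (·.fits j) false H)

/-- The belief about the quality of `j`, in terms of the quality realizations. -/
def qualityPosterior (H : FiniteHistory m) (j : Fin m) : Measure I :=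
  coinPosterior (M.qualityPrior j) (obsCount (·.qualities j) true H)
    (obsCount (·.qualities j) false H)

section OnPath

variable {M} {H : FiniteHistory m}

theorem policyLik_ne_zero (hH : M.likelihood s H M.param ≠ 0) : M.policyLik s H ≠ 0 := fun h => hH (by rw [likelihood_eq, h, zero_mul])

theorem fitLik_ne_zero (hH : M.likelihood s H M.param ≠ 0)
    (j : Fin m) : bernLik (obsCount (·.fits j) true H)
    (obsCount (·.fits j) false H) (M.param j).1 ≠ 0 := fun h => hH (by
  rw [likelihood_eq, Finset.prod_eq_zero (Finset.mem_univ j) (by rw [h, zero_mul]), mul_zero])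

theorem qualityLik_ne_zero (hH : M.likelihood s H M.param ≠ 0)
    (j : Fin m) : bernLik (obsCount (·.qualities j) true H)
    (obsCount (·.qualities j) false H) (M.param j).2 ≠ 0 := fun h => hH (by
  rw [likelihood_eq, Finset.prod_eq_zero (Finset.mem_univ j) (by rw [h, mul_zero]), mul_zero])

theorem fitPosterior_prob (hH : M.likelihood s H M.param ≠ 0)
    (j : Fin m) : IsProbabilityMeasure (M.fitPosterior H j) :=
  coinPosterior_prob (M.fit_mem_support j) (fitLik_ne_zero hH j)

theorem qualityPosterior_prob (hH : M.likelihood s H M.param ≠ 0)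
    (j : Fin m) : IsProbabilityMeasure (M.qualityPosterior H j) :=
  coinPosterior_prob (M.quality_mem_support j) (qualityLik_ne_zero hH j)

/-- On the equilibrium path the parameters of all businesses are independent under the posterior. -/
theorem posterior_eq (hH : M.likelihood s H M.param ≠ 0) : M.posterior s H =
    Measure.pi fun j => (M.fitPosterior H j).prod (M.qualityPosterior H j) := by
  have := fitPosterior_prob hH
  have := qualityPosterior_prob hH
  let f : Fin m → I → ℝ≥0∞ := fun j =>
    bernLik (obsCount (·.fits j) true H) (obsCount (·.fits j) false H)
  let g : Fin m → I → ℝ≥0∞ := fun j =>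
    bernLik (obsCount (·.qualities j) true H) (obsCount (·.qualities j) false H)
  have hf : ∀ j, Measurable (f j) := fun j => measurable_bernLik _ _
  have hg : ∀ j, Measurable (g j) := fun j => measurable_bernLik _ _
  have hfg : ∀ j, Measurable fun z : I × I => f j z.1 * g j z.2 := fun j => by fun_prop
  have hlik : M.likelihood s H = fun θ => M.policyLik s H * ∏ j, f j (θ j).1 * g j (θ j).2 :=
    funext (M.likelihood_eq s H)
  have hf₀ : ∀ j, ∫⁻ p, f j p ∂M.fitPrior j ≠ 0 := fun j =>
    lintegral_bernLik_pos (M.fit_mem_support j) (fitLik_ne_zero hH j)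
  have hg₀ : ∀ j, ∫⁻ p, g j p ∂M.qualityPrior j ≠ 0 := fun j =>
    lintegral_bernLik_pos (M.quality_mem_support j) (qualityLik_ne_zero hH j)
  have hf₁ : ∀ j, ∫⁻ p, f j p ∂M.fitPrior j ≠ ∞ := fun j => lintegral_bernLik_ne_top _ _ _
  have hg₁ : ∀ j, ∫⁻ p, g j p ∂M.qualityPrior j ≠ ∞ := fun j => lintegral_bernLik_ne_top _ _ _
  have hκ : M.policyLik s H ≠ ∞ := ne_top_of_le_ne_top ENNReal.one_ne_top (M.policyLik_le_one s H)
  have hmeas : Measurable fun θ : Params m => ∏ j, f j (θ j).1 * g j (θ j).2 :=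
    Finset.measurable_prod _ fun j _ => by fun_prop
  have hZ : ∫⁻ θ, M.likelihood s H θ ∂M.prior = M.policyLik s H *
      ∏ j, ((∫⁻ p, f j p ∂M.fitPrior j) * ∫⁻ p, g j p ∂M.qualityPrior j) := by
    rw [hlik, lintegral_const_mul _ hmeas, prior, lintegral_pi_prod hfg]
    congr 1
    exact Finset.prod_congr rfl fun j _ =>
      lintegral_prod_mul (hf j).aemeasurable (hg j).aemeasurable
  symm
  refine Measure.pi_eq fun A hA => ?_
  have hpiA : MeasurableSet (Set.univ.pi A) := MeasurableSet.univ_pi hA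
  have hA' : (M.prior.withDensity (M.likelihood s H)) (Set.univ.pi A) = M.policyLik s H *
      ∏ j, ∫⁻ z in A j, f j z.1 * g j z.2 ∂(M.fitPrior j).prod (M.qualityPrior j) := by
    rw [withDensity_apply _ hpiA, hlik, lintegral_const_mul _ hmeas, ← lintegral_indicator hpiA]
    congr 1
    rw [prior]
    have : ∀ j, ∫⁻ z in A j, f j z.1 * g j z.2 ∂(M.fitPrior j).prod (M.qualityPrior j) =
        ∫⁻ z, (A j).indicator (fun z => f j z.1 * g j z.2) z
          ∂(M.fitPrior j).prod (M.qualityPrior j) := fun j => (lintegral_indicator (hA j) _).symm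
    simp_rw [this]
    rw [← lintegral_pi_prod fun j => (hfg j).indicator (hA j)]
    congr 1
    funext θ
    by_cases h : θ ∈ Set.univ.pi A
    · rw [Set.indicator_of_mem h]
      exact Finset.prod_congr rfl fun j _ => (Set.indicator_of_mem (h j (Set.mem_univ j))
        (fun z : I × I => f j z.1 * g j z.2)).symm
    · rw [Set.indicator_of_notMem h]
      simp only [Set.mem_pi, Set.mem_univ, true_imp_iff, not_forall] at h
      obtain ⟨j, hj⟩ := h
      exact (Finset.prod_eq_zero (Finset.mem_univ j) (Set.indicator_of_notMem hj _)).symm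
  rw [posterior, Measure.smul_apply, hA', hZ, smul_eq_mul,
    ENNReal.mul_inv (.inl (policyLik_ne_zero hH)) (.inl hκ), mul_mul_mul_comm,
    ENNReal.inv_mul_cancel (policyLik_ne_zero hH) hκ, one_mul,
    ENNReal.inv_prod _ (fun j => mul_ne_zero (hf₀ j) (hg₀ j))
      fun j => ENNReal.mul_ne_top (hf₁ j) (hg₁ j), ← Finset.prod_mul_distrib]
  refine Finset.prod_congr rfl fun j _ => ?_
  rw [fitPosterior, qualityPosterior, coinPosterior, coinPosterior, Measure.prod_smul_left,
    Measure.prod_smul_right, prod_withDensity (hf j) (hg j), Measure.smul_apply,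
    Measure.smul_apply, withDensity_apply _ (hA j), smul_eq_mul, smul_eq_mul, ← mul_assoc,
    ENNReal.mul_inv (.inl (hf₀ j)) (.inl (hf₁ j))]

theorem fitBelief_eq (hH : M.likelihood s H M.param ≠ 0)
    (j : Fin m) : M.fitBelief s H j = M.fitPosterior H j := by
  have := fitPosterior_prob hH
  have := qualityPosterior_prob hH
  rw [fitBelief, posterior_eq hH]
  exact (measurePreserving_fst.comp (measurePreserving_eval _ j)).map_eq

theorem qualityBelief_eq (hH : M.likelihood s H M.param ≠ 0)
    (j : Fin m) : M.qualityBelief s H j = M.qualityPosterior H j := by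
  have := fitPosterior_prob hH
  have := qualityPosterior_prob hH
  rw [qualityBelief, posterior_eq hH]
  exact (measurePreserving_snd.comp (measurePreserving_eval _ j)).map_eq

end OnPath

end Market

/-! ### Expected utility in terms of mean parameters -/

/-- The fit probabilities of a parameter profile. -/
def Params.fit {m : ℕ} (θ : Params m) (j : Fin m) : ℝ := (θ j).1

/-- The qualities of a parameter profile. -/
def Params.quality {m : ℕ} (θ : Params m) (j : Fin m) : ℝ := (θ j).2

theorem integrable_unitInterval (α : Measure I) [IsFiniteMeasure α] :
    Integrable (fun p : I => (p : ℝ)) α :=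
  Continuous.integrable_of_hasCompactSupport (by fun_prop) (HasCompactSupport.of_compactSpace _)

section MeanParams

variable {m : ℕ} (α β : Fin m → Measure I) [∀ j, IsProbabilityMeasure (α j)]
  [∀ j, IsProbabilityMeasure (β j)]

theorem continuous_fitWeight (F : Fin m → Bool) :
    Continuous fun p : Fin m → ℝ => fitWeight p F := by
  unfold fitWeight
  refine continuous_finsetProd _ fun k _ => ?_
  split_ifs <;> fun_prop

theorem integral_fitWeight_mul (F : Fin m → Bool) (o : Option (Fin m)) :
    ∫ θ : Params m, fitWeight θ.fit F * o.elim 1 θ.quality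
      ∂Measure.pi (fun j => (α j).prod (β j)) =
      fitWeight (fun j => ∫ p, (p : ℝ) ∂α j) F * o.elim 1 fun j => ∫ p, (p : ℝ) ∂β j := by
  have h : ∀ a : Fin m → ℝ, o.elim 1 a = ∏ k, if o = some k then a k else 1 := by
    intro a
    cases o with
    | none => simp
    | some j => simp
  simp only [h, fitWeight, ← Finset.prod_mul_distrib]
  have := integral_fintype_prod_eq_prod (μ := fun j => (α j).prod (β j))
    fun (k : Fin m) (z : I × I) => (if F k = true then (z.1 : ℝ) else 1 - z.1) *
      if o = some k then (z.2 : ℝ) else 1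
  refine this.trans (Finset.prod_congr rfl fun k _ => ?_)
  refine (integral_prod_mul (fun p : I => if F k = true then (p : ℝ) else 1 - p)
    fun p : I => if o = some k then (p : ℝ) else 1).trans ?_
  congr 1
  · split_ifs
    · rfl
    · rw [integral_sub (integrable_const _) (integrable_unitInterval _)]
      simp
  · split_ifs
    · rfl
    · simp

end MeanParams

namespace Market

variable {m : ℕ} (M : Market m)

theorem gain_eq (q : Fin m → ℝ) (V : ℝ) (F : Fin m → Bool) (o : Option (Fin m)) :
    M.gain q V F o = (o.elim 0 fun j => if F j = true then V else 0) * o.elim 1 q -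
      o.elim 0 M.price := by
  cases o with
  | none => simp [gain]
  | some j => simp [gain]

theorem integral_quality (θ : Params m) (V : ℝ) (F : Fin m → Bool) (T : SearchPolicy m) :
    ∫ q, M.utility V T F q ∂(Measure.pi fun j => bernoulliMeasure true false (θ j).2) =
      M.gain θ.quality V F (T.run F).2 - M.cost * ((T.run F).1.card : ℝ) := by
  unfold utility
  rw [integral_sub .of_finite .of_finite]
  congr 1
  · rcases (T.run F).2 with _ | j
    · simp [gain]
    · have h := integral_map (μ := Measure.pi fun j => bernoulliMeasure true false (θ j).2)
        (φ := Function.eval j) (measurable_pi_apply j).aemeasurable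
        (f := fun b : Bool => (if F j = true ∧ b = true then V else 0) - M.price j)
        (Measurable.of_discrete).aestronglyMeasurable
      rw [(measurePreserving_eval (fun j => bernoulliMeasure true false (θ j).2) j).map_eq,
        integral_bernoulliMeasure] at h
      refine h.symm.trans ?_
      simp only [gain, Params.quality, and_true, Bool.false_eq_true, and_false, if_false,
        smul_eq_mul]
      split_ifs <;> ring
  · simp

theorem integral_fitQualityLaw (θ : Params m) (V : ℝ) (T : SearchPolicy m) :
    ∫ x, M.utility V T x.1 x.2 ∂(fitQualityLaw θ) = M.meanUtility θ.fit θ.quality V T := by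
  rw [fitQualityLaw, integral_prod _ .of_finite]
  simp only [integral_quality]
  rw [integral_fintype .of_finite, meanUtility]
  refine Finset.sum_congr rfl fun F _ => ?_
  rw [smul_eq_mul]
  congr 1
  rw [measureReal_def, Measure.pi_singleton, ENNReal.toReal_prod, fitWeight]
  refine Finset.prod_congr rfl fun k _ => ?_
  cases F k
  · rw [bernoulliMeasure_singleton_false, ENNReal.toReal_ofReal (by linarith [(θ k).1.2.2])]
    simp [Params.fit]
  · rw [bernoulliMeasure_singleton_true, ENNReal.toReal_ofReal (θ k).1.2.1]
    simp [Params.fit]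

theorem expectedUtility_dirac (θ : Params m) (V : ℝ) (T : SearchPolicy m) :
    M.expectedUtility (Measure.dirac θ) V T = M.meanUtility θ.fit θ.quality V T := by
  rw [expectedUtility, integral_dirac, integral_fitQualityLaw]

theorem expectedUtility_pi (α β : Fin m → Measure I) [∀ j, IsProbabilityMeasure (α j)]
    [∀ j, IsProbabilityMeasure (β j)] (V : ℝ) (T : SearchPolicy m) :
    M.expectedUtility (Measure.pi fun j => (α j).prod (β j)) V T =
      M.meanUtility (fun j => ∫ p, (p : ℝ) ∂α j) (fun j => ∫ p, (p : ℝ) ∂β j) V T := by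
  have hint : ∀ (F : Fin m → Bool) (o : Option (Fin m)), Integrable
      (fun θ : Params m => fitWeight θ.fit F * o.elim 1 θ.quality)
      (Measure.pi fun j => (α j).prod (β j)) := fun F o => by
    refine Continuous.integrable_of_hasCompactSupport (.mul ?_ ?_)
      (HasCompactSupport.of_compactSpace _)
    · exact (continuous_fitWeight F).comp (by unfold Params.fit; fun_prop)
    · cases o with
      | none => exact continuous_const
      | some j => simp only [Option.elim, Params.quality]; fun_prop
  have hlin : ∀ p q : Fin m → ℝ, M.meanUtility p q V T = ∑ F,
      ((fitWeight p F * (T.run F).2.elim 1 q) * ((T.run F).2.elim 0 fun j =>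
        if F j = true then V else 0) - (fitWeight p F * (none : Option (Fin m)).elim 1 q) *
        ((T.run F).2.elim 0 M.price + M.cost * ((T.run F).1.card : ℝ))) := by
    intro p q
    refine Finset.sum_congr rfl fun F _ => ?_
    rw [gain_eq]
    simp only [Option.elim_none]
    ring
  simp only [expectedUtility, integral_fitQualityLaw, hlin]
  refine (integral_finsetSum _ fun F _ =>
    ((hint F _).mul_const _).sub ((hint F _).mul_const _)).trans ?_
  refine Finset.sum_congr rfl fun F _ => ?_
  rw [integral_sub' ((hint F _).mul_const _) ((hint F _).mul_const _), integral_mul_const,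
    integral_mul_const, integral_fitWeight_mul, integral_fitWeight_mul]

/-- The mean fit probabilities under the posterior. -/
def fitMean (H : FiniteHistory m) (j : Fin m) : ℝ := ∫ p, (p : ℝ) ∂M.fitPosterior H j

/-- The mean qualities under the posterior. -/
def qualityMean (H : FiniteHistory m) (j : Fin m) : ℝ := ∫ p, (p : ℝ) ∂M.qualityPosterior H j

theorem expectedUtility_posterior {M : Market m} {s : ConsumerRule m} {H : FiniteHistory m}
    (hH : M.likelihood s H M.param ≠ 0) (V : ℝ) (T : SearchPolicy m) :
    M.expectedUtility (M.posterior s H) V T =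
      M.meanUtility (M.fitMean H) (M.qualityMean H) V T := by
  have := fitPosterior_prob hH
  have := qualityPosterior_prob hH
  rw [posterior_eq hH, expectedUtility_pi]
  rfl

end Market

theorem integral_unitInterval_mem (α : Measure I) [IsProbabilityMeasure α] :
    ∫ p, (p : ℝ) ∂α ∈ Set.Icc (0 : ℝ) 1 := by
  refine ⟨integral_nonneg fun p => p.2.1, ?_⟩
  have := integral_mono (integrable_unitInterval α) (integrable_const (1 : ℝ)) fun p => p.2.2
  simpa using this

theorem integral_unitInterval_mem_Ioo {α : Measure I} [IsProbabilityMeasure α] {x : I}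
    (hx : x ∈ α.support) (h₀ : 0 < x) (h₁ : x < 1) : ∫ p, (p : ℝ) ∂α ∈ Set.Ioo (0 : ℝ) 1 := by
  have hpos := (Measure.mem_support_iff_forall x).1 hx
  constructor
  · rw [integral_pos_iff_support_of_nonneg (fun p => p.2.1) (integrable_unitInterval α)]
    refine hpos _ (mem_of_superset (lt_mem_nhds h₀) fun p hp => ?_)
    exact (show (0 : ℝ) < p from hp).ne'
  · have h : 0 < ∫ p, (1 - (p : ℝ)) ∂α := by
      rw [integral_pos_iff_support_of_nonneg (fun p => sub_nonneg.2 p.2.2)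
        ((integrable_const _).sub (integrable_unitInterval α))]
      refine hpos _ (mem_of_superset (gt_mem_nhds h₁) fun p hp => ?_)
      exact (sub_pos.2 (show (p : ℝ) < 1 from hp)).ne'
    rw [integral_sub (integrable_const _) (integrable_unitInterval α)] at h
    simpa using h

theorem mem_support_coinPosterior {μ : Measure I} [IsProbabilityMeasure μ] {x : I}
    (hx : x ∈ μ.support) {a b : ℕ} (h : bernLik a b x ≠ 0) :
    x ∈ (coinPosterior μ a b).support := by
  rw [Measure.mem_support_iff_forall]
  intro U hU
  obtain ⟨O, hOU, hO, hxO⟩ := mem_nhds_iff.1 hU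
  refine lt_of_lt_of_le ?_ (measure_mono hOU)
  rw [coinPosterior, Measure.smul_apply, smul_eq_mul, pos_iff_ne_zero]
  refine mul_ne_zero (ENNReal.inv_ne_zero.2 (lintegral_bernLik_ne_top μ a b)) ?_
  rw [withDensity_apply _ hO.measurableSet, ← pos_iff_ne_zero,
    setLIntegral_pos_iff (measurable_bernLik a b)]
  refine (Measure.mem_support_iff_forall x).1 hx _ (inter_mem ?_ (hO.mem_nhds hxO))
  exact (continuous_bernLik a b).continuousAt.eventually_ne h

namespace Market

variable {m : ℕ} {M : Market m} {s : ConsumerRule m} {H : FiniteHistory m}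

theorem fitMean_mem (hH : M.likelihood s H M.param ≠ 0) (j : Fin m) :
    M.fitMean H j ∈ Set.Ioo (0 : ℝ) 1 := by
  have := fitPosterior_prob hH
  exact integral_unitInterval_mem_Ioo
    (mem_support_coinPosterior (M.fit_mem_support j) (fitLik_ne_zero hH j)) (M.fit_pos j)
    (M.fit_lt_one j)

theorem qualityMean_mem (hH : M.likelihood s H M.param ≠ 0) (j : Fin m) :
    M.qualityMean H j ∈ Set.Icc (0 : ℝ) 1 := by
  have := qualityPosterior_prob hH
  exact integral_unitInterval_mem _

/-! ### Bounds on utilities -/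

variable (M)

/-- A bound on the absolute value of all utilities. -/
def utilityBound : ℝ := |M.valueBound| + ∑ j, M.price j + M.cost * m

end Market

theorem sum_fitWeight {m : ℕ} (p : Fin m → ℝ) : ∑ F, fitWeight p F = 1 := by
  have := Finset.prod_univ_sum (fun _ : Fin m => (Finset.univ : Finset Bool))
    fun k b => if b = true then p k else 1 - p k
  rw [Fintype.piFinset_univ] at this
  simp only [fitWeight]
  rw [← this]
  simp

theorem fitWeight_nonneg {m : ℕ} {p : Fin m → ℝ} (hp : ∀ j, p j ∈ Set.Icc (0 : ℝ) 1)
    (F : Fin m → Bool) : 0 ≤ fitWeight p F :=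
  Finset.prod_nonneg fun k _ => by
    split_ifs
    · exact (hp k).1
    · exact sub_nonneg.2 (hp k).2

namespace Market

variable {m : ℕ} (M : Market m) {p p' q q' : Fin m → ℝ} {V : ℝ}

theorem abs_gain_sub_cost_le (hq : ∀ j, q j ∈ Set.Icc (0 : ℝ) 1)
    (hV : V ∈ Set.Icc 0 M.valueBound) (T : SearchPolicy m) (F : Fin m → Bool) :
    |M.gain q V F (T.run F).2 - M.cost * ((T.run F).1.card : ℝ)| ≤ M.utilityBound := by
  have h₁ : M.cost * ((T.run F).1.card : ℝ) ≤ M.cost * m :=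
    mul_le_mul_of_nonneg_left (by exact_mod_cast card_finset_fin_le _) M.cost_nonneg
  have h₂ : 0 ≤ M.cost * ((T.run F).1.card : ℝ) := mul_nonneg M.cost_nonneg (Nat.cast_nonneg _)
  have hs : 0 ≤ ∑ j, M.price j := Finset.sum_nonneg fun j _ => M.price_nonneg j
  have hb := le_abs_self M.valueBound
  have hb' := abs_nonneg M.valueBound
  unfold utilityBound
  rw [abs_le]
  cases (T.run F).2 with
  | none => simp only [gain]; constructor <;> linarith
  | some j =>
    have h₃ : M.price j ≤ ∑ j, M.price j :=
      Finset.single_le_sum (fun j _ => M.price_nonneg j) (Finset.mem_univ j)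
    have h₄ := M.price_nonneg j
    have h₅ : 0 ≤ V * q j := mul_nonneg hV.1 (hq j).1
    have h₆ : V * q j ≤ M.valueBound := (mul_le_of_le_one_right hV.1 (hq j).2).trans hV.2
    simp only [gain]
    split_ifs <;> constructor <;> linarith

theorem abs_meanUtility_le (hp : ∀ j, p j ∈ Set.Icc (0 : ℝ) 1)
    (hq : ∀ j, q j ∈ Set.Icc (0 : ℝ) 1) (hV : V ∈ Set.Icc 0 M.valueBound) (T : SearchPolicy m) :
    |M.meanUtility p q V T| ≤ M.utilityBound := by
  refine (Finset.abs_sum_le_sum_abs _ _).trans ?_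
  rw [← one_mul M.utilityBound, ← sum_fitWeight p, Finset.sum_mul]
  refine Finset.sum_le_sum fun F _ => ?_
  rw [abs_mul, abs_of_nonneg (fitWeight_nonneg hp F)]
  exact mul_le_mul_of_nonneg_left (M.abs_gain_sub_cost_le hq hV T F) (fitWeight_nonneg hp F)

/-- A bound on the change of expected utilities, uniform in values and policies. -/
def utilityGap (p q p' q' : Fin m → ℝ) : ℝ :=
  ∑ F : Fin m → Bool, |fitWeight p F - fitWeight p' F| * M.utilityBound +
    M.valueBound * ∑ j, |q j - q' j|

theorem abs_meanUtility_sub_le (hp' : ∀ j, p' j ∈ Set.Icc (0 : ℝ) 1)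
    (hq : ∀ j, q j ∈ Set.Icc (0 : ℝ) 1) (hV : V ∈ Set.Icc 0 M.valueBound)
    (T : SearchPolicy m) :
    |M.meanUtility p q V T - M.meanUtility p' q' V T| ≤ M.utilityGap p q p' q' := by
  have hgain : ∀ F, |M.gain q V F (T.run F).2 - M.gain q' V F (T.run F).2| ≤
      M.valueBound * ∑ j, |q j - q' j| := fun F => by
    have hnn : 0 ≤ M.valueBound * ∑ j, |q j - q' j| :=
      mul_nonneg (hV.1.trans hV.2) (Finset.sum_nonneg fun j _ => abs_nonneg _)
    cases (T.run F).2 with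
    | none => simpa [gain] using hnn
    | some j =>
      simp only [gain]
      split_ifs
      · rw [sub_sub_sub_cancel_right, ← mul_sub, abs_mul, abs_of_nonneg hV.1]
        exact mul_le_mul hV.2 (Finset.single_le_sum (f := fun j => |q j - q' j|)
          (fun j _ => abs_nonneg _) (Finset.mem_univ j)) (abs_nonneg _) (hV.1.trans hV.2)
      · simpa using hnn
  unfold meanUtility utilityGap
  rw [← Finset.sum_sub_distrib]
  refine (Finset.abs_sum_le_sum_abs _ _).trans ?_
  rw [← one_mul (M.valueBound * _), ← sum_fitWeight p', Finset.sum_mul,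
    ← Finset.sum_add_distrib]
  refine Finset.sum_le_sum fun F _ => ?_
  have hsplit : fitWeight p F * (M.gain q V F (T.run F).2 - M.cost * ((T.run F).1.card : ℝ)) -
      fitWeight p' F * (M.gain q' V F (T.run F).2 - M.cost * ((T.run F).1.card : ℝ)) =
      (fitWeight p F - fitWeight p' F) *
        (M.gain q V F (T.run F).2 - M.cost * ((T.run F).1.card : ℝ)) +
      fitWeight p' F * (M.gain q V F (T.run F).2 - M.gain q' V F (T.run F).2) := by ring
  rw [hsplit]
  refine (abs_add_le _ _).trans (add_le_add ?_ ?_)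
  · rw [abs_mul]
    exact mul_le_mul_of_nonneg_left (M.abs_gain_sub_cost_le hq hV T F) (abs_nonneg _)
  · rw [abs_mul, abs_of_nonneg (fitWeight_nonneg hp' F)]
    exact mul_le_mul_of_nonneg_left (hgain F) (fitWeight_nonneg hp' F)

theorem tendsto_utilityGap {p q : ℕ → Fin m → ℝ} (hp : ∀ j, Tendsto (p · j) atTop (𝓝 (p' j)))
    (hq : ∀ j, Tendsto (q · j) atTop (𝓝 (q' j))) :
    Tendsto (fun n => M.utilityGap (p n) (q n) p' q') atTop (𝓝 0) := by
  have h : Continuous fun z : (Fin m → ℝ) × (Fin m → ℝ) => M.utilityGap z.1 z.2 p' q' := by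
    unfold utilityGap
    have := fun F => continuous_fitWeight (m := m) F
    refine .add ?_ (by fun_prop)
    exact continuous_finsetSum _ fun F _ =>
      (((this F).comp continuous_fst).sub continuous_const).abs.mul continuous_const
  have h' := (h.tendsto (p', q')).comp
    ((tendsto_pi_nhds.2 hp).prodMk_nhds (tendsto_pi_nhds.2 hq))
  simpa [utilityGap, Function.comp_def] using h'

/-- The expected utility depends only on the parameters of the businesses that may be
inspected. -/
theorem meanUtility_congr {T : SearchPolicy m} (hT : T.IsAdmissible ∅) {S : Set (Fin m)}
    (hS : ∀ F, ∀ j ∈ (T.run F).1, j ∈ S) (hp : ∀ j ∈ S, p j = p' j) (hq : ∀ j ∈ S, q j = q' j) :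
    M.meanUtility p q V T = M.meanUtility p' q' V T := by
  have hg : ∀ F, M.gain q V F (T.run F).2 = M.gain q' V F (T.run F).2 := fun F => by
    cases ho : (T.run F).2 with
    | none => rfl
    | some j => simp only [gain, hq j (hS F j (hT.choice_mem_run ho))]
  unfold meanUtility
  simp only [hg]
  refine sum_fitWeight_congr fun i hi F b => ?_
  have hiS : i ∉ S := fun h => hi (hp i h)
  have : T.run (Function.update F i b) = T.run F := T.run_congr fun j hj =>
    Function.update_of_ne (fun h => hiS (by rw [← h]; exact hS F j hj)) _ _
  rw [this]
  congr 1
  cases ho : (T.run F).2 with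
  | none => rfl
  | some j =>
    have : j ≠ i := fun h => hiS (h ▸ hS F j (hT.choice_mem_run ho))
    simp only [gain, Function.update_of_ne this]

theorem measurable_meanUtility (p q : Fin m → ℝ) :
    Measurable fun z : ℝ × SearchPolicy m => M.meanUtility p q z.1 z.2 := by
  refine measurable_from_prod_countable_left fun T => ?_
  refine Finset.measurable_sum _ fun F _ => ?_
  have h : Measurable fun V => M.gain q V F (T.run F).2 := ?_
  · exact (h.sub_const (M.cost * ((T.run F).1.card : ℝ))).const_mul (fitWeight p F)
  cases (T.run F).2 with
  | none => exact measurable_const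
  | some j =>
    simp only [gain]
    split_ifs <;> fun_prop

end Market

/-! ### Posterior consistency -/

/-- The posterior mass of a set vanishes if the likelihood there is exponentially smaller than near
a point of the support. -/
theorem tendsto_coinPosterior_of_le {μ : Measure I} [IsProbabilityMeasure μ] {x : I}
    (hx : x ∈ μ.support) {a b : ℕ → ℕ} {s U : Set I} (hs : MeasurableSet s) (hU : U ∈ 𝓝 x)
    {r₁ r₂ : ℝ≥0∞} (hr : r₁ < r₂) (hr₂ : r₂ ≠ ∞)
    (h₁ : ∀ᶠ k in atTop, ∀ p ∈ s, bernLik (a k) (b k) p ≤ r₁ ^ k)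
    (h₂ : ∀ᶠ k in atTop, ∀ p ∈ U, r₂ ^ k ≤ bernLik (a k) (b k) p) :
    Tendsto (fun k => coinPosterior μ (a k) (b k) s) atTop (𝓝 0) := by
  obtain ⟨O, hOU, hO, hxO⟩ := mem_nhds_iff.1 hU
  have hμO : μ O ≠ 0 := ((Measure.mem_support_iff_forall x).1 hx O (hO.mem_nhds hxO)).ne'
  have hr₂' : r₂ ≠ 0 := (bot_le.trans_lt hr).ne'
  have hlim : Tendsto (fun k => (r₁ / r₂) ^ k * (μ O)⁻¹) atTop (𝓝 0) := by
    have : r₁ / r₂ < 1 := (ENNReal.div_lt_iff (.inl hr₂') (.inl hr₂)).2 (by rwa [one_mul])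
    simpa using ENNReal.Tendsto.mul_const (ENNReal.tendsto_pow_atTop_nhds_zero_of_lt_one this)
      (.inr (ENNReal.inv_ne_top.2 hμO))
  refine tendsto_of_tendsto_of_tendsto_of_le_of_le' tendsto_const_nhds hlim
    (.of_forall fun _ => zero_le) ?_
  filter_upwards [h₁, h₂] with k hk₁ hk₂
  rw [coinPosterior, Measure.smul_apply, smul_eq_mul, withDensity_apply _ hs]
  have hnum : ∫⁻ p in s, bernLik (a k) (b k) p ∂μ ≤ r₁ ^ k := by
    refine (setLIntegral_mono measurable_const hk₁).trans ?_
    rw [setLIntegral_const]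
    exact mul_le_of_le_one_right' prob_le_one
  have hden : r₂ ^ k * μ O ≤ ∫⁻ p, bernLik (a k) (b k) p ∂μ := by
    rw [← setLIntegral_const]
    exact (setLIntegral_mono (measurable_bernLik _ _) fun p hp => hk₂ p (hOU hp)).trans
      (setLIntegral_le_lintegral _ _)
  refine (mul_le_mul' (ENNReal.inv_le_inv.2 hden) hnum).trans_eq ?_
  rw [ENNReal.mul_inv (.inl (pow_ne_zero k hr₂')) (.inl (ENNReal.pow_ne_top hr₂)),
    ENNReal.div_eq_inv_mul, mul_pow, ENNReal.inv_pow]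
  ring

/-- The likelihood per observation if the frequency of successes is `y`. -/
def meanLik (y p : ℝ) : ℝ := p ^ y * (1 - p) ^ (1 - y)

theorem meanLik_nonneg (y : ℝ) (p : I) : 0 ≤ meanLik y p :=
  mul_nonneg (Real.rpow_nonneg p.2.1 _) (Real.rpow_nonneg (sub_nonneg.2 p.2.2) _)

theorem bernLik_eq_meanLik_pow {a b k : ℕ} (hk : 0 < k) (h : a + b = k) (p : I) :
    bernLik a b p = ENNReal.ofReal (meanLik (a / k) p) ^ k := by
  have hk' : (k : ℝ) ≠ 0 := by exact_mod_cast hk.ne'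
  have hp := p.2.1
  have hp' : (0 : ℝ) ≤ 1 - p := sub_nonneg.2 p.2.2
  have h₁ : ((p : ℝ) ^ ((a : ℝ) / k)) ^ k = (p : ℝ) ^ a := by
    rw [← Real.rpow_mul_natCast hp, div_mul_cancel₀ _ hk', Real.rpow_natCast]
  have h₂ : ((1 - p : ℝ) ^ (1 - (a : ℝ) / k)) ^ k = (1 - p : ℝ) ^ b := by
    have : (1 - (a : ℝ) / k) * k = b := by
      rw [← h]; push_cast [← h]; field_simp [show ((a : ℝ) + b) ≠ 0 by exact_mod_cast h ▸ hk.ne']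
      ring
    rw [← Real.rpow_mul_natCast hp', this, Real.rpow_natCast]
  rw [← ENNReal.ofReal_pow (meanLik_nonneg _ p), meanLik, mul_pow, h₁, h₂, bernLik,
    ENNReal.ofReal_mul (pow_nonneg hp a), ENNReal.ofReal_pow hp, ENNReal.ofReal_pow hp']

/-- The likelihood is uniquely maximized by the empirical frequency. -/
theorem meanLik_lt {x : ℝ} (h₀ : 0 < x) (h₁ : x < 1) {p : I} (hp : (p : ℝ) ≠ x) :
    meanLik x p < meanLik x x := by
  have hpos : 0 < meanLik x x :=
    mul_pos (Real.rpow_pos_of_pos h₀ _) (Real.rpow_pos_of_pos (sub_pos.2 h₁) _)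
  rcases p.2.1.eq_or_lt with hp₀ | hp₀
  · rwa [meanLik, ← hp₀, Real.zero_rpow h₀.ne', zero_mul]
  rcases p.2.2.eq_or_lt with hp₁ | hp₁
  · rwa [meanLik, hp₁, sub_self, Real.zero_rpow (sub_pos.2 h₁).ne', mul_zero]
  have hx' := sub_pos.2 h₁
  have hp' := sub_pos.2 hp₁
  rw [meanLik, meanLik, Real.rpow_def_of_pos hp₀, Real.rpow_def_of_pos hp',
    Real.rpow_def_of_pos h₀, Real.rpow_def_of_pos hx', ← Real.exp_add, ← Real.exp_add,
    Real.exp_lt_exp]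
  have e₁ := Real.log_lt_sub_one_of_pos (div_pos hp₀ h₀) (by rwa [Ne, div_eq_one_iff_eq h₀.ne'])
  have e₂ := Real.log_le_sub_one_of_pos (div_pos hp' hx')
  rw [Real.log_div hp₀.ne' h₀.ne'] at e₁
  rw [Real.log_div hp'.ne' hx'.ne'] at e₂
  have e₁' := mul_lt_mul_of_pos_left e₁ h₀
  have e₂' := mul_le_mul_of_nonneg_left e₂ hx'.le
  have f₁ : x * ((p : ℝ) / x - 1) = p - x := by field_simp
  have f₂ : (1 - x) * ((1 - p : ℝ) / (1 - x) - 1) = x - p := by field_simp; ring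
  rw [f₁] at e₁'
  rw [f₂] at e₂'
  linarith

theorem continuousAt_meanLik {x : ℝ} (h₀ : 0 < x) (h₁ : x < 1) (p : ℝ) :
    ContinuousAt (fun z : ℝ × ℝ => meanLik z.1 z.2) (x, p) := by
  have e₁ : ContinuousAt (fun z : ℝ × ℝ => z.2 ^ z.1) (x, p) :=
    (Real.continuousAt_rpow_of_pos (p, x) h₀).comp (f := fun z : ℝ × ℝ => (z.2, z.1))
      (x := (x, p)) (by fun_prop)
  have e₂ : ContinuousAt (fun z : ℝ × ℝ => (1 - z.2) ^ (1 - z.1)) (x, p) :=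
    (Real.continuousAt_rpow_of_pos (1 - p, 1 - x) (sub_pos.2 h₁)).comp
      (f := fun z : ℝ × ℝ => (1 - z.2, 1 - z.1)) (x := (x, p)) (by fun_prop)
  exact e₁.mul e₂

/-- Posterior consistency for an interior bias. -/
theorem tendsto_coinPosterior_interior {μ : Measure I} [IsProbabilityMeasure μ] {x : I}
    (hx : x ∈ μ.support) (h₀ : 0 < x) (h₁ : x < 1) {a b : ℕ → ℕ} (hab : ∀ k, a k + b k = k)
    (hfreq : Tendsto (fun k => (a k : ℝ) / k) atTop (𝓝 x)) {ε : ℝ} (hε : 0 < ε) :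
    Tendsto (fun k => coinPosterior μ (a k) (b k) {p | ε ≤ dist p x}) atTop (𝓝 0) := by
  have hclosed : IsClosed {p : I | ε ≤ dist p x} :=
    isClosed_le continuous_const (continuous_id.dist continuous_const)
  have hcont : ∀ p : I, ContinuousAt (fun z : ℝ × I => meanLik z.1 z.2) (x, p) := fun p =>
    (continuousAt_meanLik (x := x) h₀ h₁ p).comp (f := fun z : ℝ × I => (z.1, (z.2 : ℝ)))
      (x := ((x : ℝ), p)) (by fun_prop)
  have hG : 0 < meanLik x x := mul_pos (Real.rpow_pos_of_pos h₀ _)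
    (Real.rpow_pos_of_pos (sub_pos.2 (show (x : ℝ) < 1 from h₁)) _)
  obtain ⟨r, hr₀, hrG, hr⟩ : ∃ r, 0 ≤ r ∧ r < meanLik x x ∧
      ∀ p : I, ε ≤ dist p x → meanLik x p ≤ r := by
    rcases Set.eq_empty_or_nonempty {p : I | ε ≤ dist p x} with he | hne
    · exact ⟨0, le_rfl, hG, fun p hp => absurd (show p ∈ {p : I | ε ≤ dist p x} from hp)
        (by simp [he])⟩
    · have hc : ContinuousOn (fun p : I => meanLik x p) {p : I | ε ≤ dist p x} :=
        fun p _ => ((hcont p).comp (f := fun p : I => ((x : ℝ), p)) (x := p)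
          (by fun_prop)).continuousWithinAt
      obtain ⟨p, hp, hmax⟩ := hclosed.isCompact.exists_isMaxOn hne hc
      refine ⟨_, meanLik_nonneg _ p, meanLik_lt (x := x) h₀ h₁ (p := p) fun h => ?_,
        fun p' hp' => hmax hp'⟩
      have : p = x := Subtype.ext h
      rw [Set.mem_ofPred_eq, this, dist_self] at hp
      exact hp.not_gt hε
  obtain ⟨r₁, hrr₁, hr₁⟩ := exists_between hrG
  obtain ⟨r₂, hr₁₂, hr₂⟩ := exists_between hr₁
  have hr₁' : 0 ≤ r₁ := hr₀.trans hrr₁.le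
  have hfar : ∀ᶠ y in 𝓝 (x : ℝ), ∀ p ∈ {p : I | ε ≤ dist p x}, meanLik y p < r₁ :=
    hclosed.isCompact.eventually_forall_of_forall_eventually fun p hp =>
      (hcont p).eventually_lt_const ((hr p hp).trans_lt hrr₁)
  have hnear : ∀ᶠ z in 𝓝 ((x : ℝ), x), r₂ < meanLik z.1 z.2 :=
    (hcont x).eventually_const_lt hr₂
  rw [nhds_prod_eq, eventually_prod_iff] at hnear
  obtain ⟨A, hA, U, hU, hAU⟩ := hnear
  refine tendsto_coinPosterior_of_le hx hclosed.measurableSet hU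
    (r₁ := ENNReal.ofReal r₁) (r₂ := ENNReal.ofReal r₂)
    ((ENNReal.ofReal_lt_ofReal_iff (hr₁'.trans_lt hr₁₂)).2 hr₁₂) ENNReal.ofReal_ne_top ?_ ?_
  · filter_upwards [hfreq.eventually hfar, eventually_gt_atTop 0] with k hk hk₀ p hp
    rw [bernLik_eq_meanLik_pow hk₀ (hab k)]
    gcongr
    exact (hk p hp).le
  · filter_upwards [hfreq.eventually hA, eventually_gt_atTop 0] with k hk hk₀ p hp
    rw [bernLik_eq_meanLik_pow hk₀ (hab k)]
    gcongr
    exact (hAU hk hp).le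

/-- Posterior consistency: if the empirical frequencies converge to a point of the support of the
prior, then the posterior concentrates at this point. -/
theorem tendsto_coinPosterior {μ : Measure I} [IsProbabilityMeasure μ] {x : I}
    (hx : x ∈ μ.support) {a b : ℕ → ℕ} (hab : ∀ k, a k + b k = k)
    (hfreq : Tendsto (fun k => (a k : ℝ) / k) atTop (𝓝 x)) (ha : x = 0 → ∀ k, a k = 0)
    (hb : x = 1 → ∀ k, b k = 0) {ε : ℝ} (hε : 0 < ε) :
    Tendsto (fun k => coinPosterior μ (a k) (b k) {p | ε ≤ dist p x}) atTop (𝓝 0) := by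
  have hmeas : MeasurableSet {p : I | ε ≤ dist p x} :=
    (isClosed_le continuous_const (continuous_id.dist continuous_const)).measurableSet
  have hlt : ENNReal.ofReal (1 - ε) < ENNReal.ofReal (1 - min ε 1 / 2) := by
    rw [ENNReal.ofReal_lt_ofReal_iff] <;> rcases min_cases ε 1 with h | h <;> linarith
  have hU : {p : I | dist p x < min ε 1 / 2} ∈ 𝓝 x := Metric.ball_mem_nhds x (by positivity)
  by_cases hx₀ : x = 0
  · subst hx₀
    have hb' : ∀ k, b k = k := fun k => by simpa [ha rfl k] using hab k
    refine tendsto_coinPosterior_of_le hx hmeas hU hlt ENNReal.ofReal_ne_top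
      (.of_forall fun k p hp => ?_) (.of_forall fun k p hp => ?_) <;>
    · rw [ha rfl k, hb' k, bernLik, pow_zero, one_mul]
      gcongr
      rw [Set.mem_ofPred_eq, Subtype.dist_eq, Real.dist_eq] at hp
      simp [abs_of_nonneg p.2.1] at hp
      first | exact hp | (rcases min_cases ε 1 with h | h <;> simp [h.1] at hp ⊢ <;> linarith)
  by_cases hx₁ : x = 1
  · subst hx₁
    have ha' : ∀ k, a k = k := fun k => by simpa [hb rfl k] using hab k
    refine tendsto_coinPosterior_of_le hx hmeas hU hlt ENNReal.ofReal_ne_top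
      (.of_forall fun k p hp => ?_) (.of_forall fun k p hp => ?_) <;>
    · rw [hb rfl k, ha' k, bernLik, pow_zero, mul_one]
      gcongr
      rw [Set.mem_ofPred_eq, Subtype.dist_eq, Real.dist_eq, abs_sub_comm] at hp
      simp only [Set.Icc.coe_one, abs_of_nonneg (sub_nonneg.2 p.2.2)] at hp
      linarith
  exact tendsto_coinPosterior_interior hx (unitInterval.pos_iff_ne_zero.2 hx₀)
    (unitInterval.lt_one_iff_ne_one.2 hx₁) hab hfreq hε

/-- Convergence in probability to a constant implies convergence of the mean. -/
theorem tendsto_integral_of_tendsto_measure {α : ℕ → Measure I} {x : I}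
    (hα : ∀ n, IsProbabilityMeasure (α n))
    (h : ∀ ε : ℝ, 0 < ε → Tendsto (fun n => α n {p | ε ≤ dist p x}) atTop (𝓝 0)) :
    Tendsto (fun n => ∫ p, (p : ℝ) ∂α n) atTop (𝓝 x) := by
  rw [Metric.tendsto_atTop']
  intro ε hε
  have h' := (ENNReal.tendsto_toReal ENNReal.zero_ne_top).comp (h (ε / 2) (by positivity))
  obtain ⟨N, hN⟩ := eventually_atTop.1 (h'.eventually_lt_const (u := ε / 2) (by simpa using hε))
  refine ⟨N, fun n hn => ?_⟩
  have hlt : (α n).real {p | ε / 2 ≤ dist p x} < ε / 2 := hN n hn.le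
  have := hα n
  have hmeas : MeasurableSet {p : I | ε / 2 ≤ dist p x} :=
    (isClosed_le continuous_const (continuous_id.dist continuous_const)).measurableSet
  have heq : ∫ p, (p : ℝ) ∂α n - x = ∫ p, ((p : ℝ) - x) ∂α n := by
    rw [integral_sub (integrable_unitInterval _) (integrable_const _)]
    simp
  rw [Real.dist_eq, heq]
  refine (abs_integral_le_integral_abs).trans_lt ?_
  have hle : ∀ p : I, |(p : ℝ) - x| ≤ ε / 2 +
      {p : I | ε / 2 ≤ dist p x}.indicator (fun _ => (1 : ℝ)) p := fun p => by
    by_cases hp : ε / 2 ≤ dist p x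
    · rw [Set.indicator_of_mem (by exact hp)]
      have : |(p : ℝ) - x| ≤ 1 := abs_sub_le_iff.2
        ⟨by linarith [p.2.2, x.2.1], by linarith [x.2.2, p.2.1]⟩
      linarith
    · rw [Set.indicator_of_notMem (by exact hp), add_zero]
      exact (not_le.1 hp).le
  refine (integral_mono ((integrable_unitInterval _).sub (integrable_const _)).abs
    ((integrable_const _).add ((integrable_const _).indicator hmeas)) hle).trans_lt ?_
  simp only [Pi.add_apply]
  rw [integral_add (integrable_const _) ((integrable_const _).indicator hmeas),
    integral_indicator_const _ hmeas]
  simp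
  linarith

/-! ### Histories generated from tapes of outcomes -/

section History

variable {m : ℕ}

instance : Countable (Feedback m) :=
  Function.Injective.countable (f := fun h : Feedback m => (h.fits, h.transaction))
    fun h h' e => by cases h; cases h'; simp_all

/-- The primitive randomness: values, fit profiles and quality profiles. -/
abbrev Primitives (m : ℕ) : Type := ℕ → ℝ × (Fin m → Bool) × (Fin m → Bool)

/-- The feedback of the round after the history `H`, if the fit and the quality of business `j` are
read off the primitives with the indices `c j H` and `c' j H`. -/
def readFeedback (c c' : Fin m → FiniteHistory m → ℕ) (s : ConsumerRule m) (ω : Primitives m)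
    (H : FiniteHistory m) (V : ℝ) : Feedback m :=
  (s H V).feedback (fun j => (ω (c j H)).2.1 j) (fun j => (ω (c' j H)).2.2 j)

/-- The history up to round `n` if the fit and the quality of business `j` are read off the
primitives with the indices `c j` and `c' j`. -/
def readHistory (c c' : Fin m → FiniteHistory m → ℕ) (s : ConsumerRule m) (ω : Primitives m) :
    ℕ → FiniteHistory m
  | 0 => []
  | n + 1 => readFeedback c c' s ω (readHistory c c' s ω n) (ω n).1 :: readHistory c c' s ω n

/-- The infinite history if the fit and the quality of business `j` are read off the primitives with
the indices `c j` and `c' j`. -/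
def readFull (c c' : Fin m → FiniteHistory m → ℕ) (s : ConsumerRule m) (ω : Primitives m) :
    History m :=
  fun n => readFeedback c c' s ω (readHistory c c' s ω n) (ω n).1

theorem take_readFull (c c' : Fin m → FiniteHistory m → ℕ) (s : ConsumerRule m)
    (ω : Primitives m) (n : ℕ) :
    (readFull c c' s ω).take n = readHistory c c' s ω n := by
  induction n with
  | zero => rfl
  | succ n ih => rw [History.take, ih]; rfl

theorem length_readHistory (c c' : Fin m → FiniteHistory m → ℕ) (s : ConsumerRule m)
    (ω : Primitives m) (n : ℕ) : (readHistory c c' s ω n).length = n := by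
  induction n with
  | zero => rfl
  | succ n ih => simp [readHistory, ih]

/-- The indices `c` are never used twice for the observation `f`. -/
structure IsClock (f : Feedback m → Option Bool) (c : FiniteHistory m → ℕ) : Prop where
  le_length : ∀ H, c H ≤ H.length
  mono : ∀ h H, c H ≤ c (h :: H)
  strict : ∀ h H, f h ≠ none → c H < c (h :: H)

theorem isClock_length (f : Feedback m → Option Bool) : IsClock f List.length where
  le_length _ := le_rfl
  mono _ _ := by simp
  strict _ _ _ := by simp

theorem obsTotal_cons (f : Feedback m → Option Bool) (h : Feedback m) (H : FiniteHistory m) :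
    obsTotal f (h :: H) = obsTotal f H + if f h = none then 0 else 1 := by
  unfold obsTotal
  rcases hf : f h with _ | _ | _ <;> simp [obsCount, hf] <;> omega

theorem isClock_obsTotal (f : Feedback m → Option Bool) : IsClock f (obsTotal f) where
  le_length H := by
    induction H with
    | nil => simp [obsTotal, obsCount]
    | cons h H ih =>
      rw [obsTotal_cons, List.length_cons]
      split_ifs <;> omega
  mono h H := by rw [obsTotal_cons]; omega
  strict h H hf := by rw [obsTotal_cons, if_neg hf]; omega

/-- The outcome on the tape at index `i` that is implied by the observations `f` in a history. -/
def record (f : Feedback m → Option Bool) (c : FiniteHistory m → ℕ) :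
    FiniteHistory m → ℕ → Option Bool
  | [], _ => none
  | h :: H, i => if i = c H then f h else record f c H i

theorem record_eq_none {f : Feedback m → Option Bool} {c : FiniteHistory m → ℕ}
    (hc : IsClock f c) {H : FiniteHistory m} {i : ℕ} (hi : c H ≤ i) : record f c H i = none := by
  induction H with
  | nil => rfl
  | cons h H ih =>
    rw [record]
    split_ifs with hiH
    · by_contra hf
      have := hc.strict h H hf
      omega
    · exact ih ((hc.mono h H).trans hi)

theorem forall_record_cons {f : Feedback m → Option Bool} {c : FiniteHistory m → ℕ}
    (hc : IsClock f c) (h : Feedback m) (H : FiniteHistory m) (x : ℕ → Bool) :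
    (∀ i b, record f c (h :: H) i = some b → x i = b) ↔
      (∀ i b, record f c H i = some b → x i = b) ∧ ∀ b, f h = some b → x (c H) = b := by
  constructor
  · refine fun hx => ⟨fun i b hi => hx i b ?_, fun b hb => hx (c H) b (by simpa [record] using hb)⟩
    rw [record, if_neg]
    · exact hi
    · rintro rfl
      rw [record_eq_none hc le_rfl] at hi
      exact absurd hi (by simp)
  · rintro ⟨h₁, h₂⟩ i b hi
    rw [record] at hi
    split_ifs at hi with hiH
    · rw [hiH]; exact h₂ b hi
    · exact h₁ i b hi

theorem prod_obsProb_record {f : Feedback m → Option Bool} {c : FiniteHistory m → ℕ}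
    (hc : IsClock f c) (p : I) {H : FiniteHistory m} {N : ℕ} (hN : H.length ≤ N) :
    ∏ i ∈ Finset.range N, obsProb p (record f c H i) =
      bernLik (obsCount f true H) (obsCount f false H) p := by
  induction H with
  | nil => simp [record, obsProb_none, obsCount, bernLik]
  | cons h H ih =>
    rw [List.length_cons] at hN
    have hmem : c H ∈ Finset.range N := Finset.mem_range.2 ((hc.le_length H).trans_lt hN)
    rw [← bernLik_mul_obsProb, ← ih (by omega), ← Finset.mul_prod_erase _ _ hmem,
      ← Finset.mul_prod_erase _ (fun i => obsProb p (record f c H i)) hmem,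
      record_eq_none hc le_rfl, obsProb_none, one_mul, record, if_pos rfl, mul_comm]
    congr 1
    refine Finset.prod_congr rfl fun i hi => ?_
    rw [record, if_neg (Finset.ne_of_mem_erase hi)]

/-- The values of the consumer in round `i` that are compatible with a history. -/
def valueRecord (s : ConsumerRule m) : FiniteHistory m → ℕ → Set ℝ
  | [], _ => Set.univ
  | h :: H, i => if i = H.length then {V | (s H V).Produces h} else valueRecord s H i

theorem valueRecord_eq_univ (s : ConsumerRule m) {H : FiniteHistory m} {i : ℕ}
    (hi : H.length ≤ i) : valueRecord s H i = Set.univ := by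
  induction H with
  | nil => rfl
  | cons h H ih =>
    rw [List.length_cons] at hi
    rw [valueRecord, if_neg (by omega), ih (by omega)]

theorem forall_valueRecord_cons (s : ConsumerRule m) (h : Feedback m) (H : FiniteHistory m)
    (x : ℕ → ℝ) : (∀ i, x i ∈ valueRecord s (h :: H) i) ↔
      (∀ i, x i ∈ valueRecord s H i) ∧ (s H (x H.length)).Produces h := by
  constructor
  · refine fun hx => ⟨fun i => ?_, by simpa [valueRecord] using hx H.length⟩
    by_cases hi : i = H.length
    · rw [valueRecord_eq_univ s hi.ge]; trivial
    · simpa [valueRecord, hi] using hx i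
  · rintro ⟨h₁, h₂⟩ i
    rw [valueRecord]
    split_ifs with hi
    · rw [hi]; exact h₂
    · exact h₁ i

theorem readHistory_eq_iff {c c' : Fin m → FiniteHistory m → ℕ}
    (hc : ∀ j, IsClock (·.fits j) (c j)) (hc' : ∀ j, IsClock (·.qualities j) (c' j))
    (s : ConsumerRule m) (ω : Primitives m) (H : FiniteHistory m) :
    readHistory c c' s ω H.length = H ↔ (∀ i, (ω i).1 ∈ valueRecord s H i) ∧
      (∀ j i b, record (·.fits j) (c j) H i = some b → (ω i).2.1 j = b) ∧
      ∀ j i b, record (·.qualities j) (c' j) H i = some b → (ω i).2.2 j = b := by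
  induction H with
  | nil => simp [readHistory, valueRecord, record]
  | cons h H ih =>
    rw [forall_valueRecord_cons s h H fun i => (ω i).1]
    simp only [fun j => forall_record_cons (hc j) h H fun i => (ω i).2.1 j,
      fun j => forall_record_cons (hc' j) h H fun i => (ω i).2.2 j, forall_and]
    rw [List.length_cons, readHistory, List.cons.injEq, and_comm]
    have : readHistory c c' s ω H.length = H ∧
        readFeedback c c' s ω (readHistory c c' s ω H.length) (ω H.length).1 = h ↔
        readHistory c c' s ω H.length = H ∧ readFeedback c c' s ω H (ω H.length).1 = h := by
      constructor <;> rintro ⟨h₁, h₂⟩ <;> refine ⟨h₁, ?_⟩ <;> simpa [h₁] using h₂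
    rw [this, ih, readFeedback, SearchPolicy.feedback_eq_iff]
    tauto

/-- The set of primitives with which the history `H` may be read off at index `i`. -/
def recordBox (c c' : Fin m → FiniteHistory m → ℕ) (s : ConsumerRule m) (H : FiniteHistory m)
    (i : ℕ) : Set (ℝ × (Fin m → Bool) × (Fin m → Bool)) :=
  valueRecord s H i ×ˢ ({F | ∀ j b, record (·.fits j) (c j) H i = some b → F j = b} ×ˢ
    {q | ∀ j b, record (·.qualities j) (c' j) H i = some b → q j = b})

theorem setOf_readHistory_eq {c c' : Fin m → FiniteHistory m → ℕ}
    (hc : ∀ j, IsClock (·.fits j) (c j)) (hc' : ∀ j, IsClock (·.qualities j) (c' j))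
    (s : ConsumerRule m) (H : FiniteHistory m) :
    {ω | readHistory c c' s ω H.length = H} =
      Set.pi (Finset.range H.length) (recordBox c c' s H) := by
  ext ω
  rw [Set.mem_ofPred_eq, readHistory_eq_iff hc hc']
  simp only [Set.mem_pi, Finset.coe_range, Set.mem_Iio, recordBox, Set.mem_prod, Set.mem_ofPred_eq]
  constructor
  · rintro ⟨h₁, h₂, h₃⟩ i _
    exact ⟨h₁ i, fun j b => h₂ j i b, fun j b => h₃ j i b⟩
  · intro h
    refine ⟨fun i => ?_, fun j i b hi => ?_, fun j i b hi => ?_⟩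
    · by_cases hi : i < H.length
      · exact (h i hi).1
      · rw [valueRecord_eq_univ s (not_lt.1 hi)]; trivial
    · by_cases hiH : i < H.length
      · exact (h i hiH).2.1 j b hi
      · rw [record_eq_none (hc j) (((hc j).le_length H).trans (not_lt.1 hiH))] at hi
        exact absurd hi (by simp)
    · by_cases hiH : i < H.length
      · exact (h i hiH).2.2 j b hi
      · rw [record_eq_none (hc' j) (((hc' j).le_length H).trans (not_lt.1 hiH))] at hi
        exact absurd hi (by simp)

theorem measurable_feedback {s : ConsumerRule m} (hs : ∀ H, Measurable (s H))
    (H : FiniteHistory m) :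
    Measurable fun x : ℝ × (Fin m → Bool) × (Fin m → Bool) => (s H x.1).feedback x.2.1 x.2.2 :=
  (Measurable.of_discrete (f := fun z : SearchPolicy m × (Fin m → Bool) × (Fin m → Bool) =>
    z.1.feedback z.2.1 z.2.2)).comp (((hs H).comp measurable_fst).prodMk measurable_snd)

theorem measurableSet_valueRecord {s : ConsumerRule m} (hs : ∀ H, Measurable (s H))
    (H : FiniteHistory m) (i : ℕ) : MeasurableSet (valueRecord s H i) := by
  induction H with
  | nil => exact MeasurableSet.univ
  | cons h H ih =>
    rw [valueRecord]
    split_ifs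
    · exact hs H (MeasurableSet.of_discrete (s := {T | T.Produces h}))
    · exact ih

theorem measurableSet_recordBox {s : ConsumerRule m} (hs : ∀ H, Measurable (s H))
    (c c' : Fin m → FiniteHistory m → ℕ) (H : FiniteHistory m) (i : ℕ) :
    MeasurableSet (recordBox c c' s H i) :=
  (measurableSet_valueRecord hs H i).prod .of_discrete

theorem measurableSet_readHistory {c c' : Fin m → FiniteHistory m → ℕ}
    (hc : ∀ j, IsClock (·.fits j) (c j)) (hc' : ∀ j, IsClock (·.qualities j) (c' j))
    {s : ConsumerRule m} (hs : ∀ H, Measurable (s H)) (n : ℕ) (H : FiniteHistory m) :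
    MeasurableSet {ω | readHistory c c' s ω n = H} := by
  by_cases hn : n = H.length
  · rw [hn, setOf_readHistory_eq hc hc']
    exact MeasurableSet.pi (Finset.countable_toSet _) fun i _ => measurableSet_recordBox hs c c' H i
  · convert MeasurableSet.empty
    ext ω
    simp only [Set.mem_ofPred_eq, Set.mem_empty_iff_false, iff_false]
    rintro rfl
    exact hn (length_readHistory c c' s ω n).symm

theorem measurable_readFull {c c' : Fin m → FiniteHistory m → ℕ}
    (hc : ∀ j, IsClock (·.fits j) (c j)) (hc' : ∀ j, IsClock (·.qualities j) (c' j))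
    {s : ConsumerRule m} (hs : ∀ H, Measurable (s H)) : Measurable (readFull c c' s) := by
  refine measurable_pi_iff.2 fun n => measurable_to_countable' fun h => ?_
  have : (fun ω => readFull c c' s ω n) ⁻¹' {h} =
      ⋃ H, {ω | readHistory c c' s ω (n + 1) = h :: H} := by
    ext ω
    simp [readHistory, readFull]
  rw [this]
  exact MeasurableSet.iUnion fun H => measurableSet_readHistory hc hc' hs _ _

theorem measurableSet_take (n : ℕ) (H : FiniteHistory m) :
    MeasurableSet {h : History m | h.take n = H} := by
  induction n generalizing H with
  | zero => exact MeasurableSet.const ([] = H)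
  | succ n ih =>
    cases H with
    | nil => simp [History.take]
    | cons h H =>
      have : {h' : History m | h'.take (n + 1) = h :: H} =
          (fun h' => h' n) ⁻¹' {h} ∩ {h' | h'.take n = H} := by
        ext h'; simp [History.take]
      rw [this]
      exact (measurable_pi_apply n (measurableSet_singleton h)).inter (ih H)

theorem length_take (h : History m) (n : ℕ) : (h.take n).length = n := by
  induction n with
  | zero => rfl
  | succ n ih => simp [History.take, ih]

theorem take_eq_of_le {h h' : History m} {n k : ℕ} (hnk : n ≤ k) (e : h.take k = h'.take k) :
    h.take n = h'.take n := by
  induction k, hnk using Nat.le_induction with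
  | base => exact e
  | succ k _ ih => exact ih (List.cons.inj e).2

/-- Laws of infinite histories are determined by the probabilities of finite histories. -/
theorem historyMeasure_ext {μ ν : Measure (History m)} [IsProbabilityMeasure μ]
    [IsProbabilityMeasure ν]
    (h : ∀ H : FiniteHistory m, μ {h | h.take H.length = H} = ν {h | h.take H.length = H}) :
    μ = ν := by
  refine ext_of_generate_finite (Set.range fun H : FiniteHistory m =>
    {h : History m | h.take H.length = H}) (le_antisymm ?_ ?_) ?_ ?_ (by simp)
  · refine iSup_le fun n => ?_
    rw [← measurable_iff_comap_le]
    refine @measurable_to_countable' _ _ _ _ (_) _ fun x => ?_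
    have : (fun h : History m => h n) ⁻¹' {x} = ⋃ H : FiniteHistory m, ⋃ _ : H.length = n,
        {h : History m | h.take (x :: H).length = x :: H} := by
      ext h
      simp only [Set.mem_preimage, Set.mem_singleton_iff, Set.mem_iUnion, Set.mem_ofPred_eq,
        exists_prop]
      refine ⟨fun hx => ⟨h.take n, length_take h n, ?_⟩, ?_⟩
      · rw [List.length_cons, length_take, History.take, hx]
      · rintro ⟨H, rfl, hH⟩
        exact (List.cons.inj hH).1
    rw [this]
    exact .iUnion fun H => .iUnion fun _ => MeasurableSpace.measurableSet_generateFrom ⟨x :: H, rfl⟩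
  · refine MeasurableSpace.generateFrom_le ?_
    rintro _ ⟨H, rfl⟩
    exact measurableSet_take _ H
  · rintro _ ⟨H, rfl⟩ _ ⟨H', rfl⟩ ⟨h, hH, hH'⟩
    rw [Set.mem_ofPred_eq] at hH hH'
    rcases le_total H.length H'.length with hl | hl
    · refine ⟨H', ?_⟩
      ext h'
      simp only [Set.mem_inter_iff, Set.mem_ofPred_eq]
      refine ⟨fun e => ⟨?_, e⟩, fun e => e.2⟩
      rw [take_eq_of_le hl (e.trans hH'.symm), hH]
    · refine ⟨H, ?_⟩
      ext h'
      simp only [Set.mem_inter_iff, Set.mem_ofPred_eq]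
      refine ⟨fun e => ⟨e, ?_⟩, fun e => e.1⟩
      rw [take_eq_of_le hl (e.trans hH.symm), hH']
  · rintro _ ⟨H, rfl⟩
    exact h H

end History

namespace Market

variable {m : ℕ} (M : Market m)

/-- The law of the primitive randomness under the true parameters. -/
def primitiveLaw : Measure (Primitives m) := Measure.infinitePi fun _ : ℕ => M.roundLaw M.param

instance : IsProbabilityMeasure M.primitiveLaw := by unfold primitiveLaw; infer_instance

variable {M}

/-- However the outcomes are read off the primitives, the probability of a finite history is its
likelihood. -/
theorem primitiveLaw_readHistory {c c' : Fin m → FiniteHistory m → ℕ}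
    (hc : ∀ j, IsClock (·.fits j) (c j)) (hc' : ∀ j, IsClock (·.qualities j) (c' j))
    {s : ConsumerRule m} (hs : ∀ H, Measurable (s H)) (H : FiniteHistory m) :
    M.primitiveLaw {ω | readHistory c c' s ω H.length = H} = M.likelihood s H M.param := by
  have hvalue : ∀ (H : FiniteHistory m) N, H.length ≤ N →
      ∏ i ∈ Finset.range N, M.valueLaw (valueRecord s H i) = M.policyLik s H := by
    intro H
    induction H with
    | nil => intro N _; simp [valueRecord, policyLik]
    | cons h H ih =>
      intro N hN
      rw [List.length_cons] at hN
      have hmem : H.length ∈ Finset.range N := Finset.mem_range.2 hN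
      rw [policyLik, ← ih N (by omega), ← Finset.mul_prod_erase _ _ hmem,
        ← Finset.mul_prod_erase _ (fun i => M.valueLaw (valueRecord s H i)) hmem,
        valueRecord_eq_univ s le_rfl, measure_univ, one_mul, valueRecord, if_pos rfl, mul_comm]
      congr 1
      refine Finset.prod_congr rfl fun i hi => ?_
      rw [valueRecord, if_neg (Finset.ne_of_mem_erase hi)]
  rw [setOf_readHistory_eq hc hc', primitiveLaw,
    Measure.infinitePi_pi _ fun i _ => measurableSet_recordBox hs c c' H i]
  have hbox : ∀ i, M.roundLaw M.param (recordBox c c' s H i) = M.valueLaw (valueRecord s H i) *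
      ∏ j, (obsProb (M.param j).1 (record (·.fits j) (c j) H i) *
        obsProb (M.param j).2 (record (·.qualities j) (c' j) H i)) := fun i => by
    rw [recordBox, roundLaw, Measure.prod_prod, fitQualityLaw_box _
      (fun j => record (·.fits j) (c j) H i) fun j => record (·.qualities j) (c' j) H i]
  simp only [hbox]
  rw [Finset.prod_mul_distrib, hvalue H _ le_rfl, likelihood_eq, Finset.prod_comm]
  congr 1
  refine Finset.prod_congr rfl fun j _ => ?_
  rw [Finset.prod_mul_distrib, prod_obsProb_record (hc j) _ le_rfl,
    prod_obsProb_record (hc' j) _ le_rfl]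

theorem map_readFull_eq {c c' d d' : Fin m → FiniteHistory m → ℕ}
    (hc : ∀ j, IsClock (·.fits j) (c j)) (hc' : ∀ j, IsClock (·.qualities j) (c' j))
    (hd : ∀ j, IsClock (·.fits j) (d j)) (hd' : ∀ j, IsClock (·.qualities j) (d' j))
    {s : ConsumerRule m} (hs : ∀ H, Measurable (s H)) :
    M.primitiveLaw.map (readFull c c' s) = M.primitiveLaw.map (readFull d d' s) := by
  have h₁ := measurable_readFull hc hc' hs
  have h₂ := measurable_readFull hd hd' hs
  have := Measure.isProbabilityMeasure_map (μ := M.primitiveLaw) h₁.aemeasurable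
  have := Measure.isProbabilityMeasure_map (μ := M.primitiveLaw) h₂.aemeasurable
  refine historyMeasure_ext fun H => ?_
  rw [Measure.map_apply h₁ (measurableSet_take _ H), Measure.map_apply h₂ (measurableSet_take _ H)]
  simp only [Set.preimage_ofPred_eq, take_readFull]
  rw [primitiveLaw_readHistory hc hc' hs, primitiveLaw_readHistory hd hd' hs]

/-- The history in which the fit of a business is the outcome at the number of its past inspections,
and its quality realization is the outcome at the number of past transactions with it. -/
abbrev _root_.tapeHistory (s : ConsumerRule m) : Primitives m → ℕ → FiniteHistory m :=
  readHistory (fun j => obsTotal (·.fits j)) (fun j => obsTotal (·.qualities j)) s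

/-- The infinite version of `tapeHistory`. -/
abbrev _root_.tapeFull (s : ConsumerRule m) : Primitives m → History m :=
  readFull (fun j => obsTotal (·.fits j)) (fun j => obsTotal (·.qualities j)) s

theorem map_tapeFull {s : ConsumerRule m} (hs : ∀ H, Measurable (s H)) :
    M.primitiveLaw.map (tapeFull s) = M.historyLaw s := by
  rw [historyLaw, ← primitiveLaw, map_readFull_eq (d := fun _ => List.length)
    (d' := fun _ => List.length) (fun j => isClock_obsTotal _) (fun j => isClock_obsTotal _)
    (fun j => isClock_length _) (fun j => isClock_length _) hs]
  congr 1
  funext ω n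
  have h : ∀ n, readHistory (fun _ => List.length) (fun _ => List.length) s ω n =
      historyUpTo s ω n := by
    intro n
    induction n with
    | zero => rfl
    | succ n ih =>
      rw [readHistory, historyUpTo, readFeedback, length_readHistory, ih]
  rw [readFull, fullHistory, readFeedback, length_readHistory, h]

end Market

/-! ### Almost sure properties of histories -/

namespace Market

variable {m : ℕ} {M : Market m} {s : ConsumerRule m}

theorem primitiveLaw_tapeHistory (hs : ∀ H, Measurable (s H)) (H : FiniteHistory m) :
    M.primitiveLaw {ω | tapeHistory s ω H.length = H} = M.likelihood s H M.param :=
  primitiveLaw_readHistory (fun _ => isClock_obsTotal _) (fun _ => isClock_obsTotal _) hs H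

/-- Almost surely all realized histories have positive likelihood. -/
theorem ae_likelihood_ne_zero (hs : ∀ H, Measurable (s H)) :
    ∀ᵐ ω ∂M.primitiveLaw, ∀ n, M.likelihood s (tapeHistory s ω n) M.param ≠ 0 := by
  have h : ∀ᵐ ω ∂M.primitiveLaw, ∀ H : FiniteHistory m, M.likelihood s H M.param = 0 →
      tapeHistory s ω H.length ≠ H := by
    rw [ae_all_iff]
    intro H
    by_cases hH : M.likelihood s H M.param = 0
    · have := primitiveLaw_tapeHistory (M := M) hs H
      rw [hH] at this
      filter_upwards [measure_eq_zero_iff_ae_notMem.1 this] with ω hω _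
      exact hω
    · exact .of_forall fun ω h => absurd h hH
  filter_upwards [h] with ω hω n hn
  exact hω _ hn (by rw [length_readHistory])

/-- Almost surely the value of a consumer avoids null sets that depend on the history. -/
theorem ae_value_notMem (B : FiniteHistory m → Set ℝ) :
    ∀ᵐ ω ∂M.primitiveLaw, ∀ n H, M.valueLaw (B H) = 0 → (ω n).1 ∉ B H := by
  rw [ae_all_iff]
  intro n
  rw [ae_all_iff]
  intro H
  by_cases hB : M.valueLaw (B H) = 0
  · have hmp : MeasurePreserving (fun ω : Primitives m => (ω n).1) M.primitiveLaw M.valueLaw :=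
      measurePreserving_fst.comp (measurePreserving_eval_infinitePi _ n)
    filter_upwards [hmp.quasiMeasurePreserving.ae (measure_eq_zero_iff_ae_notMem.1 hB)] with ω hω _
    exact hω
  · exact .of_forall fun ω h => absurd h hB

theorem primitiveLaw_tapeHistory_cons (hs : ∀ H, Measurable (s H)) (n : ℕ) (h : Feedback m)
    (H : FiniteHistory m) : M.primitiveLaw {ω | tapeHistory s ω (n + 1) = h :: H} =
      M.primitiveLaw {ω | tapeHistory s ω n = H} *
        M.roundLaw M.param {x | (s H x.1).feedback x.2.1 x.2.2 = h} := by
  by_cases hn : H.length = n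
  · subst hn
    rw [primitiveLaw_tapeHistory hs]
    exact primitiveLaw_tapeHistory hs (h :: H)
  · have h₁ : {ω | tapeHistory s ω (n + 1) = h :: H} = ∅ := by
      ext ω
      simp only [Set.mem_ofPred_eq, Set.mem_empty_iff_false, iff_false]
      intro e
      have := (length_readHistory _ _ s ω (n + 1)).symm.trans (congrArg List.length e)
      rw [List.length_cons] at this
      omega
    have h₂ : {ω | tapeHistory s ω n = H} = ∅ := by
      ext ω
      simp only [Set.mem_ofPred_eq, Set.mem_empty_iff_false, iff_false]
      rintro rfl
      exact hn (length_readHistory _ _ s ω n)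
    rw [h₁, h₂, measure_empty, zero_mul]

/-- The expectation of a function of the history. -/
theorem lintegral_tapeHistory (hs : ∀ H, Measurable (s H)) (z : FiniteHistory m → ℝ≥0∞) (n : ℕ) :
    Measurable (fun ω => z (tapeHistory s ω n)) ∧
    ∫⁻ ω, z (tapeHistory s ω n) ∂M.primitiveLaw =
      ∑' H, z H * M.primitiveLaw {ω | tapeHistory s ω n = H} := by
  let : MeasurableSpace (FiniteHistory m) := ⊤
  have hX : Measurable fun ω => tapeHistory s ω n := measurable_to_countable' fun H =>
    measurableSet_readHistory (fun _ => isClock_obsTotal _) (fun _ => isClock_obsTotal _) hs n H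
  refine ⟨(measurable_from_top (f := z)).comp hX, ?_⟩
  rw [← lintegral_map (measurable_from_top (f := z)) hX, lintegral_countable']
  refine tsum_congr fun H => ?_
  rw [Measure.map_apply hX (measurableSet_singleton H)]
  rfl

/-- A process that is multiplied in each round by factors of conditional expectation at most one. -/
def multiplicative (w : FiniteHistory m → Feedback m → ℝ≥0∞) : FiniteHistory m → ℝ≥0∞
  | [] => 1
  | h :: H => multiplicative w H * w H h

theorem lintegral_multiplicative_le_one (hs : ∀ H, Measurable (s H))
    {w : FiniteHistory m → Feedback m → ℝ≥0∞}
    (hw : ∀ H, ∫⁻ x, w H ((s H x.1).feedback x.2.1 x.2.2) ∂M.roundLaw M.param ≤ 1) (n : ℕ) :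
    ∫⁻ ω, multiplicative w (tapeHistory s ω n) ∂M.primitiveLaw ≤ 1 := by
  induction n with
  | zero => simp [readHistory, multiplicative]
  | succ n ih =>
    refine le_trans ?_ ih
    rw [(lintegral_tapeHistory hs _ _).2, (lintegral_tapeHistory hs _ _).2]
    have hinj : Function.Injective fun z : FiniteHistory m × Feedback m =>
        (z.2 :: z.1 : FiniteHistory m) := by
      rintro ⟨H, h⟩ ⟨H', h'⟩ e
      simp only [List.cons.injEq] at e
      rw [e.1, e.2]
    rw [← hinj.tsum_eq, ENNReal.tsum_prod']
    · refine ENNReal.tsum_le_tsum fun H => ?_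
      simp only [primitiveLaw_tapeHistory_cons hs, multiplicative]
      have hsum : ∑' h, w H h * M.roundLaw M.param {x | (s H x.1).feedback x.2.1 x.2.2 = h} ≤ 1 := by
        refine le_trans (le_of_eq ?_) (hw H)
        rw [← lintegral_map (f := w H) .of_discrete (measurable_feedback hs H),
          lintegral_countable']
        refine tsum_congr fun h => ?_
        rw [Measure.map_apply (measurable_feedback hs H) (measurableSet_singleton h)]
        rfl
      calc _ = ∑' h, multiplicative w H * M.primitiveLaw {ω | tapeHistory s ω n = H} *
            (w H h * M.roundLaw M.param {x | (s H x.1).feedback x.2.1 x.2.2 = h}) :=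
              tsum_congr fun h => by ring
        _ ≤ _ := by
          rw [ENNReal.tsum_mul_left]
          exact mul_le_of_le_one_right' hsum
    · intro H hH
      cases H with
      | cons h H => exact ⟨(H, h), rfl⟩
      | nil =>
        exfalso
        refine hH ?_
        have : {ω | tapeHistory s ω (n + 1) = []} = ∅ := by
          ext ω; simp [readHistory]
        beta_reduce
        rw [this, measure_empty, mul_zero]

/-- If infinitely many rounds have a probability of a type of feedback that is bounded below, then
this feedback is given infinitely often. -/
theorem ae_frequently_feedback (hs : ∀ H, Measurable (s H)) {A : Set (FiniteHistory m)}
    {E : Set (Feedback m)} {ε : ℝ≥0∞} (hε : ε ≠ 0)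
    (hA : ∀ H ∈ A, ε ≤ M.roundLaw M.param {x | (s H x.1).feedback x.2.1 x.2.2 ∈ E}) :
    ∀ᵐ ω ∂M.primitiveLaw, (∃ᶠ n in atTop, tapeHistory s ω n ∈ A) →
      ∃ᶠ n in atTop, tapeFull s ω n ∈ E := by
  classical
  have key : ∀ N : ℕ, ∀ᵐ ω ∂M.primitiveLaw, (∃ᶠ n in atTop, tapeHistory s ω n ∈ A) →
      ∃ n ≥ N, tapeFull s ω n ∈ E := by
    intro N
    set r : ℝ≥0∞ := 1 - ε with hr
    have hr₁ : r < 1 := ENNReal.sub_lt_self ENNReal.one_ne_top one_ne_zero hε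
    let w : FiniteHistory m → Feedback m → ℝ≥0∞ := fun H h =>
      if N ≤ H.length ∧ H ∈ A then (if h ∈ E then 0 else r⁻¹) else 1
    have hw : ∀ H, ∫⁻ x, w H ((s H x.1).feedback x.2.1 x.2.2) ∂M.roundLaw M.param ≤ 1 := by
      intro H
      by_cases hH : N ≤ H.length ∧ H ∈ A
      · have hmeas : MeasurableSet {x : ℝ × (Fin m → Bool) × (Fin m → Bool) |
            (s H x.1).feedback x.2.1 x.2.2 ∈ E} :=
          measurable_feedback hs H (MeasurableSet.of_discrete (s := E))
        have : (fun x : ℝ × (Fin m → Bool) × (Fin m → Bool) =>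
            w H ((s H x.1).feedback x.2.1 x.2.2)) =
            {x | (s H x.1).feedback x.2.1 x.2.2 ∈ E}ᶜ.indicator fun _ => r⁻¹ := by
          funext x
          simp only [w, if_pos hH, Set.indicator_apply, Set.mem_compl_iff, Set.mem_ofPred_eq]
          split_ifs <;> simp_all
        rw [this, lintegral_indicator hmeas.compl, setLIntegral_const, prob_compl_eq_one_sub hmeas]
        calc r⁻¹ * _ ≤ r⁻¹ * r := by
              gcongr
              exact tsub_le_tsub_left (hA H hH.2) 1
          _ ≤ 1 := ENNReal.inv_mul_le_one r
      · simp [w, if_neg hH]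
    have hZ := lintegral_multiplicative_le_one hs hw
    have hmeas : ∀ n, Measurable fun ω => multiplicative w (tapeHistory s ω n) := fun n =>
      (lintegral_tapeHistory (M := M) hs _ n).1
    have hlim : ∫⁻ ω, liminf (fun n => multiplicative w (tapeHistory s ω n)) atTop
        ∂M.primitiveLaw ≤ 1 := by
      refine (lintegral_liminf_le hmeas).trans ?_
      refine (liminf_le_liminf (.of_forall hZ)).trans ?_
      simp
    filter_upwards [ae_lt_top (Measurable.liminf hmeas) (ne_top_of_le_ne_top ENNReal.one_ne_top hlim)]
      with ω hω hfreq
    by_contra! hno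
    have hstep : ∀ n, multiplicative w (tapeHistory s ω (n + 1)) =
        multiplicative w (tapeHistory s ω n) * w (tapeHistory s ω n) (tapeFull s ω n) :=
      fun n => rfl
    have hlen : ∀ n, (tapeHistory s ω n).length = n := length_readHistory _ _ s ω
    have hinv : 1 ≤ r⁻¹ := ENNReal.one_le_inv.2 hr₁.le
    have hfac : ∀ n, w (tapeHistory s ω n) (tapeFull s ω n) =
        if N ≤ n ∧ tapeHistory s ω n ∈ A then r⁻¹ else 1 := by
      intro n
      simp only [w, hlen]
      split_ifs with h₁ h₂
      · exact absurd h₂ (hno n h₁.1)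
      · rfl
      · rfl
    have hmono : Monotone fun n => multiplicative w (tapeHistory s ω n) := by
      refine monotone_nat_of_le_succ fun n => ?_
      rw [hstep, hfac]
      refine le_mul_of_one_le_right' ?_
      split_ifs
      · exact hinv
      · exact le_rfl
    have hgrow : ∀ k : ℕ, ∃ n, r⁻¹ ^ k ≤ multiplicative w (tapeHistory s ω n) := by
      intro k
      induction k with
      | zero =>
        refine ⟨0, ?_⟩
        simp [readHistory, multiplicative]
      | succ k ih =>
        obtain ⟨n, hn⟩ := ih
        obtain ⟨n', hn', hA'⟩ := (frequently_atTop.1 hfreq) (max n N)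
        refine ⟨n' + 1, ?_⟩
        rw [hstep, hfac, if_pos ⟨(le_max_right _ _).trans hn', hA'⟩, pow_succ]
        gcongr
        exact hn.trans (hmono ((le_max_left _ _).trans hn'))
    refine hω.ne (top_le_iff.1 ?_)
    have htop : Tendsto (fun k : ℕ => r⁻¹ ^ k) atTop (𝓝 ∞) :=
      ENNReal.tendsto_pow_atTop_nhds_top_iff.2 (ENNReal.one_lt_inv.2 hr₁)
    refine le_of_tendsto htop (.of_forall fun k => ?_)
    obtain ⟨n, hn⟩ := hgrow k
    refine le_liminf_of_le (by isBoundedDefault) ?_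
    filter_upwards [eventually_ge_atTop n] with n' hn'
    exact hn.trans (hmono hn')
  filter_upwards [ae_all_iff.2 key] with ω hω hfreq
  exact frequently_atTop.2 fun N => hω N hfreq

/-- The set of values with which a consumer transacts with `j` if it is the only fit. -/
def transactValues (s : ConsumerRule m) (H : FiniteHistory m) (j : Fin m) : Set ℝ :=
  {V | ((s H V).run (onlyFit j)).2 = some j}

theorem measurableSet_transactValues (hs : ∀ H, Measurable (s H)) (H : FiniteHistory m)
    (j : Fin m) : MeasurableSet (transactValues s H j) :=
  hs H (MeasurableSet.of_discrete (s := {T : SearchPolicy m | (T.run (onlyFit j)).2 = some j}))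

/-- Almost surely, if there are only finitely many transactions with `j`, then consumers eventually
are unlikely to transact with it. -/
theorem ae_tendsto_transactValues (hs : ∀ H, Measurable (s H)) :
    ∀ᵐ ω ∂M.primitiveLaw, ∀ j, (∀ᶠ n in atTop, (tapeFull s ω n).qualities j = none) →
      Tendsto (fun n => M.valueLaw (transactValues s (tapeHistory s ω n) j)) atTop (𝓝 0) := by
  rw [ae_all_iff]
  intro j
  set δ : ℝ≥0∞ := fitQualityLaw M.param ({onlyFit j} ×ˢ Set.univ) with hδ
  have hδ₀ : δ ≠ 0 := by
    rw [hδ, fitQualityLaw, Measure.prod_prod, measure_univ, mul_one, Measure.pi_singleton,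
      Finset.prod_ne_zero_iff]
    intro k _
    cases onlyFit j k
    · rw [bernoulliMeasure_singleton_false]
      have : ((M.param k).1 : ℝ) < 1 := M.fit_lt_one k
      simpa using this
    · rw [bernoulliMeasure_singleton_true]
      have : (0 : ℝ) < (M.param k).1 := M.fit_pos k
      simpa using this
  have h : ∀ i : ℕ, ∀ᵐ ω ∂M.primitiveLaw,
      (∃ᶠ n in atTop, tapeHistory s ω n ∈
        {H | ((i : ℝ≥0∞) + 1)⁻¹ ≤ M.valueLaw (transactValues s H j)}) →
      ∃ᶠ n in atTop, tapeFull s ω n ∈ {h : Feedback m | h.qualities j ≠ none} := by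
    intro i
    refine ae_frequently_feedback hs (ε := ((i : ℝ≥0∞) + 1)⁻¹ * δ)
      (mul_ne_zero (ENNReal.inv_ne_zero.2 (by finiteness)) hδ₀) fun H hH => ?_
    calc ((i : ℝ≥0∞) + 1)⁻¹ * δ ≤ M.valueLaw (transactValues s H j) * δ := by gcongr; exact hH
      _ = M.roundLaw M.param (transactValues s H j ×ˢ ({onlyFit j} ×ˢ Set.univ)) := by
        rw [roundLaw, Measure.prod_prod]
      _ ≤ _ := by
        refine measure_mono ?_
        rintro ⟨V, F, q⟩ ⟨hV, hF, -⟩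
        have hF' : F = onlyFit j := hF
        subst hF'
        have : ((s H V).feedback (onlyFit j) q).qualities j = some (q j) :=
          SearchPolicy.qualities_feedback.2 ⟨hV, rfl⟩
        simp [this]
  filter_upwards [ae_all_iff.2 h] with ω hω hev
  rw [ENNReal.tendsto_nhds_zero]
  intro ε hε
  obtain ⟨i, hi⟩ := ENNReal.exists_inv_nat_lt hε.ne'
  by_contra hnot
  rw [not_eventually] at hnot
  refine (hω i (hnot.mono fun n hn => ?_)) (hev.mono fun n hn => by simpa using hn)
  refine le_trans ?_ (not_le.1 hn).le
  exact (ENNReal.inv_le_inv.2 (by simp)).trans hi.le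

end Market

/-! ### Frequencies on the tapes -/

/-- The number of the first `k` outcomes on a tape that are equal to `b`. -/
def tapeCount (x : ℕ → Bool) (b : Bool) : ℕ → ℕ
  | 0 => 0
  | k + 1 => tapeCount x b k + if x k = b then 1 else 0

theorem tapeCount_add (x : ℕ → Bool) (k : ℕ) : tapeCount x true k + tapeCount x false k = k := by
  induction k with
  | zero => rfl
  | succ k ih => cases h : x k <;> simp [tapeCount, h] <;> omega

theorem tapeCount_mono (x : ℕ → Bool) (b : Bool) : Monotone (tapeCount x b) :=
  monotone_nat_of_le_succ fun k => by rw [tapeCount]; omega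

/-- A tape whose frequencies converge to `p`, and which is constant if `p` is extreme. -/
structure IsTypical (x : ℕ → Bool) (p : I) : Prop where
  frequency : Tendsto (fun k => (tapeCount x true k : ℝ) / k) atTop (𝓝 p)
  of_zero : p = 0 → ∀ k, tapeCount x true k = 0
  of_one : p = 1 → ∀ k, tapeCount x false k = 0

theorem ae_isTypical {Ω : Type*} [MeasurableSpace Ω] {μ : Measure Ω} [IsProbabilityMeasure μ]
    {φ : Ω → Bool} (hφ : Measurable φ) {p : I} (hp : μ.map φ = bernoulliMeasure true false p) :
    ∀ᵐ ω ∂(Measure.infinitePi fun _ : ℕ => μ), IsTypical (fun i => φ (ω i)) p := by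
  set P := Measure.infinitePi fun _ : ℕ => μ with hP
  have hmap : ∀ i : ℕ, P.map (fun ω => φ (ω i)) = bernoulliMeasure true false p := fun i => by
    rw [← hp, ← (measurePreserving_eval_infinitePi (fun _ : ℕ => μ) i).map_eq,
      Measure.map_map hφ (measurable_pi_apply i)]
    rfl
  have hmeas : ∀ i : ℕ, Measurable fun ω : ℕ → Ω => φ (ω i) := fun i =>
    hφ.comp (measurable_pi_apply i)
  let f : Bool → ℝ := fun b => if b = true then 1 else 0
  have hf : Measurable f := .of_discrete
  have hlaw := strong_law_ae_real (μ := P) (fun i ω => f (φ (ω i)))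
    (Integrable.of_bound (C := 1) (hf.comp (hmeas 0)).aestronglyMeasurable
      (.of_forall fun ω => by simp only [f]; split_ifs <;> simp))
    (fun i j hij => (iIndepFun_infinitePi (P := fun _ : ℕ => μ)
      (X := fun _ => f ∘ φ) fun _ => hf.comp hφ).indepFun hij)
    fun i => ⟨(hf.comp (hmeas i)).aemeasurable, (hf.comp (hmeas 0)).aemeasurable, by
      change P.map (f ∘ fun ω => φ (ω i)) = P.map (f ∘ fun ω => φ (ω 0))
      rw [← Measure.map_map hf (hmeas i), ← Measure.map_map hf (hmeas 0), hmap, hmap]⟩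
  have hmean : ∫ ω, f (φ (ω 0)) ∂P = p := by
    have := integral_map (hmeas 0).aemeasurable (μ := P) (f := f) hf.aestronglyMeasurable
    rw [← this, hmap, integral_bernoulliMeasure]
    simp [f]
  have hconst : ∀ b, bernoulliMeasure true false p {b} = 0 → ∀ᵐ ω ∂P, ∀ i, φ (ω i) ≠ b := by
    intro b hb
    rw [ae_all_iff]
    intro i
    rw [← hmap i, Measure.map_apply (hmeas i) (measurableSet_singleton b)] at hb
    exact measure_eq_zero_iff_ae_notMem.1 hb
  have hzero : ∀ (x : ℕ → Bool) b, (∀ i, x i ≠ b) → ∀ k, tapeCount x b k = 0 := by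
    intro x b hx k
    induction k with
    | zero => rfl
    | succ k ih => rw [tapeCount, ih, if_neg (hx k)]
  have h₀ : ∀ᵐ ω ∂P, p = 0 → ∀ k, tapeCount (fun i => φ (ω i)) true k = 0 := by
    by_cases h : p = 0
    · filter_upwards [hconst true (by rw [bernoulliMeasure_singleton_true, h]; simp)] with ω hω _
      exact hzero _ _ hω
    · exact .of_forall fun ω h' => absurd h' h
  have h₁ : ∀ᵐ ω ∂P, p = 1 → ∀ k, tapeCount (fun i => φ (ω i)) false k = 0 := by
    by_cases h : p = 1
    · filter_upwards [hconst false (by rw [bernoulliMeasure_singleton_false, h]; simp)] with ω hω _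
      exact hzero _ _ hω
    · exact .of_forall fun ω h' => absurd h' h
  filter_upwards [hlaw, h₀, h₁] with ω hω h₀ h₁
  refine ⟨?_, h₀, h₁⟩
  rw [hmean] at hω
  refine hω.congr fun k => ?_
  congr 1
  induction k with
  | zero => simp [tapeCount]
  | succ k ih =>
    rw [Finset.sum_range_succ, ih, tapeCount]
    simp only [f]
    split_ifs <;> simp

namespace Market

variable {m : ℕ} {M : Market m}

/-- The tape of fits of business `j`. -/
def fitTape (ω : Primitives m) (j : Fin m) (i : ℕ) : Bool := (ω i).2.1 j

/-- The tape of quality realizations of business `j`. -/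
def qualityTape (ω : Primitives m) (j : Fin m) (i : ℕ) : Bool := (ω i).2.2 j

theorem ae_isTypical_tapes : ∀ᵐ ω ∂M.primitiveLaw, ∀ j,
    IsTypical (fitTape ω j) (M.param j).1 ∧ IsTypical (qualityTape ω j) (M.param j).2 := by
  rw [ae_all_iff]
  intro j
  have h₁ : MeasurePreserving
      (fun x : ℝ × (Fin m → Bool) × (Fin m → Bool) => x.2.1 j) (M.roundLaw M.param)
      (bernoulliMeasure true false (M.param j).1) :=
    (measurePreserving_eval (fun j => bernoulliMeasure true false (M.param j).1) j).comp
      (measurePreserving_fst.comp measurePreserving_snd)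
  have h₂ : MeasurePreserving
      (fun x : ℝ × (Fin m → Bool) × (Fin m → Bool) => x.2.2 j) (M.roundLaw M.param)
      (bernoulliMeasure true false (M.param j).2) :=
    (measurePreserving_eval (fun j => bernoulliMeasure true false (M.param j).2) j).comp
      (measurePreserving_snd.comp measurePreserving_snd)
  filter_upwards [ae_isTypical h₁.measurable h₁.map_eq, ae_isTypical h₂.measurable h₂.map_eq]
    with ω hω₁ hω₂
  exact ⟨hω₁, hω₂⟩

end Market

/-! ### Comparison of typical paths -/

/-- The posterior after the first `k` outcomes on the tape `x`. -/
def tapePosterior (μ : Measure I) (x : ℕ → Bool) (k : ℕ) : Measure I :=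
  coinPosterior μ (tapeCount x true k) (tapeCount x false k)

section Tape

variable {μ : Measure I} [IsProbabilityMeasure μ] {p : I} {x : ℕ → Bool}

theorem IsTypical.tendsto (hx : IsTypical x p) (hp : p ∈ μ.support) {ε : ℝ} (hε : 0 < ε) :
    Tendsto (fun k => tapePosterior μ x k {y | ε ≤ dist y p}) atTop (𝓝 0) :=
  tendsto_coinPosterior hp (tapeCount_add x) hx.frequency hx.of_zero hx.of_one hε

/-- A belief that converges along some observations converges along more observations. -/
theorem IsTypical.tendsto_of_le (hx : IsTypical x p) (hp : p ∈ μ.support) {κ κ' : ℕ → ℕ}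
    (hκ : Monotone κ) (hκ' : Monotone κ') (hle : ∀ n, ∃ n', κ n ≤ κ' n') {ε : ℝ} (hε : 0 < ε)
    (h : Tendsto (fun n => tapePosterior μ x (κ n) {y | ε ≤ dist y p}) atTop (𝓝 0)) :
    Tendsto (fun n => tapePosterior μ x (κ' n) {y | ε ≤ dist y p}) atTop (𝓝 0) := by
  by_cases hb : ∀ K, ∃ n, K ≤ κ' n
  · exact (hx.tendsto hp hε).comp (tendsto_atTop_atTop_of_monotone hκ' hb)
  · push Not at hb
    obtain ⟨K, hK⟩ := hb
    have hbdd : BddAbove (Set.range κ) := by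
      refine ⟨K, ?_⟩
      rintro _ ⟨n, rfl⟩
      obtain ⟨n', hn'⟩ := hle n
      exact hn'.trans (hK n').le
    obtain ⟨N, hN⟩ := Nat.sSup_mem (Set.range_nonempty κ) hbdd
    have hzero : tapePosterior μ x (κ N) {y | ε ≤ dist y p} = 0 := by
      refine tendsto_nhds_unique (tendsto_const_nhds.congr' ?_) h
      filter_upwards [eventually_ge_atTop N] with n hn
      rw [le_antisymm (hκ hn) (hN ▸ le_csSup hbdd ⟨n, rfl⟩)]
    obtain ⟨N', hN'⟩ := hle N
    refine tendsto_const_nhds.congr' ?_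
    filter_upwards [eventually_ge_atTop N'] with n hn
    exact (coinPosterior_eq_zero_mono (tapeCount_mono x _ (hN'.trans (hκ' hn)))
      (tapeCount_mono x _ (hN'.trans (hκ' hn)))
      (isClosed_le continuous_const (continuous_id.dist continuous_const)).measurableSet
      hzero).symm

end Tape

theorem exists_passage {f : ℕ → ℕ} (h₀ : f 0 = 0) (hf : ∀ n, f (n + 1) ≤ f n + 1) {t n : ℕ}
    (ht : t < f n) : ∃ i, f i = t ∧ f (i + 1) = t + 1 := by
  induction n with
  | zero => omega
  | succ n ih =>
    by_cases h : t < f n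
    · exact ih h
    · exact ⟨n, by have := hf n; omega, by have := hf n; omega⟩

theorem eventually_const_of_bounded {f : ℕ → ℕ} (hf : Monotone f) {K : ℕ} (hK : ∀ n, f n ≤ K) :
    ∃ t ≤ K, ∀ᶠ n in atTop, f n = t := by
  have hbdd : BddAbove (Set.range f) := ⟨K, by rintro _ ⟨n, rfl⟩; exact hK n⟩
  obtain ⟨N, hN⟩ := Nat.sSup_mem (Set.range_nonempty f) hbdd
  refine ⟨f N, hK N, ?_⟩
  filter_upwards [eventually_ge_atTop N] with n hn
  exact le_antisymm (hN ▸ le_csSup hbdd ⟨n, rfl⟩) (hf hn)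

/-- Comparison of the numbers of inspections `k, k'` and transactions `l, l'` of a business in two
markets that share the tape of fits: if the first market never is active in a state in which the
second one gets stuck, then the second one has at least as many observations. -/
theorem exists_le_of_active {k l k' l' φ : ℕ → ℕ} {Act : ℕ → ℕ → Prop} {free : Prop}
    (hφ : Monotone φ) (hk₀ : k 0 = 0) (hk : ∀ n, k (n + 1) ≤ k n + 1) (hφ₀ : φ 0 = 0)
    (hφ₁ : ∀ n, φ (n + 1) ≤ φ n + 1) (hl : ∀ n, l n = φ (k n))
    (hact : ∀ n, k (n + 1) ≠ k n → Act (k n) (l n)) (hk' : Monotone k')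
    (hl' : Monotone l') (hle : ∀ n, l' n ≤ φ (k' n)) (heq : ¬ free → ∀ n, l' n = φ (k' n))
    (hstuck : ∀ κ lam, (∀ᶠ n in atTop, l' n = lam) → (free ∨ ∀ᶠ n in atTop, k' n = κ) →
      ¬ Act κ lam) (n : ℕ) : ∃ n', k n ≤ k' n' ∧ l n ≤ l' n' := by
  by_contra! hno
  by_cases hfree : free
  · have hpass : ∀ lam, (∀ᶠ i in atTop, l' i = lam) → ∀ i, l i ≤ lam := by
      intro lam hlam i
      by_contra! hlt
      have hl₁ : ∀ i, l (i + 1) ≤ l i + 1 := fun i => by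
        rw [hl, hl]
        exact (hφ (hk i)).trans (hφ₁ _)
      obtain ⟨i, hi, hi'⟩ := exists_passage (by rw [hl, hk₀, hφ₀]) hl₁ hlt
      refine hstuck (k i) lam hlam (.inl hfree) (hi ▸ hact i fun h => ?_)
      rw [hl, h, ← hl] at hi'
      omega
    by_cases hex : ∃ n₀, k n ≤ k' n₀
    · obtain ⟨n₀, hn₀⟩ := hex
      have hlt : ∀ i, l' i ≤ l n := fun i => (hl' (le_max_left i n₀)).trans
        (hno _ (hn₀.trans (hk' (le_max_right i n₀)))).le
      obtain ⟨lam, -, hlam⟩ := eventually_const_of_bounded hl' hlt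
      obtain ⟨i, hi, hi'⟩ := (hlam.and (eventually_ge_atTop n₀)).exists
      have := hno i (hn₀.trans (hk' hi'))
      have := hpass lam hlam n
      omega
    · push Not at hex
      obtain ⟨κ, -, hκ⟩ := eventually_const_of_bounded hk' fun i => (hex i).le
      obtain ⟨lam, -, hlam⟩ := eventually_const_of_bounded hl' fun i =>
        (hle i).trans (hφ (hex i).le)
      obtain ⟨i, hi, hi'⟩ := (hlam.and hκ).exists
      obtain ⟨i₁, hi₁, hi₁'⟩ := exists_passage hk₀ hk (t := κ) (n := n) (by
        have := hex i; omega)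
      have h₁ := hpass lam hlam i₁
      have h₂ := hle i
      rw [hl, hi₁] at h₁
      rw [hi'] at h₂
      refine hstuck κ lam hlam (.inl hfree) ?_
      have h₃ := hact i₁ (by omega)
      rwa [hl, hi₁, show φ κ = lam by omega] at h₃
  · have hlt : ∀ i, k' i < k n := fun i => by
      by_contra! h
      have := hno i h
      rw [hl, heq hfree] at this
      exact this.not_ge (hφ h)
    obtain ⟨κ, -, hκ⟩ := eventually_const_of_bounded hk' fun i => (hlt i).le
    obtain ⟨i, hi⟩ := hκ.exists
    obtain ⟨i₁, hi₁, hi₁'⟩ := exists_passage hk₀ hk (t := κ) (n := n) (by have := hlt i; omega)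
    refine hstuck κ (φ κ) (hκ.mono fun i hi => by rw [heq hfree, hi]) (.inr hκ) ?_
    have h₃ := hact i₁ (by omega)
    rwa [hl, hi₁] at h₃

namespace Market

variable {m : ℕ} (M : Market m) {s : ConsumerRule m}

/-- The values with which business `j` has a positive reservation value after the history `H`. -/
def activeValues (H : FiniteHistory m) (j : Fin m) : Set ℝ :=
  {V | V ∈ Set.Icc 0 M.valueBound ∧ 0 < M.index (M.fitMean H) (M.qualityMean H) V j}

variable {M}

theorem IsRational.activeValues_subset (hs : M.IsRational s) {H : FiniteHistory m}
    (hH : M.likelihood s H M.param ≠ 0) (j : Fin m) :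
    M.activeValues H j ⊆ transactValues s H j := fun V hV =>
  (hs.bestResponse H V hV.1).run_onlyFit (expectedUtility_posterior hH V)
    (fun j => (fitMean_mem hH j).1) (fun j => (fitMean_mem hH j).2) hV.2

theorem IsRational.mem_activeValues (hs : M.IsRational s) {H : FiniteHistory m}
    (hH : M.likelihood s H M.param ≠ 0) {V : ℝ} (hV : V ∈ Set.Icc 0 M.valueBound)
    {F : Fin m → Bool} {j : Fin m} (hj : j ∈ ((s H V).run F).1) : V ∈ M.activeValues H j :=
  ⟨hV, (hs.bestResponse H V hV).index_pos (expectedUtility_posterior hH V)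
    (fun j => (fitMean_mem hH j).1) (fun j => (fitMean_mem hH j).2) hj⟩

variable (M s)

/-- The properties of a path of the market that hold almost surely. -/
structure IsTypicalPath (ω : Primitives m) : Prop where
  fits : ∀ j, IsTypical (fitTape ω j) (M.param j).1
  qualities : ∀ j, IsTypical (qualityTape ω j) (M.param j).2
  likelihood_ne_zero : ∀ n, M.likelihood s (tapeHistory s ω n) M.param ≠ 0
  value_mem : ∀ n, (ω n).1 ∈ Set.Icc 0 M.valueBound
  active : ∀ n j, (tapeFull s ω n).fits j ≠ none →
    M.valueLaw (M.activeValues (tapeHistory s ω n) j) ≠ 0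
  recurrent : ∀ j, (∀ᶠ n in atTop, (tapeFull s ω n).qualities j = none) →
    Tendsto (fun n => M.valueLaw (transactValues s (tapeHistory s ω n) j)) atTop (𝓝 0)

variable {M s}

theorem fits_tapeFull (ω : Primitives m) (n : ℕ) {j : Fin m} {b : Bool} :
    (tapeFull s ω n).fits j = some b ↔
      j ∈ ((s (tapeHistory s ω n) (ω n).1).run
        fun j => fitTape ω j (obsTotal (·.fits j) (tapeHistory s ω n))).1 ∧
      fitTape ω j (obsTotal (·.fits j) (tapeHistory s ω n)) = b :=
  SearchPolicy.fits_feedback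

theorem qualities_tapeFull (ω : Primitives m) (n : ℕ) {j : Fin m} {b : Bool} :
    (tapeFull s ω n).qualities j = some b ↔
      ((s (tapeHistory s ω n) (ω n).1).run
        fun j => fitTape ω j (obsTotal (·.fits j) (tapeHistory s ω n))).2 = some j ∧
      qualityTape ω j (obsTotal (·.qualities j) (tapeHistory s ω n)) = b :=
  SearchPolicy.qualities_feedback

theorem IsRational.ae_isTypicalPath (hs : M.IsRational s) :
    ∀ᵐ ω ∂M.primitiveLaw, M.IsTypicalPath s ω := by
  filter_upwards [ae_isTypical_tapes, ae_likelihood_ne_zero hs.measurable,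
    ae_value_notMem (M := M) fun _ => (Set.Icc 0 M.valueBound)ᶜ,
    ae_all_iff.2 fun j => ae_value_notMem (M := M) fun H => M.activeValues H j,
    ae_tendsto_transactValues hs.measurable] with ω h₁ h₂ h₃ h₄ h₅
  have hV : ∀ n, (ω n).1 ∈ Set.Icc 0 M.valueBound := fun n => by
    simpa using h₃ n [] M.valueLaw_bounded
  refine ⟨fun j => (h₁ j).1, fun j => (h₁ j).2, h₂, hV, fun n j hj h => ?_, h₅⟩
  obtain ⟨b, hb⟩ := Option.ne_none_iff_exists'.1 hj
  exact h₄ j n _ h (hs.mem_activeValues (h₂ n) (hV n) ((fits_tapeFull ω n).1 hb).1)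

theorem obsCount_eq_tapeCount {f : Feedback m → Option Bool} {x : ℕ → Bool} {ω : Primitives m}
    (hf : ∀ n b, f (tapeFull s ω n) = some b → x (obsTotal f (tapeHistory s ω n)) = b)
    (n : ℕ) (b : Bool) :
    obsCount f b (tapeHistory s ω n) = tapeCount x b (obsTotal f (tapeHistory s ω n)) := by
  induction n with
  | zero => simp [readHistory, obsCount, obsTotal, tapeCount]
  | succ n ih =>
    have hcons : tapeHistory s ω (n + 1) = tapeFull s ω n :: tapeHistory s ω n := rfl
    rw [hcons, obsTotal_cons, obsCount, ih]
    rcases hb : f (tapeFull s ω n) with _ | b'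
    · simp
    · simp [tapeCount, hf n b' hb]

theorem obsCount_fits (ω : Primitives m) (j : Fin m) (n : ℕ) (b : Bool) :
    obsCount (·.fits j) b (tapeHistory s ω n) =
      tapeCount (fitTape ω j) b (obsTotal (·.fits j) (tapeHistory s ω n)) :=
  obsCount_eq_tapeCount (fun n _ hb => ((fits_tapeFull ω n).1 hb).2) n b

theorem obsCount_qualities (ω : Primitives m) (j : Fin m) (n : ℕ) (b : Bool) :
    obsCount (·.qualities j) b (tapeHistory s ω n) =
      tapeCount (qualityTape ω j) b (obsTotal (·.qualities j) (tapeHistory s ω n)) :=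
  obsCount_eq_tapeCount (fun n _ hb => ((qualities_tapeFull ω n).1 hb).2) n b

theorem fitPosterior_tapeHistory (ω : Primitives m) (j : Fin m) (n : ℕ) :
    M.fitPosterior (tapeHistory s ω n) j = tapePosterior (M.fitPrior j) (fitTape ω j)
      (obsTotal (·.fits j) (tapeHistory s ω n)) := by
  rw [fitPosterior, obsCount_fits, obsCount_fits, tapePosterior]

theorem qualityPosterior_tapeHistory (ω : Primitives m) (j : Fin m) (n : ℕ) :
    M.qualityPosterior (tapeHistory s ω n) j = tapePosterior (M.qualityPrior j) (qualityTape ω j)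
      (obsTotal (·.qualities j) (tapeHistory s ω n)) := by
  rw [qualityPosterior, obsCount_qualities, obsCount_qualities, tapePosterior]

theorem monotone_obsTotal (f : Feedback m → Option Bool) (ω : Primitives m) :
    Monotone fun n => obsTotal f (tapeHistory s ω n) :=
  monotone_nat_of_le_succ fun n => by
    have hcons : tapeHistory s ω (n + 1) = tapeFull s ω n :: tapeHistory s ω n := rfl
    rw [hcons, obsTotal_cons]
    omega

theorem eventually_eq_none {f : Feedback m → Option Bool} {ω : Primitives m} {t : ℕ}
    (h : ∀ᶠ n in atTop, obsTotal f (tapeHistory s ω n) = t) :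
    ∀ᶠ n in atTop, f (tapeFull s ω n) = none := by
  filter_upwards [h, (tendsto_add_atTop_nat 1).eventually h] with n hn hn'
  have hcons : tapeHistory s ω (n + 1) = tapeFull s ω n :: tapeHistory s ω n := rfl
  rw [hcons, obsTotal_cons, hn] at hn'
  by_contra hf
  simp [hf] at hn'

/-- Transactions are successful inspections, and conversely if search is costly. -/
theorem obsTotal_qualities (hs : M.IsRational s) {ω : Primitives m} (hω : M.IsTypicalPath s ω)
    (j : Fin m) (n : ℕ) :
    obsTotal (·.qualities j) (tapeHistory s ω n) ≤
      tapeCount (fitTape ω j) true (obsTotal (·.fits j) (tapeHistory s ω n)) ∧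
    (0 < M.cost → obsTotal (·.qualities j) (tapeHistory s ω n) =
      tapeCount (fitTape ω j) true (obsTotal (·.fits j) (tapeHistory s ω n))) := by
  simp only [← obsCount_fits]
  induction n with
  | zero => simp [readHistory, obsCount, obsTotal]
  | succ n ih =>
    have hcons : tapeHistory s ω (n + 1) = tapeFull s ω n :: tapeHistory s ω n := rfl
    have hbr := hs.bestResponse (tapeHistory s ω n) _ (hω.value_mem n)
    rw [hcons, obsTotal_cons, obsCount]
    have h₁ : (tapeFull s ω n).qualities j ≠ none → (tapeFull s ω n).fits j = some true := by
      intro h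
      obtain ⟨b, hb⟩ := Option.ne_none_iff_exists'.1 h
      have hch := ((qualities_tapeFull ω n).1 hb).1
      have hfit := hbr.transacts_fit _ j hch
      exact (fits_tapeFull ω n).2 ⟨hbr.admissible.choice_mem_run hch, hfit⟩
    have h₂ : 0 < M.cost → (tapeFull s ω n).fits j = some true →
        (tapeFull s ω n).qualities j ≠ none := by
      intro hc h
      obtain ⟨hin, hfit⟩ := (fits_tapeFull ω n).1 h
      have hH := hω.likelihood_ne_zero n
      have hch := hbr.choice_of_fit (expectedUtility_posterior hH _)
        (fun j => (fitMean_mem hH j).1) (fun j => (fitMean_mem hH j).2) hc hin hfit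
      exact Option.ne_none_iff_exists'.2 ⟨_, (qualities_tapeFull ω n).2 ⟨hch, rfl⟩⟩
    constructor
    · have := ih.1
      split_ifs with a b b <;> first | omega | exact absurd (h₁ a) b
    · intro hc
      have := ih.2 hc
      split_ifs with a b b
      · exact absurd a (h₂ hc b)
      · omega
      · omega
      · exact absurd (h₁ a) b

variable (M) in
/-- The probability that business `j` has a positive reservation value in terms of the numbers of
inspections and transactions. -/
def tapeActive (ω : Primitives m) (j : Fin m) (k l : ℕ) : ℝ≥0∞ :=
  M.valueLaw {V | V ∈ Set.Icc 0 M.valueBound ∧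
    0 < V * (∫ p, (p : ℝ) ∂tapePosterior (M.qualityPrior j) (qualityTape ω j) l) - M.price j -
      M.cost / ∫ p, (p : ℝ) ∂tapePosterior (M.fitPrior j) (fitTape ω j) k}

theorem valueLaw_activeValues (ω : Primitives m) (j : Fin m) (n : ℕ) :
    M.valueLaw (M.activeValues (tapeHistory s ω n) j) =
      M.tapeActive ω j (obsTotal (·.fits j) (tapeHistory s ω n))
        (obsTotal (·.qualities j) (tapeHistory s ω n)) := by
  simp only [activeValues, index, fitMean, qualityMean, fitPosterior_tapeHistory,
    qualityPosterior_tapeHistory, tapeActive]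

theorem tapeActive_withCost {c' : ℝ} (hc'₀ : 0 ≤ c') (hc' : c' ≤ M.cost) {ω : Primitives m}
    {j : Fin m} {k l : ℕ} (h : M.tapeActive ω j k l ≠ 0) :
    (M.withCost c' hc'₀).tapeActive ω j k l ≠ 0 := by
  refine fun h' => h (measure_mono_null ?_ h')
  rintro V ⟨hV, hpos⟩
  refine ⟨hV, hpos.trans_le ?_⟩
  refine sub_le_sub_left (div_le_div_of_nonneg_right hc' ?_) _
  exact integral_nonneg fun p => p.2.1

theorem tapeActive_eq_zero_of_stuck (hs : M.IsRational s) {ω : Primitives m}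
    (hω : M.IsTypicalPath s ω) {j : Fin m} {k l : ℕ}
    (hl : ∀ᶠ n in atTop, obsTotal (·.qualities j) (tapeHistory s ω n) = l)
    (hk : M.cost = 0 ∨ ∀ᶠ n in atTop, obsTotal (·.fits j) (tapeHistory s ω n) = k) :
    M.tapeActive ω j k l = 0 := by
  have h := hω.recurrent j (eventually_eq_none (f := fun h => h.qualities j) hl)
  have h' : Tendsto (fun n => M.valueLaw (M.activeValues (tapeHistory s ω n) j)) atTop (𝓝 0) :=
    tendsto_of_tendsto_of_tendsto_of_le_of_le tendsto_const_nhds h (fun _ => zero_le)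
      fun n => measure_mono (hs.activeValues_subset (hω.likelihood_ne_zero n) j)
  refine tendsto_nhds_unique (tendsto_const_nhds.congr' ?_) h'
  rcases hk with hc | hk
  · filter_upwards [hl] with n hn
    rw [valueLaw_activeValues, hn]
    simp [tapeActive, hc]
  · filter_upwards [hl, hk] with n hn hn'
    rw [valueLaw_activeValues, hn, hn']

/-- With a smaller search cost, each business is at least as often inspected and transacted with. -/
theorem exists_obsTotal_le {c' : ℝ} (hc'₀ : 0 ≤ c') (hc' : c' < M.cost) {s' : ConsumerRule m}
    (hs : M.IsRational s) (hs' : (M.withCost c' hc'₀).IsRational s') {ω : Primitives m}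
    (hω : M.IsTypicalPath s ω) (hω' : (M.withCost c' hc'₀).IsTypicalPath s' ω) (j : Fin m)
    (n : ℕ) : ∃ n', obsTotal (·.fits j) (tapeHistory s ω n) ≤
        obsTotal (·.fits j) (tapeHistory s' ω n') ∧
      obsTotal (·.qualities j) (tapeHistory s ω n) ≤
        obsTotal (·.qualities j) (tapeHistory s' ω n') := by
  have hcons : ∀ n, tapeHistory s ω (n + 1) = tapeFull s ω n :: tapeHistory s ω n := fun _ => rfl
  refine exists_le_of_active (φ := tapeCount (fitTape ω j) true) (free := c' = 0)
    (Act := fun k l => M.tapeActive ω j k l ≠ 0)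
    (k := fun n => obsTotal (·.fits j) (tapeHistory s ω n))
    (l := fun n => obsTotal (·.qualities j) (tapeHistory s ω n))
    (k' := fun n => obsTotal (·.fits j) (tapeHistory s' ω n))
    (l' := fun n => obsTotal (·.qualities j) (tapeHistory s' ω n))
    (tapeCount_mono _ _) ?_ (fun n => ?_) rfl (fun k => ?_)
    (fun n => (obsTotal_qualities hs hω j n).2 (hc'₀.trans_lt hc')) (fun n hn => ?_)
    (monotone_obsTotal _ ω) (monotone_obsTotal _ ω) (fun n => (obsTotal_qualities hs' hω' j n).1)
    (fun hfree n => (obsTotal_qualities hs' hω' j n).2 (lt_of_le_of_ne hc'₀ (Ne.symm hfree)))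
    (fun κ lam hlam hκ hact => ?_) n
  · simp [readHistory, obsTotal, obsCount]
  · rw [hcons, obsTotal_cons]
    split_ifs <;> omega
  · rw [tapeCount]
    split_ifs <;> omega
  · rw [← valueLaw_activeValues]
    refine hω.active n j fun h => hn ?_
    simp only [hcons, obsTotal_cons, h, if_true, add_zero]
  · exact tapeActive_withCost hc'₀ hc'.le hact (tapeActive_eq_zero_of_stuck hs' hω' hlam hκ)

/-! ### Learned businesses on typical paths -/

theorem isLearned_iff {ω : Primitives m} (hω : M.IsTypicalPath s ω) (j : Fin m) :
    M.IsLearned s (tapeFull s ω) j ↔ ∀ ε : ℝ, 0 < ε →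
      Tendsto (fun n => tapePosterior (M.fitPrior j) (fitTape ω j)
        (obsTotal (·.fits j) (tapeHistory s ω n)) {p | ε ≤ dist p (M.param j).1}) atTop (𝓝 0) ∧
      Tendsto (fun n => tapePosterior (M.qualityPrior j) (qualityTape ω j)
        (obsTotal (·.qualities j) (tapeHistory s ω n)) {p | ε ≤ dist p (M.param j).2})
        atTop (𝓝 0) := by
  have h := hω.likelihood_ne_zero
  simp only [IsLearned, take_readFull, fitBelief_eq (h _), qualityBelief_eq (h _),
    fitPosterior_tapeHistory, qualityPosterior_tapeHistory]

theorem learnedSet_subset {c' : ℝ} (hc'₀ : 0 ≤ c') (hc' : c' < M.cost) {s' : ConsumerRule m}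
    (hs : M.IsRational s) (hs' : (M.withCost c' hc'₀).IsRational s') {ω : Primitives m}
    (hω : M.IsTypicalPath s ω) (hω' : (M.withCost c' hc'₀).IsTypicalPath s' ω) :
    M.learnedSet s (tapeFull s ω) ⊆ (M.withCost c' hc'₀).learnedSet s' (tapeFull s' ω) := by
  intro j hj
  have hle := exists_obsTotal_le hc'₀ hc' hs hs' hω hω' j
  have hj' := (isLearned_iff hω j).1 hj
  refine (isLearned_iff hω' j).2 fun ε hε => ⟨?_, ?_⟩
  · exact (hω.fits j).tendsto_of_le (M.fit_mem_support j) (monotone_obsTotal _ ω)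
      (monotone_obsTotal _ ω) (fun n => (hle n).imp fun _ h => h.1) hε (hj' ε hε).1
  · exact (hω.qualities j).tendsto_of_le (M.quality_mem_support j) (monotone_obsTotal _ ω)
      (monotone_obsTotal _ ω) (fun n => (hle n).imp fun _ h => h.2) hε (hj' ε hε).2

theorem isLearned_of_tendsto (hs : M.IsRational s) {ω : Primitives m}
    (hω : M.IsTypicalPath s ω) {j : Fin m}
    (h : Tendsto (fun n => obsTotal (·.qualities j) (tapeHistory s ω n)) atTop atTop) :
    M.IsLearned s (tapeFull s ω) j := by
  have h' : Tendsto (fun n => obsTotal (·.fits j) (tapeHistory s ω n)) atTop atTop := by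
    refine tendsto_atTop_mono (fun n => (obsTotal_qualities hs hω j n).1.trans ?_) h
    have := tapeCount_add (fitTape ω j) (obsTotal (·.fits j) (tapeHistory s ω n))
    omega
  exact (isLearned_iff hω j).2 fun ε hε =>
    ⟨((hω.fits j).tendsto (M.fit_mem_support j) hε).comp h',
      ((hω.qualities j).tendsto (M.quality_mem_support j) hε).comp h⟩

end Market

/-! ### Convergence of utilities -/

namespace Market

variable {m : ℕ} (M : Market m) {s : ConsumerRule m}

theorem param_fit_mem (j : Fin m) : M.param.fit j ∈ Set.Icc (0 : ℝ) 1 := (M.param j).1.2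

theorem param_quality_mem (j : Fin m) : M.param.quality j ∈ Set.Icc (0 : ℝ) 1 := (M.param j).2.2

theorem ae_value_mem : ∀ᵐ V ∂M.valueLaw, V ∈ Set.Icc 0 M.valueBound := by
  filter_upwards [measure_eq_zero_iff_ae_notMem.1 M.valueLaw_bounded] with V hV
  simpa using hV

/-- The admissible policies that only use the businesses in `S`. -/
abbrev PolicyIn (S : Set (Fin m)) : Type :=
  {T : SearchPolicy m // T.IsAdmissible ∅ ∧ ∀ F, ∀ j ∈ (T.run F).1, j ∈ S}

instance (S : Set (Fin m)) : Nonempty (PolicyIn S) :=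
  ⟨⟨.halt none, trivial, by simp [SearchPolicy.run]⟩⟩

/-- The optimal expected utility of a consumer with value `V` who knows the parameters. -/
def optimalValue (S : Set (Fin m)) (V : ℝ) : ℝ :=
  ⨆ T : PolicyIn S, M.expectedUtility (Measure.dirac M.param) V T.1

theorem abs_expectedUtility_dirac_le {V : ℝ} (hV : V ∈ Set.Icc 0 M.valueBound)
    (T : SearchPolicy m) : |M.expectedUtility (Measure.dirac M.param) V T| ≤ M.utilityBound := by
  rw [expectedUtility_dirac]
  exact M.abs_meanUtility_le M.param_fit_mem M.param_quality_mem hV T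

theorem bddAbove_expectedUtility (S : Set (Fin m)) {V : ℝ} (hV : V ∈ Set.Icc 0 M.valueBound) :
    BddAbove (Set.range fun T : PolicyIn S =>
      M.expectedUtility (Measure.dirac M.param) V T.1) :=
  ⟨M.utilityBound, by
    rintro _ ⟨T, rfl⟩
    exact (abs_le.1 (M.abs_expectedUtility_dirac_le hV T.1)).2⟩

theorem abs_optimalValue_le (S : Set (Fin m)) {V : ℝ} (hV : V ∈ Set.Icc 0 M.valueBound) :
    |M.optimalValue S V| ≤ M.utilityBound := by
  refine abs_le.2 ⟨?_, ciSup_le fun T => (abs_le.1 (M.abs_expectedUtility_dirac_le hV T.1)).2⟩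
  let T : PolicyIn S := Classical.arbitrary _
  exact (abs_le.1 (M.abs_expectedUtility_dirac_le hV T.1)).1.trans
    (le_ciSup (M.bddAbove_expectedUtility S hV) T)

theorem integrable_optimalValue (S : Set (Fin m)) :
    Integrable (M.optimalValue S) M.valueLaw := by
  refine Integrable.of_bound (C := M.utilityBound) (Measurable.aestronglyMeasurable ?_) ?_
  · refine Measurable.iSup fun T => ?_
    simp only [expectedUtility_dirac]
    exact (M.measurable_meanUtility _ _).comp (measurable_id.prodMk measurable_const)
  · filter_upwards [M.ae_value_mem] with V hV
    exact M.abs_optimalValue_le S hV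

theorem optimalUtility_mono {c' : ℝ} (hc'₀ : 0 ≤ c') (hc' : c' ≤ M.cost) {S S' : Set (Fin m)}
    (hS : S ⊆ S') : M.optimalUtility S ≤ (M.withCost c' hc'₀).optimalUtility S' := by
  refine integral_mono_ae (M.integrable_optimalValue S)
    ((M.withCost c' hc'₀).integrable_optimalValue S') ?_
  filter_upwards [M.ae_value_mem] with V hV
  refine ciSup_le fun T => ?_
  refine le_trans ?_ (le_ciSup ((M.withCost c' hc'₀).bddAbove_expectedUtility S' hV)
    ⟨T.1, T.2.1, fun F j hj => hS (T.2.2 F j hj)⟩)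
  rw [expectedUtility_dirac, expectedUtility_dirac]
  refine Finset.sum_le_sum fun F _ =>
    mul_le_mul_of_nonneg_left ?_ (fitWeight_nonneg M.param_fit_mem F)
  exact sub_le_sub_left (mul_le_mul_of_nonneg_right hc' (Nat.cast_nonneg _)) _

theorem integrable_meanUtility {p q : Fin m → ℝ} (hp : ∀ j, p j ∈ Set.Icc (0 : ℝ) 1)
    (hq : ∀ j, q j ∈ Set.Icc (0 : ℝ) 1) {τ : ℝ → SearchPolicy m} (hτ : Measurable τ) :
    Integrable (fun V => M.meanUtility p q V (τ V)) M.valueLaw := by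
  refine Integrable.of_bound (C := M.utilityBound) (Measurable.aestronglyMeasurable ?_) ?_
  · exact (M.measurable_meanUtility _ _).comp (measurable_id.prodMk hτ)
  · filter_upwards [M.ae_value_mem] with V hV
    exact M.abs_meanUtility_le hp hq hV _

variable {M}

/-- The values with which a business that is not learned is used if it is the only fit. -/
def unlearnedValues (M : Market m) (s : ConsumerRule m) (ω : Primitives m) (n : ℕ) : Set ℝ :=
  ⋃ j ∈ (M.learnedSet s (tapeFull s ω))ᶜ, transactValues s (tapeHistory s ω n) j

theorem tendsto_unlearnedValues (hs : M.IsRational s) {ω : Primitives m}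
    (hω : M.IsTypicalPath s ω) :
    Tendsto (fun n => M.valueLaw (M.unlearnedValues s ω n)) atTop (𝓝 0) := by
  classical
  have hj : ∀ j, Tendsto (fun n => if j ∈ (M.learnedSet s (tapeFull s ω))ᶜ then
      M.valueLaw (transactValues s (tapeHistory s ω n) j) else 0) atTop (𝓝 0) := by
    intro j
    split_ifs with h
    · refine hω.recurrent j ?_
      have hmono := monotone_obsTotal (s := s) (fun h => h.qualities j) ω
      by_cases hb : ∀ K, ∃ n, K ≤ obsTotal (fun h => h.qualities j) (tapeHistory s ω n)
      · exact absurd (isLearned_of_tendsto hs hω (tendsto_atTop_atTop_of_monotone hmono hb)) h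
      · push Not at hb
        obtain ⟨K, hK⟩ := hb
        obtain ⟨t, -, ht⟩ := eventually_const_of_bounded hmono fun n => (hK n).le
        exact eventually_eq_none (f := fun h => h.qualities j) ht
    · exact tendsto_const_nhds
  have hsum := tendsto_finsetSum Finset.univ fun j _ => hj j
  rw [Finset.sum_const_zero] at hsum
  refine tendsto_of_tendsto_of_tendsto_of_le_of_le tendsto_const_nhds hsum (fun _ => zero_le)
    fun n => ?_
  refine (measure_iUnion_fintype_le _ _).trans (Finset.sum_le_sum fun j _ => ?_)
  by_cases h : j ∈ (M.learnedSet s (tapeFull s ω))ᶜ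
  · simp [h]
  · simp [h]

theorem abs_integral_sub_le {μ : Measure ℝ} [IsProbabilityMeasure μ] {f g : ℝ → ℝ}
    (hf : Integrable f μ) (hg : Integrable g μ) {B : Set ℝ} (hB : MeasurableSet B) {e K : ℝ}
    (h : ∀ᵐ x ∂μ, |f x - g x| ≤ e + B.indicator (fun _ => K) x) :
    |∫ x, f x ∂μ - ∫ x, g x ∂μ| ≤ e + μ.real B * K := by
  rw [← integral_sub hf hg]
  refine abs_integral_le_integral_abs.trans ?_
  have hK : Integrable (B.indicator fun _ => K) μ := (integrable_const K).indicator hB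
  refine (integral_mono_ae (hf.sub hg).abs ((integrable_const e).add hK) h).trans_eq ?_
  simp only [Pi.add_apply]
  rw [integral_add (integrable_const e) hK, integral_indicator_const _ hB]
  simp

/-- On a typical path the expected utility of consumers, both under the true parameters and under
their beliefs, converges to the optimal utility with the learned businesses. -/
theorem utilityTendsto_of_isTypicalPath (hs : M.IsRational s) {ω : Primitives m}
    (hω : M.IsTypicalPath s ω) :
    M.UtilityTendsto s (tapeFull s ω) (M.limitUtility s (tapeFull s ω)) := by
  classical
  set L := M.learnedSet s (tapeFull s ω) with hL
  let H : ℕ → FiniteHistory m := tapeHistory s ω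
  have hH : ∀ n, M.likelihood s (H n) M.param ≠ 0 := hω.likelihood_ne_zero
  have hfit : ∀ n j, M.fitMean (H n) j ∈ Set.Icc (0 : ℝ) 1 := fun n j =>
    Set.Ioo_subset_Icc_self (fitMean_mem (hH n) j)
  have hqual : ∀ n j, M.qualityMean (H n) j ∈ Set.Icc (0 : ℝ) 1 := fun n j =>
    qualityMean_mem (hH n) j
  let p : ℕ → Fin m → ℝ := fun n j => if j ∈ L then M.fitMean (H n) j else M.param.fit j
  let q : ℕ → Fin m → ℝ := fun n j => if j ∈ L then M.qualityMean (H n) j else M.param.quality j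
  have hq : ∀ n j, q n j ∈ Set.Icc (0 : ℝ) 1 := fun n j => by
    simp only [q]
    split_ifs
    · exact hqual n j
    · exact M.param_quality_mem j
  let d : ℕ → ℝ := fun n => M.utilityGap (p n) (q n) M.param.fit M.param.quality
  have hd : Tendsto d atTop (𝓝 0) := by
    refine M.tendsto_utilityGap (fun j => ?_) fun j => ?_
    · by_cases hj : j ∈ L
      · simp only [p, if_pos hj]
        refine tendsto_integral_of_tendsto_measure (fun n => fitPosterior_prob (hH n) j)
          fun ε hε => ?_
        refine (hj ε hε).1.congr fun n => ?_
        rw [take_readFull]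
        exact congrArg (fun μ : Measure I => μ _) (fitBelief_eq (hH n) j)
      · simp only [p, if_neg hj]
        exact tendsto_const_nhds
    · by_cases hj : j ∈ L
      · simp only [q, if_pos hj]
        refine tendsto_integral_of_tendsto_measure (fun n => qualityPosterior_prob (hH n) j)
          fun ε hε => ?_
        refine (hj ε hε).2.congr fun n => ?_
        rw [take_readFull]
        exact congrArg (fun μ : Measure I => μ _) (qualityBelief_eq (hH n) j)
      · simp only [q, if_neg hj]
        exact tendsto_const_nhds
  have hcongr : ∀ n V (T : PolicyIn L), M.meanUtility (M.fitMean (H n)) (M.qualityMean (H n)) V T.1 =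
      M.meanUtility (p n) (q n) V T.1 := fun n V T =>
    M.meanUtility_congr T.2.1 T.2.2 (fun j hj => (if_pos hj).symm) fun j hj => (if_pos hj).symm
  have hgap : ∀ n, ∀ V ∈ Set.Icc 0 M.valueBound, ∀ T : PolicyIn L,
      |M.meanUtility (M.fitMean (H n)) (M.qualityMean (H n)) V T.1 -
        M.meanUtility M.param.fit M.param.quality V T.1| ≤ d n := fun n V hV T => by
    rw [hcongr]
    exact M.abs_meanUtility_sub_le M.param_fit_mem (hq n) hV T.1
  have hnear : ∀ n, ∀ V ∈ Set.Icc 0 M.valueBound, V ∉ M.unlearnedValues s ω n →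
      |M.meanUtility (M.fitMean (H n)) (M.qualityMean (H n)) V (s (H n) V) - M.optimalValue L V| ≤
        2 * d n ∧
      |M.meanUtility M.param.fit M.param.quality V (s (H n) V) - M.optimalValue L V| ≤
        2 * d n := by
    intro n V hV hVn
    have hbr := hs.bestResponse (H n) V hV
    let T : PolicyIn L := ⟨s (H n) V, hbr.admissible, fun F j hj => by
      by_contra hjL
      exact hVn (Set.mem_iUnion₂.2 ⟨j, hjL, hs.activeValues_subset (hH n) j
        (hs.mem_activeValues (hH n) hV hj)⟩)⟩
    have h₁ := abs_le.1 (hgap n V hV T)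
    have h₂ : M.meanUtility M.param.fit M.param.quality V (s (H n) V) ≤ M.optimalValue L V := by
      have := le_ciSup (M.bddAbove_expectedUtility L hV) T
      rwa [expectedUtility_dirac] at this
    have h₃ : M.optimalValue L V ≤
        M.meanUtility (M.fitMean (H n)) (M.qualityMean (H n)) V (s (H n) V) + d n := by
      refine ciSup_le fun T' => ?_
      rw [expectedUtility_dirac]
      have h₄ := abs_le.1 (hgap n V hV T')
      have h₅ := hbr.optimal T'.1 T'.2.1
      rw [expectedUtility_posterior (hH n), expectedUtility_posterior (hH n)] at h₅
      linarith [h₄.1]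
    have h₁₁ := h₁.1
    have h₁₂ := h₁.2
    simp only [T] at h₁₁ h₁₂
    constructor <;> rw [abs_le] <;> constructor <;> linarith
  have hmeas : ∀ n, MeasurableSet (M.unlearnedValues s ω n) := fun n =>
    MeasurableSet.biUnion (Set.to_countable _) fun j _ =>
      measurableSet_transactValues hs.measurable _ j
  have hfar : ∀ n (a b : Fin m → ℝ), (∀ j, a j ∈ Set.Icc (0 : ℝ) 1) →
      (∀ j, b j ∈ Set.Icc (0 : ℝ) 1) →
      (∀ V ∈ Set.Icc 0 M.valueBound, V ∉ M.unlearnedValues s ω n →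
        |M.meanUtility a b V (s (H n) V) - M.optimalValue L V| ≤ 2 * d n) →
      |∫ V, M.meanUtility a b V (s (H n) V) ∂M.valueLaw - M.limitUtility s (tapeFull s ω)| ≤
        2 * d n + M.valueLaw.real (M.unlearnedValues s ω n) * (2 * M.utilityBound) := by
    intro n a b ha hb hab
    refine abs_integral_sub_le (M.integrable_meanUtility ha hb (hs.measurable (H n)))
      (M.integrable_optimalValue L) (hmeas n) ?_
    filter_upwards [M.ae_value_mem] with V hV
    by_cases hVn : V ∈ M.unlearnedValues s ω n
    · rw [Set.indicator_of_mem hVn]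
      have h₀ := (abs_nonneg _).trans (hgap n V hV (Classical.arbitrary _))
      have h₁ := abs_le.1 (M.abs_meanUtility_le ha hb hV (s (H n) V))
      have h₂ := abs_le.1 (M.abs_optimalValue_le L hV)
      rw [abs_le]
      constructor <;> linarith [h₁.1, h₁.2, h₂.1, h₂.2]
    · rw [Set.indicator_of_notMem hVn, add_zero]
      exact hab V hV hVn
  have hlim : Tendsto (fun n => 2 * d n + M.valueLaw.real (M.unlearnedValues s ω n) *
      (2 * M.utilityBound)) atTop (𝓝 0) := by
    have := (ENNReal.tendsto_toReal ENNReal.zero_ne_top).comp (tendsto_unlearnedValues hs hω)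
    simpa [measureReal_def] using (hd.const_mul 2).add (this.mul_const (2 * M.utilityBound))
  constructor
  · refine tendsto_iff_dist_tendsto_zero.2 (squeeze_zero (fun _ => dist_nonneg) (fun n => ?_) hlim)
    rw [Real.dist_eq, take_readFull, consumerUtility]
    simp only [expectedUtility_dirac]
    exact hfar n _ _ M.param_fit_mem M.param_quality_mem fun V hV hVn => (hnear n V hV hVn).2
  · refine tendsto_iff_dist_tendsto_zero.2 (squeeze_zero (fun _ => dist_nonneg) (fun n => ?_) hlim)
    rw [Real.dist_eq, take_readFull, consumerUtility]
    rw [show M.posterior s (readHistory (fun j => obsTotal fun h => h.fits j)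
      (fun j => obsTotal fun h => h.qualities j) s ω n) = M.posterior s (H n) from rfl]
    simp only [expectedUtility_posterior (hH n)]
    exact hfar n _ _ (hfit n) (hqual n) fun V hV hVn => (hnear n V hV hVn).1

/-! ### Measurability of long-term outcomes -/

theorem measurable_comp_take {X : Type*} [MeasurableSpace X] (z : FiniteHistory m → X) (n : ℕ) :
    Measurable fun h : History m => z (h.take n) := by
  let : MeasurableSpace (FiniteHistory m) := ⊤
  exact (measurable_from_top (f := z)).comp
    (measurable_to_countable' fun H => measurableSet_take n H)

variable (M s)

theorem isLearned_iff_nat (h : History m) (j : Fin m) : M.IsLearned s h j ↔ ∀ i : ℕ,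
    Tendsto (fun n => M.fitBelief s (h.take n) j {p | 1 / ((i : ℝ) + 1) ≤ dist p (M.param j).1})
      atTop (𝓝 0) ∧
    Tendsto (fun n => M.qualityBelief s (h.take n) j
      {p | 1 / ((i : ℝ) + 1) ≤ dist p (M.param j).2}) atTop (𝓝 0) := by
  refine ⟨fun hj i => hj _ (by positivity), fun hj ε hε => ?_⟩
  obtain ⟨i, hi⟩ := exists_nat_one_div_lt hε
  exact ⟨tendsto_of_tendsto_of_tendsto_of_le_of_le tendsto_const_nhds (hj i).1
      (fun _ => zero_le) fun n => measure_mono fun p hp => hi.le.trans hp,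
    tendsto_of_tendsto_of_tendsto_of_le_of_le tendsto_const_nhds (hj i).2
      (fun _ => zero_le) fun n => measure_mono fun p hp => hi.le.trans hp⟩

theorem measurableSet_isLearned (j : Fin m) : MeasurableSet {h | M.IsLearned s h j} := by
  simp only [isLearned_iff_nat, Set.ofPred_forall, Set.ofPred_and]
  exact .iInter fun i => .inter
    (measurableSet_tendsto (𝓝 0) fun n => measurable_comp_take
      (fun H => M.fitBelief s H j {p | 1 / ((i : ℝ) + 1) ≤ dist p (M.param j).1}) n)
    (measurableSet_tendsto (𝓝 0) fun n => measurable_comp_take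
      (fun H => M.qualityBelief s H j {p | 1 / ((i : ℝ) + 1) ≤ dist p (M.param j).2}) n)

theorem measurable_limitUtility : Measurable (M.limitUtility s) := by
  classical
  let : MeasurableSpace (Set (Fin m)) := ⊤
  refine (measurable_from_top (f := M.optimalUtility)).comp
    (measurable_to_countable' fun S => ?_)
  have : M.learnedSet s ⁻¹' {S} = ⋂ j, if j ∈ S then {h | M.IsLearned s h j}
      else {h | M.IsLearned s h j}ᶜ := by
    ext h
    simp only [Set.mem_preimage, Set.mem_singleton_iff, Set.mem_iInter, Set.ext_iff]
    refine forall_congr' fun j => ?_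
    by_cases hj : j ∈ S <;> simp [hj, learnedSet]
  rw [this]
  refine .iInter fun j => ?_
  split_ifs
  · exact M.measurableSet_isLearned s j
  · exact (M.measurableSet_isLearned s j).compl

theorem measurableSet_utilityTendsto :
    MeasurableSet {h | M.UtilityTendsto s h (M.limitUtility s h)} := by
  have hz : ∀ z : FiniteHistory m → ℝ, MeasurableSet
      {h : History m | Tendsto (fun n => z (h.take n)) atTop (𝓝 (M.limitUtility s h))} := by
    intro z
    have : ∀ h : History m, Tendsto (fun n => z (h.take n)) atTop (𝓝 (M.limitUtility s h)) ↔
        Tendsto (fun n => z (h.take n) - M.limitUtility s h) atTop (𝓝 0) := fun h =>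
      tendsto_sub_nhds_zero_iff.symm
    simp only [this]
    exact measurableSet_tendsto (𝓝 0) fun n =>
      (measurable_comp_take z n).sub (M.measurable_limitUtility s)
  exact (hz fun H => M.consumerUtility s (Measure.dirac M.param) H).inter
    (hz fun H => M.consumerUtility s (M.posterior s H) H)

end Market

end

theorem mainTheorem1 {m : ℕ} (M : Market m) (c' : ℝ) (hc'_nonneg : 0 ≤ c') (hc' : c' < M.cost)
    (s s' : ConsumerRule m) (hs : M.IsRational s)
    (hs' : (M.withCost c' hc'_nonneg).IsRational s') :
    ∃ γ : Measure (History m × History m),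
      γ.map Prod.fst = M.historyLaw s ∧
      γ.map Prod.snd = (M.withCost c' hc'_nonneg).historyLaw s' ∧
      ∀ᵐ h ∂γ,
        M.learnedSet s h.1 ⊆ (M.withCost c' hc'_nonneg).learnedSet s' h.2 ∧
        M.limitUtility s h.1 ≤ (M.withCost c' hc'_nonneg).limitUtility s' h.2 ∧
        M.UtilityTendsto s h.1 (M.limitUtility s h.1) ∧
        (M.withCost c' hc'_nonneg).UtilityTendsto s' h.2
          ((M.withCost c' hc'_nonneg).limitUtility s' h.2) := by
  set M' := M.withCost c' hc'_nonneg with hM'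
  have h₁ : Measurable (tapeFull s) :=
    measurable_readFull (fun _ => isClock_obsTotal _) (fun _ => isClock_obsTotal _) hs.measurable
  have h₂ : Measurable (tapeFull s') :=
    measurable_readFull (fun _ => isClock_obsTotal _) (fun _ => isClock_obsTotal _) hs'.measurable
  have h₁₂ : Measurable fun ω => (tapeFull s ω, tapeFull s' ω) := h₁.prodMk h₂
  refine ⟨M.primitiveLaw.map fun ω => (tapeFull s ω, tapeFull s' ω), ?_, ?_, ?_⟩
  · rw [Measure.map_map measurable_fst h₁₂]
    exact Market.map_tapeFull hs.measurable
  · rw [Measure.map_map measurable_snd h₁₂]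
    exact Market.map_tapeFull (M := M') hs'.measurable
  · have hsubset : MeasurableSet {h : History m × History m |
        M.learnedSet s h.1 ⊆ M'.learnedSet s' h.2} := by
      have : {h : History m × History m | M.learnedSet s h.1 ⊆ M'.learnedSet s' h.2} =
          ⋂ j, ((Prod.fst ⁻¹' {h | M.IsLearned s h j})ᶜ ∪
            Prod.snd ⁻¹' {h | M'.IsLearned s' h j}) := by
        ext h
        simp only [Market.learnedSet, Set.mem_ofPred_eq, Set.subset_def, Set.mem_iInter,
          Set.mem_union, Set.mem_compl_iff, Set.mem_preimage, imp_iff_not_or]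
      rw [this]
      exact .iInter fun j => (measurable_fst (M.measurableSet_isLearned s j)).compl.union
        (measurable_snd (M'.measurableSet_isLearned s' j))
    have hmeas : MeasurableSet {h : History m × History m |
        M.learnedSet s h.1 ⊆ M'.learnedSet s' h.2 ∧
        M.limitUtility s h.1 ≤ M'.limitUtility s' h.2 ∧
        M.UtilityTendsto s h.1 (M.limitUtility s h.1) ∧
        M'.UtilityTendsto s' h.2 (M'.limitUtility s' h.2)} := by
      refine hsubset.inter (.inter ?_ (.inter ?_ ?_))
      · exact measurableSet_le ((M.measurable_limitUtility s).comp measurable_fst)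
          ((M'.measurable_limitUtility s').comp measurable_snd)
      · exact measurable_fst (M.measurableSet_utilityTendsto s)
      · exact measurable_snd (M'.measurableSet_utilityTendsto s')
    rw [ae_map_iff h₁₂.aemeasurable hmeas]
    have hω' : ∀ᵐ ω ∂M.primitiveLaw, M'.IsTypicalPath s' ω := hs'.ae_isTypicalPath
    filter_upwards [hs.ae_isTypicalPath, hω'] with ω hω hω'
    have hsub := Market.learnedSet_subset hc'_nonneg hc' hs hs' hω hω'
    exact ⟨hsub, M.optimalUtility_mono hc'_nonneg hc'.le hsub,
      Market.utilityTendsto_of_isTypicalPath hs hω,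
      Market.utilityTendsto_of_isTypicalPath hs' hω'⟩
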